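/- **Setting.** $K$ queues are served by one server in slots $t=1,2,\dots$. With $\mathbf Q_0=\mathbf 0$, the queue lengths evolve by $Q_{t,i}=\max\{Q_{t-1,i}+A_{t,i}-S_{t,i}\mathbb 1[i=a_t],0\}$, where $a_t\in[K]$ is the type served in slot $t$. The random vectors $\mathbf A_t\sim\mathcal A_t$ and $\mathbf S_t\sim\mathcal S_t$ ($t\ge 1$) are independent, the distributions $\mathcal A_t,\mathcal S_t$ on $\mathbb R_+^K$ are fixed in advance, $\vec\lambda_t$ and $\vec\sigma_t$ are their means, and $\mathbf A_t,\mathbf S_t$ are independent of everything that happened before slot $t$. Let $\triangle^{[K]}$ be the probability simplex and $\triangle^{[K],\beta}=\{\mathbf x\in\triangle^{[K]}: x_i\ge\beta\ \forall i\}$. **Assumptions.** 1. (Piecewise stabilizability) There are $C_W\ge 0$, $\epsilon>0$, $\vec\theta_1,\vec\theta_2,\ldots\in\triangle^{[K]}$ and a partition of $\{1,2,\dots\}$ into intervals $W_0,W_1,\dots$ such that $\sum_{i:\min W_i<T}(|W_i|-1)^2\le C_WT$ for all $T\ge1$, and $\frac1{|W_i|}\sum_{t\in W_i}\theta_{t,j}\sigma_{t,j}\ge\epsilon+\frac1{|W_i|}\sum_{t\in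 W_i}\lambda_{t,j}$ for all $i\ge 0$, $j\in[K]$. 2. (Time-homogeneous variation) There are $0<\delta\le 1$ and $C_V>0$ with $\sum_{t=T_0+1}^{T_0+T-1}\|\vec\theta_{t+1}-\vec\theta_t\|_1\le C_VT^{1-\delta}$ for all $T_0\ge0$, $T\ge1$. 3. (Bounded moments) There are $\alpha\ge2$ and $M\ge1$ with $\mathbb E[A_{t,i}^\alpha],\ \mathbb E[S_{t,i}^\alpha]\le M^\alpha$ for all $t\ge 1$, $i\in[K]$. **Algorithm SSMW+** (inputs $M$, $K$, $\delta$). It runs in epochs. An epoch that begins after time $T_0$ (the first one has $T_0=0$) lasts for $m=\max\{\lceil\|\mathbf Q_{T_0}\|_\infty/(2M)\rceil,1\}$ slots. With $\beta=m^{-3}/K$, $\eta=(4M^3Km^{1+2\delta/3})^{-1}$ and $\gamma=m^{\delta/3}KM\eta\|\mathbf Q_{T_0}\|_\infty$, it starts from an arbitrary $\mathbf x_1\in\triangle^{[K],\beta}$ (which may depend on the past), and for $\tau=1,\dots,m$, with $t=T_0+\tau$: - it samples $a_t$, given the past and independently of $\mathbf A_t,\mathbf S_t$, from $\mathbf p_\tau=(1-\gamma)\mathbf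 x_\tau+\gamma\mathbf 1/K$, and observes $S_{t,a_t}$; - it sets $g_t=Q_{t-1,a_t}S_{t,a_t}$ if this number is at most $m^{\delta/3}M\|\mathbf Q_{T_0}\|_\infty$, and $g_t=0$ otherwise; - it sets $\mathbf x_{\tau+1}=\arg\min_{\mathbf x'\in\triangle^{[K],\beta}}\langle-\eta\tilde{\mathbf g}_t,\mathbf x'\rangle+D_\Psi(\mathbf x',\mathbf x_\tau)$, where $\tilde{\mathbf g}_t$ is $g_t/p_{\tau,a_t}$ in coordinate $a_t$ and $0$ elsewhere, and $D_\Psi$ is the Bregman divergence of $\Psi(\mathbf x)=\sum_i(x_i\ln x_i-x_i)$. **Theorem.** Under Assumptions 1, 2 and 3, let $$f(m)=42(1+C_V)M^2Km^{-\delta/3}(3\ln m+\ln K),\qquad m_0=\min\{m\in\mathbb N: m\ge2,\ f(m')\le\epsilon/2\ \ \forall\, m'\ge m\},$$ which exists. Then all $\mathbb E\|\mathbf Q_t\|_1$ are finite, and if $C_W>0$, SSMW+ guarantees, for every integer $T\ge\frac4{C_W}+C_W$, $$\frac1T\,\mathbb E\Big[\sum_{t=1}^T\|\mathbf Q_t\|_1\Big]\le\Big[3KM^2m_0+\frac{(K+1)M^2}2+(KM^2+\epsilon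 KM)C_W+4M^2\Big]\cdot\frac{10}\epsilon .$$ In particular (also if $C_W=0$) the system is stable: $\frac1T\sum_{t=0}^{T-1}\sum_{i=1}^K\mathbb E[Q_{t,i}]$ is bounded uniformly in $T\ge1$. Moreover, there is an absolute constant $c>0$ such that, whenever $K\ge2$, with $B=(1+C_V)M^2K\ln K\,\epsilon^{-1}$, $$m_0\le\max\{B,1/\delta\}^{c/\delta};$$ that is, $m_0\le B^{O(1/\delta)}$ as soon as $B\ge1/\delta$. -/

import Mathlib

open MeasureTheory ProbabilityTheory

noncomputable section

/-! ### The queueing system -/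

/-- Queue lengths `Q_t` at the end of slot `t` on one sample path, given arrivals `A t`, potential
services `S t` and served types `a t` in the slots `t = 1, 2, …` (index `0` is not used):
`Q_0 = 0`, `Q_{t,i} = max (Q_{t-1,i} + A_{t,i} - S_{t,i} 𝟙[i = a_t]) 0`. -/
def queueLength {K : ℕ} (A S : ℕ → Fin K → ℝ) (a : ℕ → Fin K) : ℕ → Fin K → ℝ
  | 0 => 0
  | t + 1 => fun i =>
      max (queueLength A S a t i + A (t + 1) i - if i = a (t + 1) then S (t + 1) i else 0) 0

/-- The mean vector of a distribution on `ℝ^K`. -/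
def meanVec {K : ℕ} (μ : Measure (Fin K → ℝ)) : Fin K → ℝ := fun i => ∫ x, x i ∂μ

/-- A probability distribution on `ℝ_+^K` whose coordinates have `α`-th moment at most `M ^ α`. -/
structure HasBoundedMoments {K : ℕ} (α M : ℝ) (μ : Measure (Fin K → ℝ)) : Prop where
  prob : IsProbabilityMeasure μ
  nonneg : ∀ᵐ x ∂μ, ∀ i, 0 ≤ x i
  moment : ∀ i, ∫⁻ x, ENNReal.ofReal (x i ^ α) ∂μ ≤ ENNReal.ofReal (M ^ α)

/-- Piecewise stabilizability. The slots `1, 2, …` are partitioned into the consecutive nonempty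
intervals `W_i = [w i, w (i + 1))`; note that `w i < T` forces `i < T`, so that the
sum in `windows` runs over all windows that start before `T`. -/
structure PiecewiseStabilizable {K : ℕ} (lam sig θ : ℕ → Fin K → ℝ) (w : ℕ → ℕ)
    (C_W ε : ℝ) : Prop where
  C_nonneg : 0 ≤ C_W
  eps_pos : 0 < ε
  mem_simplex : ∀ t, 1 ≤ t → θ t ∈ stdSimplex ℝ (Fin K)
  start : w 0 = 1
  strictMono : StrictMono w
  windows : ∀ T : ℕ, 1 ≤ T →
    ∑ i ∈ (Finset.range T).filter (fun i => w i < T),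
      (((w (i + 1) - w i : ℕ) : ℝ) - 1) ^ 2 ≤ C_W * T
  drift : ∀ (i : ℕ) (j : Fin K),
    ε + (1 / ((w (i + 1) - w i : ℕ) : ℝ)) * ∑ t ∈ Finset.Ico (w i) (w (i + 1)), lam t j ≤
      (1 / ((w (i + 1) - w i : ℕ) : ℝ)) *
        ∑ t ∈ Finset.Ico (w i) (w (i + 1)), θ t j * sig t j

/-- Time-homogeneous stationarity of the reference policy: over any `T` consecutive slots
`T₀ + 1, …, T₀ + T` the total `ℓ¹`-variation is at most `C_V T ^ (1 - δ)`. -/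
def TimeHomogeneousVariation {K : ℕ} (θ : ℕ → Fin K → ℝ) (C_V δ : ℝ) : Prop :=
  ∀ T₀ T : ℕ, 1 ≤ T →
    ∑ t ∈ Finset.Ico (T₀ + 1) (T₀ + T), ∑ i, |θ (t + 1) i - θ t i| ≤ C_V * (T : ℝ) ^ (1 - δ)

/-! ### The building block `EXP3.S+` -/

/-- The simplex `Δ^{[K],β}` of the probability vectors with all coordinates at least `β`. -/
def truncSimplex (K : ℕ) (β : ℝ) : Set (Fin K → ℝ) :=
  {x | x ∈ stdSimplex ℝ (Fin K) ∧ ∀ i, β ≤ x i}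

/-- `Ψ(x) = ∑ i, (x_i ln x_i - x_i)`. -/
def negEntropy {K : ℕ} (x : Fin K → ℝ) : ℝ := ∑ i, (x i * Real.log (x i) - x i)

/-- The Bregman divergence `D_f(y, x) = f(y) - f(x) - ⟨∇f(x), y - x⟩`. -/
def bregman {K : ℕ} (f : (Fin K → ℝ) → ℝ) (y x : Fin K → ℝ) : ℝ :=
  f y - f x - fderiv ℝ f x (y - x)

/-- The mixed action with explicit exploration, `(1 - γ) x + γ e`. -/
def exp3Play {K : ℕ} (γ : ℝ) (e x : Fin K → ℝ) : Fin K → ℝ := (1 - γ) • x + γ • e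

/-- The importance weighted feedback: `g / p_a` in the coordinate `a`, and `0` elsewhere. -/
def exp3Estimate {K : ℕ} (p : Fin K → ℝ) (a : Fin K) (g : ℝ) : Fin K → ℝ :=
  Pi.single a (g / p a)

/-- The mirror step `argmin_{y ∈ Δ^{[K],β}} ⟨-η g̃, y⟩ + D_Ψ(y, x)` (for `0 < β ≤ 1 / K` and
`x ∈ Δ^{[K],β}` the minimizer exists and is unique). -/
def exp3Step {K : ℕ} (β η : ℝ) (gEst x : Fin K → ℝ) : Fin K → ℝ :=
  Classical.epsilon fun y => y ∈ truncSimplex K β ∧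
    IsMinOn (fun z => (-η • gEst) ⬝ᵥ z + bregman negEntropy z x) (truncSimplex K β) y

/-! ### `SSMW+`: parameters

Below `q` stands for the queue vector `Q_{T₀}` at the start of an epoch. Note that `‖q‖` is the
sup norm. -/

/-- The length of an epoch, `m = max ⌈‖Q_{T₀}‖_∞ / (2 M)⌉ 1`. -/
def epochLen {K : ℕ} (M : ℝ) (q : Fin K → ℝ) : ℕ := max ⌈‖q‖ / (2 * M)⌉₊ 1

/-- `β = m ^ (-3) / K`. -/
def floorRate {K : ℕ} (M : ℝ) (q : Fin K → ℝ) : ℝ := ((epochLen M q : ℝ) ^ 3)⁻¹ / K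

/-- `η = (4 M³ K m ^ (1 + 2 δ / 3))⁻¹`. -/
def learnRate {K : ℕ} (M δ : ℝ) (q : Fin K → ℝ) : ℝ :=
  (4 * M ^ 3 * K * (epochLen M q : ℝ) ^ (1 + 2 / 3 * δ))⁻¹

/-- `γ = m ^ (δ / 3) K M η ‖Q_{T₀}‖_∞`. -/
def exploreRate {K : ℕ} (M δ : ℝ) (q : Fin K → ℝ) : ℝ :=
  (epochLen M q : ℝ) ^ (δ / 3) * K * M * learnRate M δ q * ‖q‖

/-- The feedback fed to `EXP3.S+`: the raw value `r = Q_{t-1,a_t} S_{t,a_t}` if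
`r ≤ m ^ (δ / 3) M ‖Q_{T₀}‖_∞`, and `0` otherwise. -/
def clipFeedback {K : ℕ} (M δ : ℝ) (q : Fin K → ℝ) (r : ℝ) : ℝ :=
  if r ≤ (epochLen M q : ℝ) ^ (δ / 3) * M * ‖q‖ then r else 0

/-! ### `SSMW+`: the algorithm on one sample path -/

/-- `epochStart M Q t` is the time `T₀` after which the epoch containing slot `t + 1` begins: it
starts at `0`, and a new epoch begins as soon as the current one has run for its full length. -/
def epochStart {K : ℕ} (M : ℝ) (Q : ℕ → Fin K → ℝ) : ℕ → ℕ
  | 0 => 0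
  | t + 1 =>
      if t + 1 = epochStart M Q t + epochLen M (Q (epochStart M Q t)) then t + 1
      else epochStart M Q t

/-- The queue vector at the start of the epoch containing slot `t + 1`. -/
def epochQueue {K : ℕ} (M : ℝ) (Q : ℕ → Fin K → ℝ) (t : ℕ) : Fin K → ℝ :=
  Q (epochStart M Q t)

/-- The distribution of the served type in slot `t + 1`, when the current `EXP3.S+` instance is in
the state `x`; the exploration vector is uniform. -/
def playFrom {K : ℕ} (M δ : ℝ) (Q : ℕ → Fin K → ℝ) (t : ℕ) (x : Fin K → ℝ) : Fin K → ℝ :=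
  exp3Play (exploreRate M δ (epochQueue M Q t)) (fun _ => 1 / (K : ℝ)) x

/-- The state `x` of the current `EXP3.S+` instance that is used in slot `t + 1`. An instance that
begins after time `T₀` is initialized with `ξ T₀`; otherwise the state is updated
with the clipped feedback of slot `t + 1`. -/
def mixedAction {K : ℕ} (M δ : ℝ) (Q S : ℕ → Fin K → ℝ) (a : ℕ → Fin K)
    (ξ : ℕ → Fin K → ℝ) : ℕ → Fin K → ℝ
  | 0 => ξ 0
  | t + 1 =>
      if epochStart M Q (t + 1) = t + 1 then ξ (t + 1)
      else
        exp3Step (floorRate M (epochQueue M Q t)) (learnRate M δ (epochQueue M Q t))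
          (exp3Estimate (playFrom M δ Q t (mixedAction M δ Q S a ξ t)) (a (t + 1))
            (clipFeedback M δ (epochQueue M Q t)
              (Q t (a (t + 1)) * S (t + 1) (a (t + 1)))))
          (mixedAction M δ Q S a ξ t)

/-- The distribution `p_{t+1}` from which `SSMW+` samples the type served in slot `t + 1`. -/
def playProb {K : ℕ} (M δ : ℝ) (Q S : ℕ → Fin K → ℝ) (a : ℕ → Fin K)
    (ξ : ℕ → Fin K → ℝ) (t : ℕ) : Fin K → ℝ :=
  playFrom M δ Q t (mixedAction M δ Q S a ξ t)

/-! ### The random system controlled by `SSMW+` -/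

section Run

variable {Ω : Type*} {K : ℕ}

/-- The queue lengths as random vectors. -/
def queueProc (A S : ℕ → Ω → Fin K → ℝ) (a : ℕ → Ω → Fin K) (t : ℕ) (ω : Ω) : Fin K → ℝ :=
  queueLength (fun s => A s ω) (fun s => S s ω) (fun s => a s ω) t

/-- The `σ`-algebra generated by all arrivals, services and decisions of the slots `1, …, t`. -/
abbrev history (A S : ℕ → Ω → Fin K → ℝ) (a : ℕ → Ω → Fin K) (t : ℕ) : MeasurableSpace Ω :=
  ⨆ s ∈ Finset.Icc 1 t, (MeasurableSpace.comap (A s) inferInstance ⊔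
    MeasurableSpace.comap (S s) inferInstance ⊔ MeasurableSpace.comap (a s) inferInstance)

/-- The random sequences `A`, `S`, `a` form a system scheduled by `SSMW+` with arrival
distributions `𝒜 t` and service distributions `𝒮 t`. The vectors `A_t`, `S_t` of each slot are
independent of each other and of the past, and, given the past and `A_t`, `S_t`, the decision `a_t`
is sampled from the distribution prescribed by the algorithm. The initial states `ξ T₀` of the
`EXP3.S+` instances may be any elements of the truncated simplex, chosen from the past. -/
structure IsSSMWPlusRun [MeasurableSpace Ω] (P : Measure Ω) (M δ : ℝ)
    (𝒜 𝒮 : ℕ → Measure (Fin K → ℝ)) (A S : ℕ → Ω → Fin K → ℝ) (a : ℕ → Ω → Fin K)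
    (ξ : ℕ → Ω → Fin K → ℝ) : Prop where
  measurable_arrival : ∀ t, 1 ≤ t → Measurable (A t)
  measurable_service : ∀ t, 1 ≤ t → Measurable (S t)
  measurable_action : ∀ t, 1 ≤ t → Measurable (a t)
  law_arrival : ∀ t, 1 ≤ t → P.map (A t) = 𝒜 t
  law_service : ∀ t, 1 ≤ t → P.map (S t) = 𝒮 t
  indep_arrival_service : ∀ t, 1 ≤ t → IndepFun (A t) (S t) P
  indep_past : ∀ t, Indep (history A S a t)
    (MeasurableSpace.comap (A (t + 1)) inferInstance ⊔
      MeasurableSpace.comap (S (t + 1)) inferInstance) P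
  measurable_init : ∀ t, Measurable[history A S a t] (ξ t)
  init_mem : ∀ t ω, ξ t ω ∈ truncSimplex K (floorRate M (queueProc A S a t ω))
  action_law : ∀ (t : ℕ) (i : Fin K),
    P[(a (t + 1) ⁻¹' {i}).indicator (fun _ => (1 : ℝ)) | history A S a t ⊔
        (MeasurableSpace.comap (A (t + 1)) inferInstance ⊔
          MeasurableSpace.comap (S (t + 1)) inferInstance)]
      =ᵐ[P] fun ω => playProb M δ (fun s => queueProc A S a s ω) (fun s => S s ω)
        (fun s => a s ω) (fun s => ξ s ω) t i

/-- The expected total queue length `E ‖Q_t‖₁`. -/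
def expTotalQueue [MeasurableSpace Ω] (P : Measure Ω) (A S : ℕ → Ω → Fin K → ℝ)
    (a : ℕ → Ω → Fin K) (t : ℕ) : ℝ :=
  ∫ ω, ∑ i, |queueProc A S a t ω i| ∂P

end Run

/-- `f(m) = 42 (1 + C_V) M² K m ^ (-δ / 3) (3 ln m + ln K)`. -/
def ssmwRate (K : ℕ) (M δ C_V : ℝ) (m : ℕ) : ℝ :=
  42 * (1 + C_V) * M ^ 2 * K * (m : ℝ) ^ (-δ / 3) * (3 * Real.log m + Real.log K)

end

/-! The proof is a drift analysis of V_t = ½ Σ_i Q_{t,i}² in which the quality of the scheduling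
enters as the regret of a bandit algorithm. One slot (`lyapunov_drift`) raises E V by at most Σ_i E
Q_{t,i} (λ_i - θ_i σ_i), plus the expected regret of the slot against the reference policy θ, plus
(K+1)M²/2. Over whole windows the first term adds up to at most -ε Σ E‖Q_t‖₁ and an error controlled
by C_W, because a mean queue length moves by at most M per slot (`window_bound`, `sum_windows_le`).
It remains to show that the regret consumes at most half of this negative drift
(`sum_slotRegret_le`).

The regret is estimated separately on each event B that an epoch of length m begins after time s
(`epochEvent`). This event is decided at time s, so later arrivals and services are independent of
it, and integrals over B take the place of conditional expectations. On B the norm of Q_s lies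
between 2M(m-1) and 2Mm. Over the epoch each queue grows, and the maximal queue shrinks, by at most
M per slot on average, so the maximal queue stays of order Mm. The upper bounds control the second
moments of the feedback and lead to a regret of at most (2/7) f(m) M m² P(B) (`epoch_regret_le`).
The lower bounds show that the queue lengths summed over the epoch are at least (3/2) M m(m-1) P(B).
When m ≥ m₀, so that f(m) ≤ ε/2, the fraction ε/2 of this sum pays for the regret. Shorter epochs
cost at most 3M²m₀ per slot. An epoch cut off by the horizon T has not collected enough queue
length, but then Q_T is still of order Mm and the regret is at most the integral of V_T over the
event (`epoch_balance`). The resulting total E V_T is exactly what the summed drift inequality has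
on its left side, so it cancels in `sum_expTotalQueue_le`.

Inside an epoch the algorithm is entropic mirror descent against a moving comparator. Exploration
keeps η times the estimated gain in [0,1]. The errors are the initial entropy together with the path
length of θ, the variance and the loss by clipping (both through second moments only), and the
exploration. With r = m^{δ/3} each is of order at most m²/r up to the factor 3 ln m + ln K
(`epoch_error_le`); this is the shape of f. For the size of m₀, half of the decay m^{-δ/3} is spent
on the logarithm (`ssmwRate_le`). -/

/-! ### Entropic mirror descent on the truncated simplex -/

section Entropy

variable {K : ℕ} {β : ℝ}

theorem isCompact_truncSimplex : IsCompact (truncSimplex K β) := by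
  have h : truncSimplex K β = stdSimplex ℝ (Fin K) ∩ ⋂ i, {x | β ≤ x i} := by
    ext x; simp [truncSimplex]
  rw [h]
  refine (isCompact_stdSimplex ℝ (Fin K)).inter_right (isClosed_iInter fun i => ?_)
  exact isClosed_le continuous_const (continuous_apply i)

theorem convex_truncSimplex : Convex ℝ (truncSimplex K β) := by
  intro x hx y hy a b ha hb hab
  refine ⟨convex_stdSimplex ℝ (Fin K) hx.1 hy.1 ha hb hab, fun i => ?_⟩
  simp only [Pi.add_apply, Pi.smul_apply, smul_eq_mul]
  have h1 := mul_le_mul_of_nonneg_left (hx.2 i) ha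
  have h2 := mul_le_mul_of_nonneg_left (hy.2 i) hb
  have h3 : a * β + b * β = β := by rw [← add_mul, hab, one_mul]
  linarith

theorem le_one_of_mem_stdSimplex {x : Fin K → ℝ} (hx : x ∈ stdSimplex ℝ (Fin K)) (i : Fin K) :
    x i ≤ 1 := by
  rw [← hx.2]
  exact Finset.single_le_sum (fun j _ => hx.1 j) (Finset.mem_univ i)

theorem continuous_negEntropy : Continuous (negEntropy (K := K)) := by
  unfold negEntropy
  refine continuous_finsetSum _ fun i _ => ?_
  exact (Real.continuous_mul_log.comp (continuous_apply i)).sub (continuous_apply i)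

/-- The derivative of the negative entropy is the coordinatewise logarithm. -/
theorem hasFDerivAt_negEntropy {x : Fin K → ℝ} (hx : ∀ i, x i ≠ 0) :
    HasFDerivAt negEntropy
      (∑ i, Real.log (x i) • (ContinuousLinearMap.proj i : (Fin K → ℝ) →L[ℝ] ℝ)) x := by
  unfold negEntropy
  refine HasFDerivAt.fun_sum fun i _ => ?_
  have h1 : HasDerivAt (fun r : ℝ => r * Real.log r - r) (Real.log (x i)) (x i) := by
    simpa using (Real.hasDerivAt_mul_log (hx i)).fun_sub (hasDerivAt_id' (x i))
  exact h1.comp_hasFDerivAt x (ContinuousLinearMap.proj i : (Fin K → ℝ) →L[ℝ] ℝ).hasFDerivAt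

theorem bregman_negEntropy {x : Fin K → ℝ} (hx : ∀ i, x i ≠ 0) (y : Fin K → ℝ) :
    bregman negEntropy y x =
      negEntropy y - negEntropy x - ∑ i, Real.log (x i) * (y i - x i) := by
  simp [bregman, (hasFDerivAt_negEntropy hx).fderiv]

/-- A minimizer of `Ψ(z) - ⟨v, z⟩` over the truncated simplex. -/
noncomputable def entropicArgmin (β : ℝ) (v : Fin K → ℝ) : Fin K → ℝ :=
  Classical.epsilon fun y => y ∈ truncSimplex K β ∧
    IsMinOn (fun z => negEntropy z - ∑ i, v i * z i) (truncSimplex K β) y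

theorem entropicArgmin_spec (hne : (truncSimplex K β).Nonempty) (v : Fin K → ℝ) :
    entropicArgmin β v ∈ truncSimplex K β ∧
      IsMinOn (fun z => negEntropy z - ∑ i, v i * z i) (truncSimplex K β)
        (entropicArgmin β v) := by
  refine Classical.epsilon_spec (p := fun y => y ∈ truncSimplex K β ∧
    IsMinOn (fun z => negEntropy z - ∑ i, v i * z i) (truncSimplex K β) y) ?_
  obtain ⟨y, hy, hmin⟩ := (isCompact_truncSimplex (K := K) (β := β)).exists_isMinOn hne
    (f := fun z => negEntropy z - ∑ i, v i * z i)
    (continuous_negEntropy.sub (by fun_prop)).continuousOn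
  exact ⟨y, hy, hmin⟩

/-- The two objectives differ by a constant in z, so both sides are the same choice from the same
predicate; uniqueness of the minimizer is not needed. The mirror step thereby depends on the past
only through one vector. -/
theorem exp3Step_eq_entropicArgmin {x : Fin K → ℝ} (hx : ∀ i, x i ≠ 0) (η : ℝ)
    (g : Fin K → ℝ) :
    exp3Step β η g x = entropicArgmin β (fun i => Real.log (x i) + η * g i) := by
  have hobj : ∀ z, (-η • g) ⬝ᵥ z + bregman negEntropy z x =
      (negEntropy z - ∑ i, (Real.log (x i) + η * g i) * z i) +
        (∑ i, Real.log (x i) * x i - negEntropy x) := by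
    intro z
    rw [bregman_negEntropy hx]
    simp only [dotProduct, Pi.smul_apply, smul_eq_mul, mul_sub, add_mul, Finset.sum_sub_distrib,
      Finset.sum_add_distrib, neg_mul, Finset.sum_neg_distrib]
    ring
  unfold exp3Step entropicArgmin
  congr 1
  funext y
  simp only [hobj, isMinOn_iff, add_le_add_iff_right]

/-- The first order optimality condition of `entropicArgmin`. -/
theorem entropicArgmin_variational (hβ : 0 < β) (v : Fin K → ℝ) {u : Fin K → ℝ}
    (hu : u ∈ truncSimplex K β) :
    0 ≤ ∑ i, (Real.log (entropicArgmin β v i) - v i) * (u i - entropicArgmin β v i) := by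
  obtain ⟨hy, hmin⟩ := entropicArgmin_spec ⟨u, hu⟩ v
  set y := entropicArgmin β v
  have hy0 : ∀ i, y i ≠ 0 := fun i => (hβ.trans_le (hy.2 i)).ne'
  have hlin : HasFDerivAt (fun z : Fin K → ℝ => ∑ i, v i * z i)
      (∑ i, v i • (ContinuousLinearMap.proj i : (Fin K → ℝ) →L[ℝ] ℝ)) y := by
    refine HasFDerivAt.fun_sum fun i _ => ?_
    exact (ContinuousLinearMap.proj i : (Fin K → ℝ) →L[ℝ] ℝ).hasFDerivAt.const_mul (v i)
  have h := IsLocalMinOn.hasFDerivWithinAt_nonneg hmin.localize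
    ((hasFDerivAt_negEntropy hy0).sub hlin).hasFDerivWithinAt
    (mem_posTangentConeAt_of_segment_subset (y := u - y) (by
      rw [add_sub_cancel]; exact convex_truncSimplex.segment_subset hy hu))
  simpa [sub_mul, Finset.sum_sub_distrib] using h

/-- The derivative of the logarithm is at least 1 on (0,1]; in other words the entropy is strongly
convex there with constant 1. -/
theorem sq_sub_le_log_sub_mul_sub {r s : ℝ} (hr : 0 < r) (hr1 : r ≤ 1) (hs : 0 < s)
    (hs1 : s ≤ 1) : (r - s) ^ 2 ≤ (Real.log r - Real.log s) * (r - s) := by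
  wlog h : s ≤ r generalizing r s
  · have := this hs hs1 hr hr1 (le_of_not_ge h)
    nlinarith
  have h1 : r - s ≤ Real.log r - Real.log s := by
    have h2 := Real.one_sub_inv_le_log_of_pos (div_pos hr hs)
    rw [Real.log_div hr.ne' hs.ne', inv_div] at h2
    have h3 : r - s ≤ 1 - s / r := by
      rw [one_sub_div hr.ne', le_div_iff₀ hr]
      nlinarith
    linarith
  nlinarith

/-- Strong convexity makes the minimizer Lipschitz in the linear term. The purpose is measurability:
the minimizer is defined by choice, and its continuity makes the states of the algorithm random
variables. -/
theorem lipschitzWith_entropicArgmin (hβ : 0 < β) (hne : (truncSimplex K β).Nonempty) :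
    LipschitzWith K (entropicArgmin (K := K) β) := by
  refine LipschitzWith.of_dist_le_mul fun v v' => ?_
  have hy := (entropicArgmin_spec hne v).1
  have hy' := (entropicArgmin_spec hne v').1
  have h1 := entropicArgmin_variational hβ v hy'
  have h2 := entropicArgmin_variational hβ v' hy
  set y := entropicArgmin β v
  set y' := entropicArgmin β v'
  simp only [dist_eq_norm]
  -- Each minimizer is tested against the other and the two optimality conditions are added.
  have h3 : ∑ i, (y i - y' i) ^ 2 ≤ ∑ i, (v i - v' i) * (y i - y' i) := by
    have h4 : ∑ i, (y i - y' i) ^ 2 ≤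
        ∑ i, (Real.log (y i) - Real.log (y' i)) * (y i - y' i) :=
      Finset.sum_le_sum fun i _ => sq_sub_le_log_sub_mul_sub (hβ.trans_le (hy.2 i))
        (le_one_of_mem_stdSimplex hy.1 i) (hβ.trans_le (hy'.2 i))
        (le_one_of_mem_stdSimplex hy'.1 i)
    have h5 : ∑ i, (v i - v' i) * (y i - y' i) -
        ∑ i, (Real.log (y i) - Real.log (y' i)) * (y i - y' i) =
        (∑ i, (Real.log (y i) - v i) * (y' i - y i)) +
          ∑ i, (Real.log (y' i) - v' i) * (y i - y' i) := by
      rw [← Finset.sum_sub_distrib, ← Finset.sum_add_distrib]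
      exact Finset.sum_congr rfl fun i _ => by ring
    linarith
  have h6 : ∑ i, (v i - v' i) * (y i - y' i) ≤ K * (‖v - v'‖ * ‖y - y'‖) := by
    have : ∑ i : Fin K, (v i - v' i) * (y i - y' i) ≤ ∑ _i : Fin K, ‖v - v'‖ * ‖y - y'‖ := by
      refine Finset.sum_le_sum fun i _ => (le_abs_self _).trans ?_
      rw [abs_mul]
      exact mul_le_mul (norm_le_pi_norm (v - v') i) (norm_le_pi_norm (y - y') i)
        (abs_nonneg _) (norm_nonneg _)
    simpa using this
  have h7 : ‖y - y'‖ ^ 2 ≤ ∑ i, (y i - y' i) ^ 2 := by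
    have hs : 0 ≤ ∑ i, (y i - y' i) ^ 2 := Finset.sum_nonneg fun i _ => sq_nonneg _
    rw [← Real.sq_sqrt hs]
    refine pow_le_pow_left₀ (norm_nonneg _) ?_ 2
    rw [pi_norm_le_iff_of_nonneg (Real.sqrt_nonneg _)]
    intro i
    refine Real.abs_le_sqrt ?_
    exact Finset.single_le_sum (f := fun i => (y i - y' i) ^ 2) (fun j _ => sq_nonneg _)
      (Finset.mem_univ i)
  rcases (norm_nonneg (y - y')).eq_or_lt with h0 | h0
  · rw [← h0]; positivity
  · have h8 : ‖y - y'‖ * ‖y - y'‖ ≤ (K * ‖v - v'‖) * ‖y - y'‖ := by nlinarith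
    simpa using le_of_mul_le_mul_right h8 h0

/-- The generalized relative entropy, which is the Bregman divergence of `negEntropy`. -/
noncomputable def relEntropy (u x : Fin K → ℝ) : ℝ :=
  ∑ i, (u i * (Real.log (u i) - Real.log (x i)) - u i + x i)

theorem relEntropy_nonneg {u x : Fin K → ℝ} (hu : ∀ i, 0 < u i) (hx : ∀ i, 0 < x i) :
    0 ≤ relEntropy u x := by
  refine Finset.sum_nonneg fun i _ => ?_
  have h := Real.one_sub_inv_le_log_of_pos (div_pos (hu i) (hx i))
  rw [Real.log_div (hu i).ne' (hx i).ne', inv_div] at h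
  have h2 := mul_le_mul_of_nonneg_left h (hu i).le
  have h3 : u i * (1 - x i / u i) = u i - x i := by
    have := (hu i).ne'
    field_simp
  linarith

theorem neg_log_le_of_mem_truncSimplex (hβ : 0 < β) {x : Fin K → ℝ} (hx : x ∈ truncSimplex K β)
    (i : Fin K) : -Real.log (x i) ≤ Real.log (1 / β) := by
  rw [one_div, Real.log_inv]
  exact neg_le_neg (Real.log_le_log hβ (hx.2 i))

theorem log_nonpos_of_mem_truncSimplex (hβ : 0 < β) {x : Fin K → ℝ}
    (hx : x ∈ truncSimplex K β) (i : Fin K) : Real.log (x i) ≤ 0 :=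
  Real.log_nonpos (hβ.le.trans (hx.2 i)) (le_one_of_mem_stdSimplex hx.1 i)

theorem relEntropy_le (hβ : 0 < β) {u x : Fin K → ℝ} (hu : u ∈ truncSimplex K β)
    (hx : x ∈ truncSimplex K β) : relEntropy u x ≤ Real.log (1 / β) := by
  have h1 : relEntropy u x = ∑ i, u i * (Real.log (u i) - Real.log (x i)) := by
    simp only [relEntropy, Finset.sum_add_distrib, Finset.sum_sub_distrib, hu.1.2, hx.1.2]
    ring
  have h2 : ∑ i, u i * (Real.log (u i) - Real.log (x i)) ≤ ∑ i, u i * Real.log (1 / β) := by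
    refine Finset.sum_le_sum fun i _ => mul_le_mul_of_nonneg_left ?_ (hu.1.1 i)
    have := neg_log_le_of_mem_truncSimplex hβ hx i
    have := log_nonpos_of_mem_truncSimplex hβ hu i
    linarith
  rwa [← Finset.sum_mul, hu.1.2, one_mul, ← h1] at h2

/-- The relative entropy is Lipschitz in its first argument. -/
theorem relEntropy_sub_le (hβ : 0 < β) {u u' x : Fin K → ℝ} (hu : u ∈ truncSimplex K β)
    (hu' : u' ∈ truncSimplex K β) (hx : x ∈ truncSimplex K β) :
    relEntropy u x - relEntropy u' x ≤ Real.log (1 / β) * ∑ i, |u i - u' i| := by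
  have h0 : 0 ≤ relEntropy u' u := relEntropy_nonneg (fun i => hβ.trans_le (hu'.2 i))
    (fun i => hβ.trans_le (hu.2 i))
  -- The three-point identity of Bregman divergences; the last divergence is nonnegative and can be
  -- dropped.
  have h1 : relEntropy u x - relEntropy u' x =
      ∑ i, (Real.log (u i) - Real.log (x i)) * (u i - u' i) - relEntropy u' u := by
    simp only [relEntropy]
    rw [← Finset.sum_sub_distrib, ← Finset.sum_sub_distrib]
    exact Finset.sum_congr rfl fun i _ => by ring
  have h2 : ∑ i, (Real.log (u i) - Real.log (x i)) * (u i - u' i) ≤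
      ∑ i, Real.log (1 / β) * |u i - u' i| := by
    refine Finset.sum_le_sum fun i _ => (le_abs_self _).trans ?_
    rw [abs_mul]
    refine mul_le_mul_of_nonneg_right ?_ (abs_nonneg _)
    have a1 := neg_log_le_of_mem_truncSimplex hβ hx i
    have a2 := log_nonpos_of_mem_truncSimplex hβ hu i
    have a3 := neg_log_le_of_mem_truncSimplex hβ hu i
    have a4 := log_nonpos_of_mem_truncSimplex hβ hx i
    rw [abs_le]
    constructor <;> linarith
  rw [← Finset.mul_sum] at h2
  linarith

/-- One step of entropic mirror descent with gains `w ∈ [0, 1]`. -/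
theorem entropicArgmin_regret (hβ : 0 < β) {x u w : Fin K → ℝ}
    (hx : x ∈ truncSimplex K β) (hu : u ∈ truncSimplex K β) (hw : ∀ i, 0 ≤ w i)
    (hw1 : ∀ i, w i ≤ 1) :
    ∑ i, w i * (u i - x i) ≤ relEntropy u x -
      relEntropy u (entropicArgmin β fun i => Real.log (x i) + w i) + ∑ i, x i * w i ^ 2 := by
  have hy := (entropicArgmin_spec ⟨u, hu⟩ fun i => Real.log (x i) + w i).1
  have hv := entropicArgmin_variational hβ (fun i => Real.log (x i) + w i) hu
  set y := entropicArgmin β fun i => Real.log (x i) + w i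
  -- With the optimality condition added to the left side the inequality holds coordinate by
  -- coordinate. There it reduces to Fenchel-Young for r ln r - r (`h2`) and exp w ≤ 1 + w + w²,
  -- which is where w ≤ 1 is used (`h1`).
  suffices h : ∑ i, w i * (u i - x i) + ∑ i, (Real.log (y i) - (Real.log (x i) + w i)) *
      (u i - y i) ≤ relEntropy u x - relEntropy u y + ∑ i, x i * w i ^ 2 by linarith
  simp only [relEntropy]
  rw [← Finset.sum_add_distrib, ← Finset.sum_sub_distrib, ← Finset.sum_add_distrib]
  refine Finset.sum_le_sum fun i _ => ?_
  have hxi := hβ.trans_le (hx.2 i)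
  have hyi := hβ.trans_le (hy.2 i)
  have h1 : Real.exp (w i) ≤ 1 + w i + w i ^ 2 := by
    have := (abs_le.1 (Real.abs_exp_sub_one_sub_id_le (x := w i)
      (abs_le.2 ⟨by linarith [hw i], hw1 i⟩))).2
    linarith
  have h2 : y i * (w i - (Real.log (y i) - Real.log (x i)) + 1) ≤ x i * Real.exp (w i) := by
    have h3 := Real.add_one_le_exp (w i - (Real.log (y i) - Real.log (x i)))
    have h4 : Real.exp (w i - (Real.log (y i) - Real.log (x i))) =
        Real.exp (w i) * x i / y i := by
      rw [Real.exp_sub, Real.exp_sub, Real.exp_log hxi, Real.exp_log hyi]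
      field_simp
    rw [h4, le_div_iff₀ hyi] at h3
    linarith
  have h5 := mul_le_mul_of_nonneg_left h1 hxi.le
  linarith

end Entropy

/-! ### Parameters of an epoch -/

section Parameters

variable {K : ℕ} {M : ℝ}

theorem one_le_epochLen (q : Fin K → ℝ) : 1 ≤ epochLen M q := le_max_right _ _

theorem floorRate_pos (hK : 0 < K) (q : Fin K → ℝ) : 0 < floorRate M q := by
  have h1 : (0 : ℝ) < epochLen M q := by exact_mod_cast one_le_epochLen q
  have h2 : (0 : ℝ) < K := by exact_mod_cast hK
  unfold floorRate
  positivity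

/-- With `epochLen_le_norm` this pins the initial queue of an epoch of length m between 2M(m-1) and
2Mm: the upper half bounds the feedback, the lower half lets the queues of the epoch pay for its
regret. -/
theorem norm_le_epochLen (hM : 0 < M) (q : Fin K → ℝ) : ‖q‖ ≤ 2 * M * epochLen M q := by
  have h1 : ‖q‖ / (2 * M) ≤ epochLen M q :=
    (Nat.le_ceil _).trans (by exact_mod_cast le_max_left _ _)
  rw [div_le_iff₀ (by positivity)] at h1
  linarith

theorem epochLen_le_norm (hM : 0 < M) {q : Fin K → ℝ} (h : 2 ≤ epochLen M q) :
    2 * M * ((epochLen M q : ℝ) - 1) ≤ ‖q‖ := by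
  have h1 : epochLen M q = ⌈‖q‖ / (2 * M)⌉₊ := by
    unfold epochLen at h ⊢
    omega
  have h2 := Nat.ceil_lt_add_one (a := ‖q‖ / (2 * M)) (by positivity)
  rw [← h1] at h2
  have h3 : (epochLen M q : ℝ) - 1 ≤ ‖q‖ / (2 * M) := by linarith
  rw [le_div_iff₀ (by positivity)] at h3
  linarith

theorem truncSimplex_nonempty (hK : 0 < K) {n : ℕ} (hn : 1 ≤ n) :
    (truncSimplex K (((n : ℝ) ^ 3)⁻¹ / K)).Nonempty := by
  have hK' : (0 : ℝ) < K := by exact_mod_cast hK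
  have hn' : (1 : ℝ) ≤ (n : ℝ) ^ 3 := one_le_pow₀ (by exact_mod_cast hn)
  refine ⟨fun _ => 1 / K, ⟨fun i => by positivity, ?_⟩, fun i => ?_⟩
  · simp [hK'.ne']
  · exact div_le_div_of_nonneg_right (inv_le_one_of_one_le₀ hn') hK'.le

theorem measurable_epochLen : Measurable (epochLen (K := K) M) := by
  unfold epochLen
  exact (Nat.measurable_ceil.comp (measurable_norm.div_const _)).max measurable_const

theorem epochStart_le (Q : ℕ → Fin K → ℝ) (t : ℕ) : epochStart M Q t ≤ t := by
  induction t with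
  | zero => simp [epochStart]
  | succ t ih => simp only [epochStart]; split_ifs <;> omega

theorem epochStart_lt_add (Q : ℕ → Fin K → ℝ) (t : ℕ) :
    t < epochStart M Q t + epochLen M (Q (epochStart M Q t)) := by
  induction t with
  | zero => have := one_le_epochLen (M := M) (Q (epochStart M Q 0)); omega
  | succ t ih =>
    simp only [epochStart]
    split_ifs with h
    · have := one_le_epochLen (M := M) (Q (t + 1)); omega
    · omega

theorem epochStart_succ_of_ne {Q : ℕ → Fin K → ℝ} {t : ℕ} (h : epochStart M Q (t + 1) ≠ t + 1) :
    epochStart M Q (t + 1) = epochStart M Q t := by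
  simp only [epochStart] at h ⊢
  split_ifs at h ⊢ <;> simp_all

theorem epochStart_self {Q : ℕ → Fin K → ℝ} {s t : ℕ} (h : epochStart M Q t = s) :
    epochStart M Q s = s := by
  induction t with
  | zero => subst h; simp [epochStart]
  | succ t ih =>
    by_cases h1 : epochStart M Q (t + 1) = t + 1
    · rw [h1] at h; subst h; exact h1
    · exact ih ((epochStart_succ_of_ne h1).symm.trans h)

/-- The extent of an epoch is known at its beginning. On the event fixing its start and length,
random epochs become deterministic ranges of slots. -/
theorem epochStart_add_eq_iff {Q : ℕ → Fin K → ℝ} {s : ℕ} (h : epochStart M Q s = s) (k : ℕ) :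
    epochStart M Q (s + k) = s ↔ k < epochLen M (Q s) := by
  constructor
  · intro hk
    have := epochStart_lt_add (M := M) Q (s + k)
    rw [hk] at this
    omega
  · intro hk
    induction k with
    | zero => exact h
    | succ k ih =>
      have ih := ih (by omega)
      rw [← add_assoc]
      simp only [epochStart, ih]
      rw [if_neg (by omega)]

end Parameters

/-! ### Measurability of the run -/

section Measurability

variable {Ω : Type*} {m : MeasurableSpace Ω} {K : ℕ} {M δ : ℝ}

theorem measurable_random_index {Q : ℕ → Ω → Fin K → ℝ} {t : ℕ} (hQ : ∀ s ≤ t, Measurable (Q s))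
    {n : Ω → ℕ} (hn : Measurable n) (hnt : ∀ ω, n ω ≤ t) : Measurable fun ω => Q (n ω) ω := by
  -- The minimum cuts off the indices beyond t, for which no measurability is assumed.
  have h1 : Measurable fun p : ℕ × Ω => Q (min p.1 t) p.2 :=
    measurable_from_prod_countable_right fun n => hQ _ (min_le_right n t)
  have h2 : (fun ω => Q (n ω) ω) = (fun p : ℕ × Ω => Q (min p.1 t) p.2) ∘
      fun ω => (n ω, id ω) := by
    funext ω
    simp [min_eq_left (hnt ω)]
  rw [h2]
  exact h1.comp (hn.prodMk measurable_id)

theorem measurable_epochStart {Q : ℕ → Ω → Fin K → ℝ} {t : ℕ} (hQ : ∀ s ≤ t, Measurable (Q s)) :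
    Measurable fun ω => epochStart M (fun s => Q s ω) t := by
  induction t with
  | zero => exact measurable_const
  | succ t ih =>
    have hQ' : ∀ s ≤ t, Measurable (Q s) := fun s hs => hQ s (by omega)
    have ih := ih hQ'
    have hq := measurable_random_index hQ' ih fun _ => epochStart_le (M := M) _ t
    simp only [epochStart]
    refine Measurable.ite ?_ measurable_const ih
    exact measurableSet_eq_fun measurable_const (ih.add (measurable_epochLen.comp hq))

theorem measurable_epochQueue {Q : ℕ → Ω → Fin K → ℝ} {t : ℕ} (hQ : ∀ s ≤ t, Measurable (Q s)) :
    Measurable fun ω => epochQueue M (fun s => Q s ω) t :=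
  measurable_random_index hQ (measurable_epochStart hQ) fun _ => epochStart_le (M := M) _ t

theorem mixedAction_succ_of_ne {Q S : ℕ → Fin K → ℝ} {a : ℕ → Fin K} {ξ : ℕ → Fin K → ℝ} {t : ℕ}
    (h : epochStart M Q (t + 1) ≠ t + 1) :
    mixedAction M δ Q S a ξ (t + 1) =
      exp3Step (floorRate M (epochQueue M Q t)) (learnRate M δ (epochQueue M Q t))
        (exp3Estimate (playProb M δ Q S a ξ t) (a (t + 1))
          (clipFeedback M δ (epochQueue M Q t) (Q t (a (t + 1)) * S (t + 1) (a (t + 1)))))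
        (mixedAction M δ Q S a ξ t) := by
  simp only [mixedAction, if_neg h, playProb]

theorem mixedAction_mem (hK : 0 < K) {Q S : ℕ → Fin K → ℝ} {a : ℕ → Fin K} {ξ : ℕ → Fin K → ℝ}
    (hξ : ∀ t, ξ t ∈ truncSimplex K (floorRate M (Q t))) (t : ℕ) :
    mixedAction M δ Q S a ξ t ∈ truncSimplex K (floorRate M (epochQueue M Q t)) := by
  induction t with
  | zero => exact hξ 0
  | succ t ih =>
    by_cases h : epochStart M Q (t + 1) = t + 1
    · simp only [mixedAction, epochQueue, h]
      exact hξ (t + 1)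
    · rw [mixedAction_succ_of_ne h, exp3Step_eq_entropicArgmin]
      · have : epochQueue M Q (t + 1) = epochQueue M Q t := by
          simp only [epochQueue, epochStart_succ_of_ne h]
        rw [this]
        exact (entropicArgmin_spec ⟨_, ih⟩ _).1
      · exact fun i => ((floorRate_pos hK _).trans_le (ih.2 i)).ne'

theorem measurable_playFrom {Q : ℕ → Ω → Fin K → ℝ} {x : Ω → Fin K → ℝ} {t : ℕ}
    (hQ : ∀ s ≤ t, Measurable (Q s)) (hx : Measurable x) :
    Measurable fun ω => playFrom M δ (fun s => Q s ω) t (x ω) := by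
  have hq := measurable_epochQueue (M := M) hQ
  have hl : Measurable fun ω => (epochLen M (epochQueue M (fun s => Q s ω) t) : ℝ) :=
    (measurable_from_nat (f := fun n : ℕ => (n : ℝ))).comp (measurable_epochLen.comp hq)
  have hγ : Measurable fun ω => exploreRate M δ (epochQueue M (fun s => Q s ω) t) := by
    unfold exploreRate learnRate
    have := hq.norm
    fun_prop
  unfold playFrom exp3Play
  exact ((measurable_const.sub hγ).smul hx).add (hγ.smul measurable_const)

theorem measurable_mixedAction (hK : 0 < K) {Q S ξ : ℕ → Ω → Fin K → ℝ} {a : ℕ → Ω → Fin K}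
    {t : ℕ} (hQ : ∀ s ≤ t, Measurable (Q s)) (hS : ∀ s, 1 ≤ s → s ≤ t → Measurable (S s))
    (ha : ∀ s, 1 ≤ s → s ≤ t → Measurable (a s)) (hξ : ∀ s ≤ t, Measurable (ξ s))
    (hmem : ∀ s ω, ξ s ω ∈ truncSimplex K (floorRate M (Q s ω))) :
    Measurable fun ω => mixedAction M δ (fun s => Q s ω) (fun s => S s ω) (fun s => a s ω)
      (fun s => ξ s ω) t := by
  induction t with
  | zero => exact hξ 0 le_rfl
  | succ t ih =>
    have ih := ih (fun s hs => hQ s (by omega)) (fun s h1 hs => hS s h1 (by omega))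
      (fun s h1 hs => ha s h1 (by omega)) (fun s hs => hξ s (by omega))
    have hQt : ∀ s ≤ t, Measurable (Q s) := fun s hs => hQ s (by omega)
    have hSt := hS (t + 1) (by omega) le_rfl
    have hat := ha (t + 1) (by omega) le_rfl
    have hq := measurable_epochQueue (M := M) hQt
    have hq' := hq.norm
    have hn := measurable_epochLen (M := M).comp hq
    have hl : Measurable fun ω => (epochLen M (epochQueue M (fun s => Q s ω) t) : ℝ) :=
      (measurable_from_nat (f := fun n : ℕ => (n : ℝ))).comp hn
    have hη : Measurable fun ω => learnRate M δ (epochQueue M (fun s => Q s ω) t) := by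
      unfold learnRate; fun_prop
    have hp := measurable_playFrom (M := M) (δ := δ) hQt ih
    -- The floor takes countably many values, one for each epoch length, and for each of them the
    -- minimizer is continuous in the vector. The maximum with 1 excludes length 0, whose floor
    -- would be 0.
    have hF : Measurable fun p : ℕ × (Fin K → ℝ) =>
        entropicArgmin ((((max p.1 1 : ℕ) : ℝ) ^ 3)⁻¹ / K) p.2 := by
      refine measurable_from_prod_countable_right fun n => ?_
      have hn : 1 ≤ max n 1 := le_max_right _ _
      have hpos : (0 : ℝ) < (((max n 1 : ℕ) : ℝ) ^ 3)⁻¹ / K := by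
        have h1 : (0 : ℝ) < (max n 1 : ℕ) := by exact_mod_cast hn
        have h2 : (0 : ℝ) < K := by exact_mod_cast hK
        positivity
      exact (lipschitzWith_entropicArgmin hpos (truncSimplex_nonempty hK hn)).continuous.measurable
    have hv : Measurable fun ω => fun i : Fin K =>
        Real.log (mixedAction M δ (fun s => Q s ω) (fun s => S s ω) (fun s => a s ω)
          (fun s => ξ s ω) t i) + learnRate M δ (epochQueue M (fun s => Q s ω) t) *
        (if i = a (t + 1) ω then
          clipFeedback M δ (epochQueue M (fun s => Q s ω) t) (Q t ω i * S (t + 1) ω i) /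
            playFrom M δ (fun s => Q s ω) t (mixedAction M δ (fun s => Q s ω) (fun s => S s ω)
              (fun s => a s ω) (fun s => ξ s ω) t) i
        else 0) := by
      refine measurable_pi_lambda _ fun i => ?_
      have h1 := (measurable_pi_apply i).comp (hQt t le_rfl)
      have h2 := (measurable_pi_apply i).comp hSt
      refine (Real.measurable_log.comp ((measurable_pi_apply i).comp ih)).add (hη.mul ?_)
      refine Measurable.ite (measurableSet_eq_fun measurable_const hat) ?_ measurable_const
      refine Measurable.div ?_ ((measurable_pi_apply i).comp hp)
      unfold clipFeedback
      refine Measurable.ite (measurableSet_le (h1.mul h2) ?_) (h1.mul h2) measurable_const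
      fun_prop
    have hstep := hF.comp (hn.prodMk hv)
    have hrw : (fun ω => mixedAction M δ (fun s => Q s ω) (fun s => S s ω) (fun s => a s ω)
        (fun s => ξ s ω) (t + 1)) = fun ω =>
        if epochStart M (fun s => Q s ω) (t + 1) = t + 1 then ξ (t + 1) ω else
          entropicArgmin (floorRate M (epochQueue M (fun s => Q s ω) t)) fun i : Fin K =>
            Real.log (mixedAction M δ (fun s => Q s ω) (fun s => S s ω) (fun s => a s ω)
              (fun s => ξ s ω) t i) + learnRate M δ (epochQueue M (fun s => Q s ω) t) *
            (if i = a (t + 1) ω then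
              clipFeedback M δ (epochQueue M (fun s => Q s ω) t) (Q t ω i * S (t + 1) ω i) /
                playFrom M δ (fun s => Q s ω) t (mixedAction M δ (fun s => Q s ω)
                  (fun s => S s ω) (fun s => a s ω) (fun s => ξ s ω) t) i
            else 0) := by
      funext ω
      split_ifs with h
      · simp only [mixedAction, if_pos h]
      · rw [mixedAction_succ_of_ne h, exp3Step_eq_entropicArgmin]
        · congr 1
          funext i
          congr 2
          simp only [exp3Estimate, Pi.single_apply, playProb]
          split_ifs with hi
          · rw [hi]
          · rfl
        · exact fun i => ((floorRate_pos hK _).trans_le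
            ((mixedAction_mem hK (fun t => hmem t ω) t).2 i)).ne'
    rw [hrw]
    refine Measurable.ite (measurableSet_eq_fun (measurable_epochStart hQ) measurable_const)
      (hξ _ le_rfl) ?_
    have hfl : ∀ ω, floorRate M (epochQueue M (fun s => Q s ω) t) =
        (((max (epochLen M (epochQueue M (fun s => Q s ω) t)) 1 : ℕ) : ℝ) ^ 3)⁻¹ / K := by
      intro ω
      rw [max_eq_left (one_le_epochLen _)]
      rfl
    simp only [hfl]
    exact hstep

end Measurability

/-! ### Moments of a random vector with a given law -/

section Moments

variable {Ω : Type*} [MeasurableSpace Ω] {P : Measure Ω} {K : ℕ} {α M : ℝ}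
  {μ : Measure (Fin K → ℝ)} {X : Ω → Fin K → ℝ}

theorem HasBoundedMoments.ae_nonneg (h : HasBoundedMoments α M μ) (hX : Measurable X)
    (hl : P.map X = μ) : ∀ᵐ ω ∂P, ∀ i, 0 ≤ X ω i := by
  have := h.nonneg
  rw [← hl] at this
  exact ae_of_ae_map hX.aemeasurable this

theorem HasBoundedMoments.integral_eq_meanVec (hX : Measurable X) (hl : P.map X = μ) (i : Fin K) :
    ∫ ω, X ω i ∂P = meanVec μ i := by
  rw [meanVec, ← hl, integral_map hX.aemeasurable]
  exact (measurable_pi_apply i).aestronglyMeasurable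

/-- Monotonicity of the L^p norms on a probability space; from here on only second moments are used.
-/
theorem HasBoundedMoments.eLpNorm_le [IsProbabilityMeasure P] (h : HasBoundedMoments α M μ)
    (hα : 2 ≤ α) (hM : 0 ≤ M) (hX : Measurable X) (hl : P.map X = μ) (i : Fin K) :
    eLpNorm (fun ω => X ω i) 2 P ≤ ENNReal.ofReal M := by
  have hXi : Measurable fun ω => X ω i := (measurable_pi_apply i).comp hX
  have h2 : (2 : ENNReal) ≤ ENNReal.ofReal α := by
    rw [← ENNReal.ofReal_ofNat]; exact ENNReal.ofReal_le_ofReal hα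
  have hα0 : (0 : ℝ) < α := by linarith
  refine (eLpNorm_le_eLpNorm_of_exponent_le h2 hXi.aestronglyMeasurable).trans ?_
  rw [eLpNorm_eq_lintegral_rpow_enorm_toReal (by simpa using hα0) ENNReal.ofReal_ne_top,
    ENNReal.toReal_ofReal hα0.le]
  have h3 : ∫⁻ ω, ‖X ω i‖ₑ ^ α ∂P ≤ ENNReal.ofReal (M ^ α) := by
    refine le_trans (le_of_eq ?_) (h.moment i)
    rw [← hl, lintegral_map (by fun_prop) hX]
    refine lintegral_congr_ae ?_
    filter_upwards [h.ae_nonneg hX hl] with ω hω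
    rw [Real.enorm_eq_ofReal (hω i), ENNReal.ofReal_rpow_of_nonneg (hω i) hα0.le]
  calc (∫⁻ ω, ‖X ω i‖ₑ ^ α ∂P) ^ (1 / α) ≤ (ENNReal.ofReal (M ^ α)) ^ (1 / α) :=
        ENNReal.rpow_le_rpow h3 (by positivity)
    _ = ENNReal.ofReal M := by
        rw [ENNReal.ofReal_rpow_of_nonneg (by positivity) (by positivity), ← Real.rpow_mul hM,
          mul_one_div_cancel hα0.ne', Real.rpow_one]

theorem HasBoundedMoments.memLp [IsProbabilityMeasure P] (h : HasBoundedMoments α M μ)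
    (hα : 2 ≤ α) (hM : 0 ≤ M) (hX : Measurable X) (hl : P.map X = μ) (i : Fin K) :
    MemLp (fun ω => X ω i) 2 P :=
  ⟨((measurable_pi_apply i).comp hX).aestronglyMeasurable,
    (h.eLpNorm_le hα hM hX hl i).trans_lt ENNReal.ofReal_lt_top⟩

theorem HasBoundedMoments.integral_sq_le [IsProbabilityMeasure P] (h : HasBoundedMoments α M μ)
    (hα : 2 ≤ α) (hM : 0 ≤ M) (hX : Measurable X) (hl : P.map X = μ) (i : Fin K) :
    ∫ ω, X ω i ^ 2 ∂P ≤ M ^ 2 := by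
  have hXi : Measurable fun ω => X ω i := (measurable_pi_apply i).comp hX
  rw [integral_eq_lintegral_of_nonneg_ae (ae_of_all _ fun ω => sq_nonneg _)
    (hXi.pow_const 2).aestronglyMeasurable]
  refine ENNReal.toReal_le_of_le_ofReal (by positivity) ?_
  have h1 := eLpNorm_nnreal_pow_eq_lintegral (μ := P) (f := fun ω => X ω i) (p := 2) (by simp)
  have h2 : ∫⁻ ω, ENNReal.ofReal (X ω i ^ 2) ∂P = eLpNorm (fun ω => X ω i) 2 P ^ 2 := by
    simp only [NNReal.coe_ofNat, ENNReal.coe_ofNat, ENNReal.rpow_ofNat] at h1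
    rw [h1]
    refine lintegral_congr fun ω => ?_
    rw [← Real.enorm_eq_ofReal (sq_nonneg _), enorm_pow]
  rw [h2, ENNReal.ofReal_pow hM]
  gcongr
  exact h.eLpNorm_le hα hM hX hl i

theorem HasBoundedMoments.meanVec_nonneg (h : HasBoundedMoments α M μ) (i : Fin K) :
    0 ≤ meanVec μ i := by
  refine integral_nonneg_of_ae ?_
  filter_upwards [h.nonneg] with x hx using hx i

theorem HasBoundedMoments.meanVec_le (h : HasBoundedMoments α M μ)
    (hα : 2 ≤ α) (hM : 1 ≤ M) (i : Fin K) : meanVec μ i ≤ M := by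
  have := h.prob
  have hm := h.memLp hα (by linarith) measurable_id Measure.map_id i
  have h2 := h.integral_sq_le hα (by linarith) measurable_id Measure.map_id i
  -- Integrating (x - M)² ≥ 0 gives 2M times the mean at most 2M².
  have h3 : ∫ x, 2 * M * x i ∂μ ≤ ∫ x, (x i ^ 2 + M ^ 2) ∂μ := by
    refine integral_mono ((hm.integrable one_le_two).const_mul _)
      (hm.integrable_sq.add (integrable_const _)) fun x => ?_
    change 2 * M * x i ≤ x i ^ 2 + M ^ 2
    nlinarith [sq_nonneg (x i - M)]
  have h4 : Integrable (fun x : Fin K → ℝ => x i ^ 2) μ := hm.integrable_sq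
  rw [integral_const_mul, integral_add h4 (integrable_const _)] at h3
  simp only [id, integral_const, probReal_univ, one_smul] at h2 h3
  unfold meanVec
  nlinarith

end Moments

/-! ### The history of a run -/

section History

variable {Ω : Type*} {K : ℕ} {A S : ℕ → Ω → Fin K → ℝ} {a : ℕ → Ω → Fin K}

/-- The `σ`-algebra generated by the arrivals and services of slot `t + 1`. -/
abbrev innovation (A S : ℕ → Ω → Fin K → ℝ) (t : ℕ) : MeasurableSpace Ω :=
  MeasurableSpace.comap (A (t + 1)) inferInstance ⊔ MeasurableSpace.comap (S (t + 1)) inferInstance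

theorem history_mono {s t : ℕ} (h : s ≤ t) : history A S a s ≤ history A S a t := by
  refine iSup₂_le fun r hr => ?_
  have : r ∈ Finset.Icc 1 t := by simp only [Finset.mem_Icc] at hr ⊢; omega
  exact le_iSup₂_of_le r this le_rfl

theorem le_history {s t : ℕ} (h1 : 1 ≤ s) (h : s ≤ t) :
    MeasurableSpace.comap (A s) inferInstance ⊔ MeasurableSpace.comap (S s) inferInstance ⊔
      MeasurableSpace.comap (a s) inferInstance ≤ history A S a t :=
  le_iSup₂_of_le s (Finset.mem_Icc.2 ⟨h1, h⟩) le_rfl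

theorem measurable_arrival_history {s t : ℕ} (h1 : 1 ≤ s) (h : s ≤ t) :
    Measurable[history A S a t] (A s) :=
  (comap_measurable (A s)).mono ((le_sup_left.trans le_sup_left).trans (le_history h1 h)) le_rfl

theorem measurable_service_history {s t : ℕ} (h1 : 1 ≤ s) (h : s ≤ t) :
    Measurable[history A S a t] (S s) :=
  (comap_measurable (S s)).mono ((le_sup_right.trans le_sup_left).trans (le_history h1 h)) le_rfl

theorem measurable_action_history {s t : ℕ} (h1 : 1 ≤ s) (h : s ≤ t) :
    Measurable[history A S a t] (a s) :=
  (comap_measurable (a s)).mono (le_sup_right.trans (le_history h1 h)) le_rfl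

theorem measurable_arrival_innovation (t : ℕ) : Measurable[innovation A S t] (A (t + 1)) :=
  (comap_measurable (A (t + 1))).mono le_sup_left le_rfl

theorem measurable_service_innovation (t : ℕ) : Measurable[innovation A S t] (S (t + 1)) :=
  (comap_measurable (S (t + 1))).mono le_sup_right le_rfl

theorem queueProc_succ (t : ℕ) (ω : Ω) (i : Fin K) :
    queueProc A S a (t + 1) ω i = max (queueProc A S a t ω i + A (t + 1) ω i -
      if i = a (t + 1) ω then S (t + 1) ω i else 0) 0 := rfl

theorem queueProc_nonneg (t : ℕ) (ω : Ω) (i : Fin K) : 0 ≤ queueProc A S a t ω i := by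
  cases t with
  | zero => exact le_rfl
  | succ t => exact le_max_right _ _

theorem measurable_queueProc_of_measurable {m : MeasurableSpace Ω} {t : ℕ}
    (hA : ∀ s, 1 ≤ s → s ≤ t → Measurable (A s)) (hS : ∀ s, 1 ≤ s → s ≤ t → Measurable (S s))
    (ha : ∀ s, 1 ≤ s → s ≤ t → Measurable (a s)) : Measurable (queueProc A S a t) := by
  induction t with
  | zero => exact measurable_const
  | succ t ih =>
    have ih := ih (fun s h1 h => hA s h1 (by omega)) (fun s h1 h => hS s h1 (by omega))
      (fun s h1 h => ha s h1 (by omega))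
    have hAt := hA (t + 1) (by omega) le_rfl
    have hSt := hS (t + 1) (by omega) le_rfl
    have hat := ha (t + 1) (by omega) le_rfl
    refine measurable_pi_lambda _ fun i => ?_
    simp only [queueProc_succ]
    refine Measurable.max (Measurable.sub (Measurable.add ?_ ?_) ?_) measurable_const
    · exact (measurable_pi_apply i).comp ih
    · exact (measurable_pi_apply i).comp hAt
    · exact Measurable.ite (measurableSet_eq_fun measurable_const hat)
        ((measurable_pi_apply i).comp hSt) measurable_const

theorem measurable_queueProc_history {s t : ℕ} (h : s ≤ t) :
    Measurable[history A S a t] (queueProc A S a s) :=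
  measurable_queueProc_of_measurable
    (fun _ h1 h2 => measurable_arrival_history h1 (h2.trans h))
    (fun _ h1 h2 => measurable_service_history h1 (h2.trans h))
    (fun _ h1 h2 => measurable_action_history h1 (h2.trans h))

theorem measurable_arrival_apply (t : ℕ) (i : Fin K) :
    Measurable[innovation A S t] fun ω => A (t + 1) ω i :=
  (measurable_pi_apply i).comp (measurable_arrival_innovation t)

theorem measurable_service_apply (t : ℕ) (i : Fin K) :
    Measurable[innovation A S t] fun ω => S (t + 1) ω i :=
  (measurable_pi_apply i).comp (measurable_service_innovation t)

theorem measurable_queue_apply {s t : ℕ} (hst : s ≤ t) (i : Fin K) :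
    Measurable[history A S a t] fun ω => queueProc A S a s ω i :=
  (measurable_pi_apply i).comp (measurable_queueProc_history hst)

theorem norm_le_sum_queue (t : ℕ) (ω : Ω) :
    ‖queueProc A S a t ω‖ ≤ ∑ i, queueProc A S a t ω i := by
  rw [pi_norm_le_iff_of_nonneg (Finset.sum_nonneg fun i _ => queueProc_nonneg _ _ _)]
  intro i
  rw [Real.norm_of_nonneg (queueProc_nonneg _ _ _)]
  exact Finset.single_le_sum (f := fun i => queueProc A S a t ω i)
    (fun j _ => queueProc_nonneg _ _ _) (Finset.mem_univ i)

theorem norm_sq_le_sum_queue_sq (t : ℕ) (ω : Ω) :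
    ‖queueProc A S a t ω‖ ^ 2 ≤ ∑ i, queueProc A S a t ω i ^ 2 := by
  have h0 : 0 ≤ ∑ i, queueProc A S a t ω i ^ 2 := Finset.sum_nonneg fun i _ => sq_nonneg _
  rw [← Real.sq_sqrt h0]
  refine pow_le_pow_left₀ (norm_nonneg _) ?_ 2
  rw [pi_norm_le_iff_of_nonneg (Real.sqrt_nonneg _)]
  intro i
  exact Real.abs_le_sqrt (Finset.single_le_sum (f := fun i => queueProc A S a t ω i ^ 2)
    (fun j _ => sq_nonneg _) (Finset.mem_univ i))

end History

/-! ### The run as a random process -/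

section Run

variable {Ω : Type*} {K : ℕ} {M δ : ℝ} {A S : ℕ → Ω → Fin K → ℝ} {a : ℕ → Ω → Fin K}
  {ξ : ℕ → Ω → Fin K → ℝ}

/-- The sampling distribution of slot `t + 1` along a run. -/
noncomputable def runPlay (M δ : ℝ) (A S : ℕ → Ω → Fin K → ℝ) (a : ℕ → Ω → Fin K) (ξ : ℕ → Ω → Fin K → ℝ)
    (t : ℕ) (ω : Ω) : Fin K → ℝ :=
  playProb M δ (fun s => queueProc A S a s ω) (fun s => S s ω) (fun s => a s ω)
    (fun s => ξ s ω) t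

/-- The state of the bandit algorithm used in slot `t + 1` along a run. -/
noncomputable def runState (M δ : ℝ) (A S : ℕ → Ω → Fin K → ℝ) (a : ℕ → Ω → Fin K) (ξ : ℕ → Ω → Fin K → ℝ)
    (t : ℕ) (ω : Ω) : Fin K → ℝ :=
  mixedAction M δ (fun s => queueProc A S a s ω) (fun s => S s ω) (fun s => a s ω)
    (fun s => ξ s ω) t

/-- The start of the epoch containing slot `t + 1` along a run. -/
noncomputable def runStart (M : ℝ) (A S : ℕ → Ω → Fin K → ℝ) (a : ℕ → Ω → Fin K) (t : ℕ) (ω : Ω) : ℕ :=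
  epochStart M (fun s => queueProc A S a s ω) t

theorem measurable_runStart (t : ℕ) : Measurable[history A S a t] (runStart M A S a t) :=
  measurable_epochStart (M := M) fun _ hs => measurable_queueProc_history hs

variable [MeasurableSpace Ω] {P : Measure Ω} {𝒜 𝒮 : ℕ → Measure (Fin K → ℝ)}

theorem IsSSMWPlusRun.history_le (h : IsSSMWPlusRun P M δ 𝒜 𝒮 A S a ξ) (t : ℕ) :
    history A S a t ≤ ‹MeasurableSpace Ω› := by
  refine iSup₂_le fun s hs => ?_
  have h1 := (Finset.mem_Icc.1 hs).1
  exact sup_le (sup_le (h.measurable_arrival s h1).comap_le (h.measurable_service s h1).comap_le)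
    (h.measurable_action s h1).comap_le

theorem IsSSMWPlusRun.innovation_le (h : IsSSMWPlusRun P M δ 𝒜 𝒮 A S a ξ) (t : ℕ) :
    innovation A S t ≤ ‹MeasurableSpace Ω› :=
  sup_le (h.measurable_arrival _ (by omega)).comap_le (h.measurable_service _ (by omega)).comap_le

theorem IsSSMWPlusRun.measurable_queueProc (h : IsSSMWPlusRun P M δ 𝒜 𝒮 A S a ξ) (t : ℕ) :
    Measurable (queueProc A S a t) :=
  (measurable_queueProc_history le_rfl).mono (h.history_le t) le_rfl

theorem IsSSMWPlusRun.card_pos [NeZero P] (h : IsSSMWPlusRun P M δ 𝒜 𝒮 A S a ξ) : 0 < K := by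
  obtain ⟨ω⟩ := P.nonempty_of_neZero
  rcases Nat.eq_zero_or_pos K with rfl | hK
  · have := (h.init_mem 0 ω).1.2
    simp at this
  · exact hK

theorem IsSSMWPlusRun.runState_mem (h : IsSSMWPlusRun P M δ 𝒜 𝒮 A S a ξ) (hK : 0 < K) (t : ℕ)
    (ω : Ω) : runState M δ A S a ξ t ω ∈
      truncSimplex K (floorRate M (queueProc A S a (runStart M A S a t ω) ω)) :=
  mixedAction_mem hK (fun s => h.init_mem s ω) t

theorem IsSSMWPlusRun.measurable_runState (h : IsSSMWPlusRun P M δ 𝒜 𝒮 A S a ξ) (hK : 0 < K)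
    (t : ℕ) : Measurable[history A S a t] (runState M δ A S a ξ t) :=
  measurable_mixedAction hK (fun _ hs => measurable_queueProc_history hs)
    (fun _ h1 hs => measurable_service_history h1 hs)
    (fun _ h1 hs => measurable_action_history h1 hs)
    (fun s hs => (h.measurable_init s).mono (history_mono hs) le_rfl) h.init_mem

theorem IsSSMWPlusRun.measurable_runPlay (h : IsSSMWPlusRun P M δ 𝒜 𝒮 A S a ξ) (hK : 0 < K)
    (t : ℕ) : Measurable[history A S a t] (runPlay M δ A S a ξ t) :=
  measurable_playFrom (fun _ hs => measurable_queueProc_history hs) (h.measurable_runState hK t)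

/-- The exploration rate in terms of `r = m ^ (δ / 3)`. -/
theorem exploreRate_bounds (hK : 0 < K) (hM : 1 ≤ M) (hδ : 0 < δ) (q : Fin K → ℝ) :
    0 ≤ exploreRate M δ q ∧
      exploreRate M δ q ≤ (2 * M * (epochLen M q : ℝ) ^ (δ / 3))⁻¹ ∧
        exploreRate M δ q ≤ 1 / 2 := by
  have hK' : (0 : ℝ) < K := by exact_mod_cast hK
  have hn : (1 : ℝ) ≤ epochLen M q := by exact_mod_cast one_le_epochLen q
  have hq := norm_le_epochLen (by linarith : 0 < M) q
  set n : ℝ := (epochLen M q : ℝ)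
  have hr : 1 ≤ n ^ (δ / 3) := Real.one_le_rpow hn (by positivity)
  have hpow : n ^ (1 + 2 / 3 * δ) = n * (n ^ (δ / 3) * n ^ (δ / 3)) := by
    rw [Real.rpow_add (by linarith), Real.rpow_one, ← Real.rpow_add (by linarith)]
    ring_nf
  have h0 : exploreRate M δ q = ‖q‖ / (4 * M ^ 2 * n * n ^ (δ / 3)) := by
    unfold exploreRate learnRate
    change n ^ (δ / 3) * K * M * (4 * M ^ 3 * K * n ^ (1 + 2 / 3 * δ))⁻¹ * ‖q‖ = _
    rw [hpow]
    field_simp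
  have h1 : exploreRate M δ q ≤ (2 * M * n ^ (δ / 3))⁻¹ := by
    rw [h0, div_le_iff₀ (by positivity)]
    calc ‖q‖ ≤ 2 * M * n := hq
      _ = _ := by field_simp; ring
  refine ⟨by rw [h0]; positivity, h1, h1.trans ?_⟩
  rw [one_div]
  exact inv_anti₀ two_pos (by nlinarith)

theorem IsSSMWPlusRun.runPlay_mem (h : IsSSMWPlusRun P M δ 𝒜 𝒮 A S a ξ) (hK : 0 < K)
    (hM : 1 ≤ M) (hδ : 0 < δ) (t : ℕ) (ω : Ω) :
    runPlay M δ A S a ξ t ω ∈ stdSimplex ℝ (Fin K) := by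
  have hx := (h.runState_mem hK t ω).1
  obtain ⟨h0, -, h1⟩ := exploreRate_bounds hK hM hδ (queueProc A S a (runStart M A S a t ω) ω)
  have hK' : (K : ℝ) ≠ 0 := by exact_mod_cast hK.ne'
  have hu : (fun _ => 1 / (K : ℝ)) ∈ stdSimplex ℝ (Fin K) := ⟨fun _ => by positivity, by
    simp [hK']⟩
  exact convex_stdSimplex ℝ (Fin K) hx hu (sub_nonneg.2 (h1.trans (by norm_num))) h0 (by ring)

/-- Averaging over the decision of slot `t + 1`. -/
theorem IsSSMWPlusRun.integral_action [IsProbabilityMeasure P]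
    (h : IsSSMWPlusRun P M δ 𝒜 𝒮 A S a ξ) (t : ℕ) {F : Fin K → Ω → ℝ}
    (hF : ∀ i, Measurable[history A S a t ⊔ innovation A S t] (F i))
    (hFi : ∀ i, Integrable (F i) P) :
    ∫ ω, F (a (t + 1) ω) ω ∂P = ∑ i, ∫ ω, F i ω * runPlay M δ A S a ξ t ω i ∂P := by
  have hm : history A S a t ⊔ innovation A S t ≤ ‹MeasurableSpace Ω› :=
    sup_le (h.history_le t) (h.innovation_le t)
  have hset : ∀ i, MeasurableSet (a (t + 1) ⁻¹' {i}) := fun i =>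
    h.measurable_action (t + 1) (by omega) (measurableSet_singleton i)
  have h1 : ∀ ω, F (a (t + 1) ω) ω =
      ∑ i, F i ω * (a (t + 1) ⁻¹' {i}).indicator (fun _ => (1 : ℝ)) ω := by
    intro ω
    rw [Finset.sum_eq_single (a (t + 1) ω)]
    · rw [Set.indicator_of_mem (Set.mem_preimage.2 (Set.mem_singleton _)), mul_one]
    · intro i _ hi
      rw [Set.indicator_of_notMem (fun h => hi h.symm), mul_zero]
    · simp
  have hint : ∀ i, Integrable
      (fun ω => F i ω * (a (t + 1) ⁻¹' {i}).indicator (fun _ => (1 : ℝ)) ω) P := by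
    intro i
    refine ((hFi i).indicator (hset i)).congr (ae_of_all _ fun ω => ?_)
    by_cases hω : ω ∈ a (t + 1) ⁻¹' {i}
    · simp only [Set.indicator_of_mem hω, mul_one]
    · simp only [Set.indicator_of_notMem hω, mul_zero]
  simp_rw [h1]
  rw [integral_finsetSum _ fun i _ => hint i]
  refine Finset.sum_congr rfl fun i _ => ?_
  -- `F i` is known given the past and the innovation, so it leaves the conditional expectation, and
  -- `action_law` evaluates what remains.
  have h2 := condExp_mul_of_stronglyMeasurable_left (μ := P) (hF i).stronglyMeasurable (hint i)
    ((integrable_const (1 : ℝ)).indicator (hset i))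
  rw [← integral_condExp hm]
  refine integral_congr_ae ?_
  filter_upwards [h2, h.action_law t i] with ω hω hω'
  change (P[F i * (a (t + 1) ⁻¹' {i}).indicator (fun _ => (1 : ℝ)) |
    history A S a t ⊔ innovation A S t]) ω = _
  rw [hω, Pi.mul_apply, hω']
  rfl

/-- Events of the past and innovations of slot `t + 1` are independent. -/
theorem IsSSMWPlusRun.setIntegral_mul_innovation (h : IsSSMWPlusRun P M δ 𝒜 𝒮 A S a ξ) (t : ℕ)
    {B : Set Ω} (hB : MeasurableSet[history A S a t] B) {X Y : Ω → ℝ}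
    (hX : Measurable[history A S a t] X) (hY : Measurable[innovation A S t] Y) :
    ∫ ω in B, X ω * Y ω ∂P = (∫ ω in B, X ω ∂P) * ∫ ω, Y ω ∂P := by
  have hB' := h.history_le t B hB
  have hXB : Measurable[history A S a t] (B.indicator X) := hX.indicator hB
  have hind : IndepFun (B.indicator X) Y P := by
    rw [IndepFun_iff_Indep]
    exact indep_of_indep_of_le_left (indep_of_indep_of_le_right (h.indep_past t) hY.comap_le)
      hXB.comap_le
  have h1 := hind.integral_mul_eq_mul_integral
    ((hXB.mono (h.history_le t) le_rfl).aestronglyMeasurable)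
    ((hY.mono (h.innovation_le t) le_rfl).aestronglyMeasurable)
  rw [← integral_indicator hB', ← integral_indicator hB', ← h1]
  refine integral_congr_ae (ae_of_all _ fun ω => ?_)
  by_cases hω : ω ∈ B <;> simp [hω]

theorem IsSSMWPlusRun.integrable_mul_innovation (h : IsSSMWPlusRun P M δ 𝒜 𝒮 A S a ξ) (t : ℕ)
    {X Y : Ω → ℝ} (hX : Measurable[history A S a t] X) (hY : Measurable[innovation A S t] Y)
    (hXi : Integrable X P) (hYi : Integrable Y P) : Integrable (fun ω => X ω * Y ω) P := by
  have hind : IndepFun X Y P := by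
    rw [IndepFun_iff_Indep]
    exact indep_of_indep_of_le_left (indep_of_indep_of_le_right (h.indep_past t) hY.comap_le)
      hX.comap_le
  exact hind.integrable_mul hXi hYi

/-- Averaging over the decision of slot `t + 1` on an event. -/
theorem IsSSMWPlusRun.setIntegral_action [IsProbabilityMeasure P]
    (h : IsSSMWPlusRun P M δ 𝒜 𝒮 A S a ξ) (t : ℕ) {B : Set Ω} (hB : MeasurableSet[history A S a t] B) {F : Fin K → Ω → ℝ}
    (hF : ∀ i, Measurable[history A S a t ⊔ innovation A S t] (F i))
    (hFi : ∀ i, Integrable (F i) P) :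
    ∫ ω in B, F (a (t + 1) ω) ω ∂P =
      ∑ i, ∫ ω in B, F i ω * runPlay M δ A S a ξ t ω i ∂P := by
  have hB' := h.history_le t B hB
  have h1 := h.integral_action t (F := fun i => B.indicator (F i))
    (fun i => (hF i).indicator ((le_sup_left : history A S a t ≤ _) B hB))
    (fun i => (hFi i).indicator hB')
  rw [← integral_indicator hB']
  convert h1 using 2 with i
  · rfl
  · rw [← integral_indicator hB']
    refine integral_congr_ae (ae_of_all _ fun ω => ?_)
    by_cases hω : ω ∈ B <;> simp [hω]

end Run

/-! ### Growth of the queues -/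

/-- A run of `SSMW+` whose arrivals and services have moments bounded by `M`. -/
structure IsBoundedRun {Ω : Type*} {K : ℕ} [MeasurableSpace Ω] (P : Measure Ω) (M δ α : ℝ)
    (𝒜 𝒮 : ℕ → Measure (Fin K → ℝ)) (A S : ℕ → Ω → Fin K → ℝ) (a : ℕ → Ω → Fin K)
    (ξ : ℕ → Ω → Fin K → ℝ) : Prop where
  run : IsSSMWPlusRun P M δ 𝒜 𝒮 A S a ξ
  prob : IsProbabilityMeasure P
  one_le : 1 ≤ M
  delta_pos : 0 < δ
  two_le : 2 ≤ α
  arrival : ∀ t, 1 ≤ t → HasBoundedMoments α M (𝒜 t)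
  service : ∀ t, 1 ≤ t → HasBoundedMoments α M (𝒮 t)

namespace IsBoundedRun

variable {Ω : Type*} {K : ℕ} {M δ α : ℝ} {A S : ℕ → Ω → Fin K → ℝ} {a : ℕ → Ω → Fin K}
  {ξ : ℕ → Ω → Fin K → ℝ} [MeasurableSpace Ω] {P : Measure Ω} {𝒜 𝒮 : ℕ → Measure (Fin K → ℝ)}

theorem card_pos (h : IsBoundedRun P M δ α 𝒜 𝒮 A S a ξ) : 0 < K := by
  have := h.prob
  exact h.run.card_pos

theorem nonneg (h : IsBoundedRun P M δ α 𝒜 𝒮 A S a ξ) : 0 ≤ M := zero_le_one.trans h.one_le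

theorem ae_nonneg (h : IsBoundedRun P M δ α 𝒜 𝒮 A S a ξ) (t : ℕ) :
    ∀ᵐ ω ∂P, (∀ i, 0 ≤ A (t + 1) ω i) ∧ ∀ i, 0 ≤ S (t + 1) ω i := by
  have ht : 1 ≤ t + 1 := by omega
  filter_upwards [(h.arrival _ ht).ae_nonneg (h.run.measurable_arrival _ ht)
    (h.run.law_arrival _ ht), (h.service _ ht).ae_nonneg (h.run.measurable_service _ ht)
    (h.run.law_service _ ht)] with ω h1 h2 using ⟨h1, h2⟩

theorem memLp_arrival (h : IsBoundedRun P M δ α 𝒜 𝒮 A S a ξ) (t : ℕ) (i : Fin K) :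
    MemLp (fun ω => A (t + 1) ω i) 2 P := by
  have := h.prob
  have ht : 1 ≤ t + 1 := by omega
  exact (h.arrival _ ht).memLp h.two_le h.nonneg (h.run.measurable_arrival _ ht)
    (h.run.law_arrival _ ht) i

theorem memLp_service (h : IsBoundedRun P M δ α 𝒜 𝒮 A S a ξ) (t : ℕ) (i : Fin K) :
    MemLp (fun ω => S (t + 1) ω i) 2 P := by
  have := h.prob
  have ht : 1 ≤ t + 1 := by omega
  exact (h.service _ ht).memLp h.two_le h.nonneg (h.run.measurable_service _ ht)
    (h.run.law_service _ ht) i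

theorem integrable_arrival (h : IsBoundedRun P M δ α 𝒜 𝒮 A S a ξ) (t : ℕ) (i : Fin K) :
    Integrable (fun ω => A (t + 1) ω i) P := by
  have := h.prob
  exact (h.memLp_arrival t i).integrable one_le_two

theorem integrable_service (h : IsBoundedRun P M δ α 𝒜 𝒮 A S a ξ) (t : ℕ) (i : Fin K) :
    Integrable (fun ω => S (t + 1) ω i) P := by
  have := h.prob
  exact (h.memLp_service t i).integrable one_le_two

theorem integral_arrival (h : IsBoundedRun P M δ α 𝒜 𝒮 A S a ξ) (t : ℕ) (i : Fin K) :
    ∫ ω, A (t + 1) ω i ∂P = meanVec (𝒜 (t + 1)) i :=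
  HasBoundedMoments.integral_eq_meanVec (h.run.measurable_arrival _ (by omega))
    (h.run.law_arrival _ (by omega)) i

theorem integral_service (h : IsBoundedRun P M δ α 𝒜 𝒮 A S a ξ) (t : ℕ) (i : Fin K) :
    ∫ ω, S (t + 1) ω i ∂P = meanVec (𝒮 (t + 1)) i :=
  HasBoundedMoments.integral_eq_meanVec (h.run.measurable_service _ (by omega))
    (h.run.law_service _ (by omega)) i

theorem integral_arrival_le (h : IsBoundedRun P M δ α 𝒜 𝒮 A S a ξ) (t : ℕ) (i : Fin K) :
    ∫ ω, A (t + 1) ω i ∂P ≤ M := by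
  rw [h.integral_arrival]
  exact (h.arrival _ (by omega)).meanVec_le h.two_le h.one_le i

theorem integral_service_le (h : IsBoundedRun P M δ α 𝒜 𝒮 A S a ξ) (t : ℕ) (i : Fin K) :
    ∫ ω, S (t + 1) ω i ∂P ≤ M := by
  rw [h.integral_service]
  exact (h.service _ (by omega)).meanVec_le h.two_le h.one_le i

theorem integral_arrival_sq_le (h : IsBoundedRun P M δ α 𝒜 𝒮 A S a ξ) (t : ℕ) (i : Fin K) :
    ∫ ω, A (t + 1) ω i ^ 2 ∂P ≤ M ^ 2 := by
  have := h.prob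
  have ht : 1 ≤ t + 1 := by omega
  exact (h.arrival _ ht).integral_sq_le h.two_le h.nonneg (h.run.measurable_arrival _ ht)
    (h.run.law_arrival _ ht) i

theorem integral_service_sq_le (h : IsBoundedRun P M δ α 𝒜 𝒮 A S a ξ) (t : ℕ) (i : Fin K) :
    ∫ ω, S (t + 1) ω i ^ 2 ∂P ≤ M ^ 2 := by
  have := h.prob
  have ht : 1 ≤ t + 1 := by omega
  exact (h.service _ ht).integral_sq_le h.two_le h.nonneg (h.run.measurable_service _ ht)
    (h.run.law_service _ ht) i

theorem measurable_play (h : IsBoundedRun P M δ α 𝒜 𝒮 A S a ξ) (t : ℕ) (i : Fin K) :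
    Measurable[history A S a t] fun ω => runPlay M δ A S a ξ t ω i :=
  (measurable_pi_apply i).comp (h.run.measurable_runPlay h.card_pos t)

theorem play_mem (h : IsBoundedRun P M δ α 𝒜 𝒮 A S a ξ) (t : ℕ) (ω : Ω) :
    runPlay M δ A S a ξ t ω ∈ stdSimplex ℝ (Fin K) :=
  h.run.runPlay_mem h.card_pos h.one_le h.delta_pos t ω

theorem norm_play_le (h : IsBoundedRun P M δ α 𝒜 𝒮 A S a ξ) (t : ℕ) (i : Fin K) (ω : Ω) :
    ‖runPlay M δ A S a ξ t ω i‖ ≤ 1 := by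
  rw [Real.norm_of_nonneg ((h.play_mem t ω).1 i)]
  exact le_one_of_mem_stdSimplex (h.play_mem t ω) i

theorem integrable_play (h : IsBoundedRun P M δ α 𝒜 𝒮 A S a ξ) (t : ℕ) (i : Fin K) :
    Integrable (fun ω => runPlay M δ A S a ξ t ω i) P := by
  have := h.prob
  exact Integrable.of_bound ((h.measurable_play t i).mono (h.run.history_le t)
    le_rfl).aestronglyMeasurable 1 (ae_of_all _ (h.norm_play_le t i))

/-- Dropping the service leaves Q_{t+1} ≤ Q_t + A_{t+1}, and square integrability follows by
induction. -/
theorem memLp_queue (h : IsBoundedRun P M δ α 𝒜 𝒮 A S a ξ) (t : ℕ) (i : Fin K) :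
    MemLp (fun ω => queueProc A S a t ω i) 2 P := by
  have := h.prob
  induction t with
  | zero => exact MemLp.zero'
  | succ t ih =>
    refine MemLp.mono' (ih.add (h.memLp_arrival t i))
      (((measurable_pi_apply i).comp (h.run.measurable_queueProc (t + 1))).aestronglyMeasurable) ?_
    filter_upwards [h.ae_nonneg t] with ω hω
    rw [Real.norm_of_nonneg (queueProc_nonneg _ _ _), queueProc_succ]
    refine max_le ?_ (add_nonneg (queueProc_nonneg _ _ _) (hω.1 i))
    have := hω.2 i
    change _ ≤ queueProc A S a t ω i + A (t + 1) ω i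
    split_ifs <;> linarith

theorem integrable_queue (h : IsBoundedRun P M δ α 𝒜 𝒮 A S a ξ) (t : ℕ) (i : Fin K) :
    Integrable (fun ω => queueProc A S a t ω i) P := by
  have := h.prob
  exact (h.memLp_queue t i).integrable one_le_two

theorem integrable_queue_sq (h : IsBoundedRun P M δ α 𝒜 𝒮 A S a ξ) (t : ℕ) (i : Fin K) :
    Integrable (fun ω => queueProc A S a t ω i ^ 2) P :=
  (h.memLp_queue t i).integrable_sq

theorem integrable_norm_queue (h : IsBoundedRun P M δ α 𝒜 𝒮 A S a ξ) (t : ℕ) :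
    Integrable (fun ω => ‖queueProc A S a t ω‖) P := by
  refine Integrable.mono' (integrable_finsetSum Finset.univ fun i _ => h.integrable_queue t i)
    (h.run.measurable_queueProc t).norm.aestronglyMeasurable (ae_of_all _ fun ω => ?_)
  rw [norm_norm]
  exact norm_le_sum_queue t ω

theorem queue_succ_le (h : IsBoundedRun P M δ α 𝒜 𝒮 A S a ξ) (t : ℕ) :
    ∀ᵐ ω ∂P, ∀ i, queueProc A S a (t + 1) ω i ≤ queueProc A S a t ω i + A (t + 1) ω i := by
  filter_upwards [h.ae_nonneg t] with ω hω i
  rw [queueProc_succ]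
  refine max_le ?_ (add_nonneg (queueProc_nonneg _ _ _) (hω.1 i))
  have := hω.2 i
  split_ifs <;> linarith

theorem le_queue_succ (h : IsBoundedRun P M δ α 𝒜 𝒮 A S a ξ) (t : ℕ) :
    ∀ᵐ ω ∂P, ∀ i, queueProc A S a t ω i - (if i = a (t + 1) ω then S (t + 1) ω i else 0) ≤
      queueProc A S a (t + 1) ω i := by
  filter_upwards [h.ae_nonneg t] with ω hω i
  rw [queueProc_succ]
  refine le_max_of_le_left ?_
  linarith [hω.1 i]

/-- Only one type is served, so the maximal queue loses at most one service. Its mean is at most M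
because the sampling probabilities sum to 1; bounding by the sum of all services would lose a factor
K. -/
theorem le_norm_queue_succ (h : IsBoundedRun P M δ α 𝒜 𝒮 A S a ξ) (t : ℕ) :
    ∀ᵐ ω ∂P, ‖queueProc A S a t ω‖ - S (t + 1) ω (a (t + 1) ω) ≤
      ‖queueProc A S a (t + 1) ω‖ := by
  filter_upwards [h.ae_nonneg t, h.le_queue_succ t] with ω hω hω'
  rw [sub_le_iff_le_add, pi_norm_le_iff_of_nonneg (add_nonneg (norm_nonneg _) (hω.2 _))]
  intro i
  rw [Real.norm_of_nonneg (queueProc_nonneg _ _ _)]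
  have h1 := norm_le_pi_norm (queueProc A S a (t + 1) ω) i
  rw [Real.norm_of_nonneg (queueProc_nonneg _ _ _)] at h1
  have h2 := hω' i
  split_ifs at h2 with hi
  · rw [← hi]; linarith
  · linarith [hω.2 (a (t + 1) ω)]

/-! ### Change of the queues in one slot, averaged over an event of the past -/

theorem setIntegral_arrival (h : IsBoundedRun P M δ α 𝒜 𝒮 A S a ξ) {t : ℕ} {B : Set Ω}
    (hB : MeasurableSet[history A S a t] B) {Y : Ω → ℝ} (hY : Measurable[innovation A S t] Y) :
    ∫ ω in B, Y ω ∂P = P.real B * ∫ ω, Y ω ∂P := by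
  have := h.prob
  simpa using h.run.setIntegral_mul_innovation t hB (X := fun _ => 1) measurable_const hY

theorem setIntegral_queue_succ_le (h : IsBoundedRun P M δ α 𝒜 𝒮 A S a ξ) {t : ℕ} {B : Set Ω}
    (hB : MeasurableSet[history A S a t] B) (i : Fin K) :
    ∫ ω in B, queueProc A S a (t + 1) ω i ∂P ≤
      (∫ ω in B, queueProc A S a t ω i ∂P) + M * P.real B := by
  have h1 : ∫ ω in B, queueProc A S a (t + 1) ω i ∂P ≤
      ∫ ω in B, (queueProc A S a t ω i + A (t + 1) ω i) ∂P := by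
    refine setIntegral_mono_ae (h.integrable_queue _ _).integrableOn
      ((h.integrable_queue _ _).add (h.integrable_arrival _ _)).integrableOn ?_
    filter_upwards [h.queue_succ_le t] with ω hω using hω i
  rw [integral_add (h.integrable_queue _ _).integrableOn
    (h.integrable_arrival _ _).integrableOn,
    h.setIntegral_arrival hB (measurable_arrival_apply t i)] at h1
  have := mul_le_mul_of_nonneg_left (h.integral_arrival_le t i) (measureReal_nonneg (μ := P) (s := B))
  linarith

theorem le_setIntegral_queue_succ (h : IsBoundedRun P M δ α 𝒜 𝒮 A S a ξ) {t : ℕ} {B : Set Ω}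
    (hB : MeasurableSet[history A S a t] B) (i : Fin K) :
    (∫ ω in B, queueProc A S a t ω i ∂P) - M * P.real B ≤
      ∫ ω in B, queueProc A S a (t + 1) ω i ∂P := by
  have h1 : ∫ ω in B, (queueProc A S a t ω i - S (t + 1) ω i) ∂P ≤
      ∫ ω in B, queueProc A S a (t + 1) ω i ∂P := by
    refine setIntegral_mono_ae
      ((h.integrable_queue _ _).sub (h.integrable_service _ _)).integrableOn
      (h.integrable_queue _ _).integrableOn ?_
    filter_upwards [h.le_queue_succ t, h.ae_nonneg t] with ω hω hω'
    have h1 := hω i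
    have h2 := hω'.2 i
    split_ifs at h1 <;> linarith
  rw [integral_sub (h.integrable_queue _ _).integrableOn
    (h.integrable_service _ _).integrableOn,
    h.setIntegral_arrival hB (measurable_service_apply t i)] at h1
  have := mul_le_mul_of_nonneg_left (h.integral_service_le t i) (measureReal_nonneg (μ := P) (s := B))
  linarith

theorem setIntegral_queue_succ_sq_le (h : IsBoundedRun P M δ α 𝒜 𝒮 A S a ξ) {t : ℕ} {B : Set Ω}
    (hB : MeasurableSet[history A S a t] B) (i : Fin K) :
    ∫ ω in B, queueProc A S a (t + 1) ω i ^ 2 ∂P ≤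
      (∫ ω in B, queueProc A S a t ω i ^ 2 ∂P) +
        2 * M * (∫ ω in B, queueProc A S a t ω i ∂P) + M ^ 2 * P.real B := by
  have hprod : Integrable (fun ω => queueProc A S a t ω i * A (t + 1) ω i) P :=
    (h.memLp_queue t i).integrable_mul (h.memLp_arrival t i)
  have h1 : ∫ ω in B, queueProc A S a (t + 1) ω i ^ 2 ∂P ≤
      ∫ ω in B, (queueProc A S a t ω i ^ 2 + 2 * (queueProc A S a t ω i * A (t + 1) ω i) +
        A (t + 1) ω i ^ 2) ∂P := by
    refine setIntegral_mono_ae (h.integrable_queue_sq _ _).integrableOn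
      (((h.integrable_queue_sq _ _).add (hprod.const_mul 2)).add
        (h.memLp_arrival t i).integrable_sq).integrableOn ?_
    filter_upwards [h.queue_succ_le t] with ω hω
    have := pow_le_pow_left₀ (queueProc_nonneg _ _ _) (hω i) 2
    nlinarith
  have hsum : Integrable (fun ω => queueProc A S a t ω i ^ 2 +
      2 * (queueProc A S a t ω i * A (t + 1) ω i)) P :=
    (h.integrable_queue_sq _ _).add (hprod.const_mul 2)
  rw [integral_add hsum.integrableOn (h.memLp_arrival t i).integrable_sq.integrableOn,
    integral_add (h.integrable_queue_sq _ _).integrableOn (hprod.const_mul 2).integrableOn,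
    integral_const_mul, h.run.setIntegral_mul_innovation t hB (measurable_queue_apply le_rfl i)
      (measurable_arrival_apply t i),
    h.setIntegral_arrival hB ((measurable_arrival_apply t i).pow_const 2)] at h1
  have h2 := mul_le_mul_of_nonneg_left (h.integral_arrival_sq_le t i)
    (measureReal_nonneg (μ := P) (s := B))
  have h3 : 0 ≤ ∫ ω in B, queueProc A S a t ω i ∂P :=
    integral_nonneg fun ω => queueProc_nonneg _ _ _
  have h4 := mul_le_mul_of_nonneg_left (h.integral_arrival_le t i) h3
  linarith

/-- On an event of the past the maximal queue decreases by at most `M` on average. -/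
theorem le_setIntegral_norm_queue_succ (h : IsBoundedRun P M δ α 𝒜 𝒮 A S a ξ) {t : ℕ} {B : Set Ω}
    (hB : MeasurableSet[history A S a t] B) :
    (∫ ω in B, ‖queueProc A S a t ω‖ ∂P) - M * P.real B ≤
      ∫ ω in B, ‖queueProc A S a (t + 1) ω‖ ∂P := by
  have := h.prob
  have hSa : Integrable (fun ω => S (t + 1) ω (a (t + 1) ω)) P := by
    refine Integrable.mono' (integrable_finsetSum Finset.univ fun i _ => h.integrable_service t i)
      ?_ ?_
    · have h1 : Measurable fun p : Fin K × Ω => S (t + 1) p.2 p.1 :=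
        measurable_from_prod_countable_right fun i =>
          (measurable_pi_apply i).comp (h.run.measurable_service (t + 1) (by omega))
      exact (h1.comp ((h.run.measurable_action (t + 1) (by omega)).prodMk
        measurable_id)).aestronglyMeasurable
    · filter_upwards [h.ae_nonneg t] with ω hω
      rw [Real.norm_of_nonneg (hω.2 _)]
      exact Finset.single_le_sum (f := fun i => S (t + 1) ω i) (fun j _ => hω.2 j)
        (Finset.mem_univ _)
  have h1 : ∫ ω in B, (‖queueProc A S a t ω‖ - S (t + 1) ω (a (t + 1) ω)) ∂P ≤
      ∫ ω in B, ‖queueProc A S a (t + 1) ω‖ ∂P :=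
    setIntegral_mono_ae ((h.integrable_norm_queue _).sub hSa).integrableOn
      (h.integrable_norm_queue _).integrableOn (h.le_norm_queue_succ t)
  rw [integral_sub (h.integrable_norm_queue _).integrableOn hSa.integrableOn,
    h.run.setIntegral_action t hB (F := fun i ω => S (t + 1) ω i)
      (fun i => (measurable_service_apply t i).mono le_sup_right le_rfl)
      (fun i => h.integrable_service t i)] at h1
  have h2 : ∑ i, ∫ ω in B, S (t + 1) ω i * runPlay M δ A S a ξ t ω i ∂P ≤ M * P.real B := by
    calc ∑ i, ∫ ω in B, S (t + 1) ω i * runPlay M δ A S a ξ t ω i ∂P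
        = ∑ i, (∫ ω in B, runPlay M δ A S a ξ t ω i ∂P) * ∫ ω, S (t + 1) ω i ∂P := by
          refine Finset.sum_congr rfl fun i _ => ?_
          rw [← h.run.setIntegral_mul_innovation t hB (h.measurable_play t i) (measurable_service_apply t i)]
          simp [mul_comm]
      _ ≤ ∑ i, (∫ ω in B, runPlay M δ A S a ξ t ω i ∂P) * M :=
          Finset.sum_le_sum fun i _ => mul_le_mul_of_nonneg_left (h.integral_service_le t i)
            (integral_nonneg fun ω => (h.play_mem t ω).1 i)
      _ = M * P.real B := by
          rw [← Finset.sum_mul, ← integral_finsetSum _ fun i _ => (h.integrable_play t i).integrableOn]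
          simp only [(h.play_mem t _).2]
          simp [mul_comm]
  linarith

/-! ### Change of the queues over k slots after the time that decides the event -/

section Iterate

variable {s : ℕ} {B : Set Ω} {q : ℝ}

theorem setIntegral_queue_add_le (h : IsBoundedRun P M δ α 𝒜 𝒮 A S a ξ)
    (hB : MeasurableSet[history A S a s] B) (i : Fin K)
    (hq : ∀ ω ∈ B, queueProc A S a s ω i ≤ q) (k : ℕ) :
    ∫ ω in B, queueProc A S a (s + k) ω i ∂P ≤ (q + k * M) * P.real B := by
  have := h.prob
  induction k with
  | zero =>
    have := setIntegral_mono_on (h.integrable_queue s i).integrableOn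
      (integrable_const q).integrableOn (h.run.history_le s B hB) hq
    simpa [mul_comm] using this
  | succ k ih =>
    have := h.setIntegral_queue_succ_le (t := s + k) (history_mono (by omega) B hB) i
    rw [← add_assoc]
    push_cast
    linarith

/-- Independence splits the cross term of Q_t and A_{t+1}, so with x = q + kM one slot turns x² into
x² + 2Mx + M² = (x + M)²: the second moment stays below the square of the bound on the first. -/
theorem setIntegral_queue_add_sq_le (h : IsBoundedRun P M δ α 𝒜 𝒮 A S a ξ)
    (hB : MeasurableSet[history A S a s] B) (i : Fin K)
    (hq : ∀ ω ∈ B, queueProc A S a s ω i ≤ q) (k : ℕ) :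
    ∫ ω in B, queueProc A S a (s + k) ω i ^ 2 ∂P ≤ (q + k * M) ^ 2 * P.real B := by
  have := h.prob
  induction k with
  | zero =>
    have := setIntegral_mono_on (h.integrable_queue_sq s i).integrableOn
      (integrable_const (q ^ 2)).integrableOn (h.run.history_le s B hB)
      fun ω hω => pow_le_pow_left₀ (queueProc_nonneg _ _ _) (hq ω hω) 2
    simpa [mul_comm] using this
  | succ k ih =>
    have h1 := h.setIntegral_queue_succ_sq_le (t := s + k) (history_mono (by omega) B hB) i
    have h2 := mul_le_mul_of_nonneg_left (h.setIntegral_queue_add_le hB i hq k)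
      (mul_nonneg zero_le_two h.nonneg)
    rw [← add_assoc]
    push_cast
    nlinarith

theorem le_setIntegral_norm_queue_add (h : IsBoundedRun P M δ α 𝒜 𝒮 A S a ξ)
    (hB : MeasurableSet[history A S a s] B) (hq : ∀ ω ∈ B, q ≤ ‖queueProc A S a s ω‖) (k : ℕ) :
    (q - k * M) * P.real B ≤ ∫ ω in B, ‖queueProc A S a (s + k) ω‖ ∂P := by
  have := h.prob
  induction k with
  | zero =>
    have := setIntegral_mono_on (integrable_const q).integrableOn
      (h.integrable_norm_queue s).integrableOn (h.run.history_le s B hB) hq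
    simpa [mul_comm] using this
  | succ k ih =>
    have := h.le_setIntegral_norm_queue_succ (t := s + k) (history_mono (by omega) B hB)
    rw [← add_assoc]
    push_cast
    linarith

end Iterate

end IsBoundedRun

/-! ### One step of the bandit algorithm -/

section BanditStep

variable {K : ℕ}

theorem exp3Play_apply (γ : ℝ) (x : Fin K → ℝ) (i : Fin K) :
    exp3Play γ (fun _ => 1 / (K : ℝ)) x i = (1 - γ) * x i + γ / K := by
  simp [exp3Play, div_eq_mul_inv]

/-- Uniform exploration gives p_a ≥ γ/K = ηc, and the feedback is at most c. Hence η g/p_a ≤ 1, the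
range in which `entropicArgmin_regret` applies. -/
theorem exp3Step_regret {β γ η c g : ℝ} (hβ : 0 < β) (hK : 0 < K) {x u : Fin K → ℝ}
    (hx : x ∈ truncSimplex K β) (hu : u ∈ truncSimplex K β) (hη : 0 ≤ η) (hγ1 : γ ≤ 1 / 2)
    (hγ : γ = η * c * K) (hg : 0 ≤ g) (hgc : g ≤ c) (a : Fin K) {p : Fin K → ℝ}
    (hp : p = exp3Play γ (fun _ => 1 / (K : ℝ)) x) :
    η * (g / p a) * (u a - x a) - η ^ 2 * (x a * (g / p a) ^ 2) ≤
      relEntropy u x - relEntropy u (exp3Step β η (exp3Estimate p a g) x) := by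
  have hK' : (0 : ℝ) < K := by exact_mod_cast hK
  have hxa : 0 < x a := hβ.trans_le (hx.2 a)
  have hpa : p a = (1 - γ) * x a + η * c := by
    rw [hp, exp3Play_apply, hγ]; field_simp
  have hc : 0 ≤ η * c := mul_nonneg hη (hg.trans hgc)
  have hpos : 0 < p a := by rw [hpa]; nlinarith
  have hw0 : 0 ≤ η * (g / p a) := by positivity
  have hw1 : η * (g / p a) ≤ 1 := by
    rw [← mul_div_assoc, div_le_one hpos, hpa]
    nlinarith [mul_le_mul_of_nonneg_left hgc hη]
  have h := entropicArgmin_regret hβ hx hu (w := fun i => η * exp3Estimate p a g i)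
    (fun i => by
      by_cases hi : i = a
      · subst hi; simpa [exp3Estimate] using hw0
      · simp [exp3Estimate, hi])
    (fun i => by
      by_cases hi : i = a
      · subst hi; simpa [exp3Estimate] using hw1
      · simp [exp3Estimate, hi])
  rw [← exp3Step_eq_entropicArgmin fun i => (hβ.trans_le (hx.2 i)).ne'] at h
  have e1 : ∑ i, η * exp3Estimate p a g i * (u i - x i) = η * (g / p a) * (u a - x a) := by
    rw [Finset.sum_eq_single a]
    · simp [exp3Estimate]
    · intro i _ hi; simp [exp3Estimate, hi]
    · simp
  have e2 : ∑ i, x i * (η * exp3Estimate p a g i) ^ 2 = η ^ 2 * (x a * (g / p a) ^ 2) := by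
    rw [Finset.sum_eq_single a]
    · simp [exp3Estimate]; ring
    · intro i _ hi; simp [exp3Estimate, hi]
    · simp
  rw [e1, e2] at h
  linarith

/-- The loss by clipping the feedback `y` at level `c`, and the second order term. -/
theorem clipped_gain_ge {η p x u y c c₀ g : ℝ} (hη : 0 ≤ η) (hp : 0 < p) (hx : 0 ≤ x)
    (hxp : x ≤ 2 * p) (hu : 0 ≤ u) (hy : 0 ≤ y) (hc₀ : 0 < c₀) (hc : c₀ ≤ c)
    (hg : g = if y ≤ c then y else 0) :
    η * (y * (u - x)) - (η * u / c₀ + 2 * η ^ 2) * y ^ 2 ≤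
      (η * (g / p) * (u - x) - η ^ 2 * (x * (g / p) ^ 2)) * p := by
  have hgy : g ≤ y := by rw [hg]; split_ifs <;> linarith
  have hg0 : 0 ≤ g := by rw [hg]; split_ifs <;> linarith
  -- Feedback above the clipping level satisfies y ≤ y²/c₀, so the loss by clipping is controlled by
  -- a second moment.
  have hclip : y - y ^ 2 / c₀ ≤ g := by
    rw [hg]
    split_ifs with h
    · have : 0 ≤ y ^ 2 / c₀ := by positivity
      linarith
    · rw [sub_nonpos, le_div_iff₀ hc₀]
      nlinarith
  have h1 : (η * (g / p) * (u - x) - η ^ 2 * (x * (g / p) ^ 2)) * p =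
      η * (g * u) - η * (g * x) - η ^ 2 * (x / p * g ^ 2) := by
    field_simp
  -- Averaging over the action cancels one of the two factors 1/p of the squared estimate; the other
  -- one is absorbed by x ≤ 2p.
  have h2 : x / p * g ^ 2 ≤ 2 * y ^ 2 := by
    have h3 : x / p ≤ 2 := by rwa [div_le_iff₀ hp]
    have h4 : g ^ 2 ≤ y ^ 2 := pow_le_pow_left₀ hg0 hgy 2
    exact mul_le_mul h3 h4 (by positivity) zero_le_two
  have h5 : η * (g * x) ≤ η * (y * x) := by gcongr
  have h6 : η * ((y - y ^ 2 / c₀) * u) ≤ η * (g * u) := by gcongr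
  have h7 := mul_le_mul_of_nonneg_left h2 (sq_nonneg η)
  rw [h1]
  have h8 : η * (y * (u - x)) - (η * u / c₀ + 2 * η ^ 2) * y ^ 2 =
      η * ((y - y ^ 2 / c₀) * u) - η * (y * x) - η ^ 2 * (2 * y ^ 2) := by ring
  linarith

end BanditStep

/-! ### The regret within an epoch -/

/-- The learning rate in epochs of length `m`. -/
noncomputable def epochRate (K : ℕ) (M δ : ℝ) (m : ℕ) : ℝ :=
  (4 * M ^ 3 * K * (m : ℝ) ^ (1 + 2 / 3 * δ))⁻¹

/-- The floor of the states in epochs of length `m`. -/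
noncomputable def epochFloor (K m : ℕ) : ℝ := ((m : ℝ) ^ 3)⁻¹ / K

/-- The event that an epoch of length `m` begins after time `s`. -/
def epochEvent {Ω : Type*} {K : ℕ} (M : ℝ) (A S : ℕ → Ω → Fin K → ℝ) (a : ℕ → Ω → Fin K)
    (s m : ℕ) : Set Ω :=
  {ω | runStart M A S a s ω = s ∧ epochLen M (queueProc A S a s ω) = m}

section EpochEvent

variable {Ω : Type*} {K : ℕ} {M δ : ℝ} {A S : ℕ → Ω → Fin K → ℝ} {a : ℕ → Ω → Fin K}
  {ξ : ℕ → Ω → Fin K → ℝ} {s m : ℕ}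

/-- The event is decided at time s; this is what makes everything after s independent enough of it.
-/
theorem measurableSet_epochEvent :
    MeasurableSet[history A S a s] (epochEvent M A S a s m) := by
  refine MeasurableSet.inter ?_ ?_
  · exact measurable_runStart s (measurableSet_singleton s)
  · exact (measurable_epochLen.comp (measurable_queueProc_history le_rfl))
      (measurableSet_singleton m)

theorem runStart_add_eq_iff {ω : Ω} (hω : ω ∈ epochEvent M A S a s m) (k : ℕ) :
    runStart M A S a (s + k) ω = s ↔ k < m := by
  rw [← hω.2]
  exact epochStart_add_eq_iff hω.1 k

theorem epochQueue_eq {ω : Ω} (hω : ω ∈ epochEvent M A S a s m) {k : ℕ} (hk : k < m) :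
    epochQueue M (fun s => queueProc A S a s ω) (s + k) = queueProc A S a s ω := by
  have := (runStart_add_eq_iff hω k).2 hk
  simp only [epochQueue]
  rw [show epochStart M (fun s => queueProc A S a s ω) (s + k) = s from this]

/-- On the event the parameters are constants. The last slot of the epoch is excluded, because after
it the state is reset. -/
theorem runState_succ {ω : Ω} (hω : ω ∈ epochEvent M A S a s m) {k : ℕ} (hk : k + 1 < m) :
    runState M δ A S a ξ (s + k + 1) ω =
      exp3Step (epochFloor K m) (epochRate K M δ m)
        (exp3Estimate (runPlay M δ A S a ξ (s + k) ω) (a (s + k + 1) ω)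
          (clipFeedback M δ (queueProc A S a s ω)
            (queueProc A S a (s + k) ω (a (s + k + 1) ω) *
              S (s + k + 1) ω (a (s + k + 1) ω))))
        (runState M δ A S a ξ (s + k) ω) := by
  have h1 := (runStart_add_eq_iff hω (k + 1)).2 hk
  unfold runState runPlay
  rw [mixedAction_succ_of_ne, epochQueue_eq hω (by omega)]
  · simp only [floorRate, learnRate, hω.2, epochFloor, epochRate]
  · change runStart M A S a (s + k + 1) ω ≠ _
    rw [add_assoc, h1]
    omega

theorem runPlay_eq {ω : Ω} (hω : ω ∈ epochEvent M A S a s m) {k : ℕ} (hk : k < m) :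
    runPlay M δ A S a ξ (s + k) ω =
      exp3Play (exploreRate M δ (queueProc A S a s ω)) (fun _ => 1 / (K : ℝ))
        (runState M δ A S a ξ (s + k) ω) := by
  unfold runPlay playProb playFrom
  rw [epochQueue_eq hω hk]
  rfl

theorem exploreRate_eq {ω : Ω} (hω : ω ∈ epochEvent M A S a s m) :
    exploreRate M δ (queueProc A S a s ω) =
      epochRate K M δ m * ((m : ℝ) ^ (δ / 3) * M * ‖queueProc A S a s ω‖) * K := by
  simp only [exploreRate, learnRate, hω.2, epochRate]
  ring

theorem measurable_clipFeedback {mΩ : MeasurableSpace Ω} {q : Ω → Fin K → ℝ} {r : Ω → ℝ}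
    (hq : Measurable q) (hr : Measurable r) :
    Measurable fun ω => clipFeedback M δ (q ω) (r ω) := by
  have h1 : Measurable fun ω => ((epochLen M (q ω) : ℕ) : ℝ) :=
    (measurable_from_nat (f := fun n : ℕ => (n : ℝ))).comp (measurable_epochLen.comp hq)
  unfold clipFeedback
  exact Measurable.ite (measurableSet_le hr (((h1.pow_const _).mul_const M).mul hq.norm)) hr
    measurable_const

theorem epochFloor_pos (hK : 0 < K) (hm : 1 ≤ m) : 0 < epochFloor K m := by
  have h1 : (0 : ℝ) < m := by exact_mod_cast hm
  have h2 : (0 : ℝ) < K := by exact_mod_cast hK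
  unfold epochFloor
  positivity

theorem epochRate_pos (hK : 0 < K) (hM : 1 ≤ M) (hm : 1 ≤ m) : 0 < epochRate K M δ m := by
  have h1 : (0 : ℝ) < m := by exact_mod_cast hm
  have h2 : (0 : ℝ) < K := by exact_mod_cast hK
  have h3 : 0 < M := by linarith
  unfold epochRate
  positivity

end EpochEvent

namespace IsBoundedRun

variable {Ω : Type*} {K : ℕ} {M δ α : ℝ} {A S : ℕ → Ω → Fin K → ℝ} {a : ℕ → Ω → Fin K}
  {ξ : ℕ → Ω → Fin K → ℝ} [MeasurableSpace Ω] {P : Measure Ω} {𝒜 𝒮 : ℕ → Measure (Fin K → ℝ)}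
  {s m k : ℕ}

theorem runState_mem_of_mem (h : IsBoundedRun P M δ α 𝒜 𝒮 A S a ξ) {ω : Ω}
    (hω : ω ∈ epochEvent M A S a s m) (hk : k < m) :
    runState M δ A S a ξ (s + k) ω ∈ truncSimplex K (epochFloor K m) := by
  have h1 := h.run.runState_mem h.card_pos (s + k) ω
  rwa [(runStart_add_eq_iff hω k).2 hk, floorRate, hω.2] at h1

theorem measurable_state (h : IsBoundedRun P M δ α 𝒜 𝒮 A S a ξ) (t : ℕ) (i : Fin K) :
    Measurable[history A S a t] fun ω => runState M δ A S a ξ t ω i :=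
  (measurable_pi_apply i).comp (h.run.measurable_runState h.card_pos t)

theorem state_mem (h : IsBoundedRun P M δ α 𝒜 𝒮 A S a ξ) (t : ℕ) (ω : Ω) :
    runState M δ A S a ξ t ω ∈ stdSimplex ℝ (Fin K) :=
  (h.run.runState_mem h.card_pos t ω).1

theorem integrableOn_relEntropy (h : IsBoundedRun P M δ α 𝒜 𝒮 A S a ξ) (hk : k < m)
    {u : Fin K → ℝ} (hu : u ∈ truncSimplex K (epochFloor K m)) :
    IntegrableOn (fun ω => relEntropy u (runState M δ A S a ξ (s + k) ω))
      (epochEvent M A S a s m) P := by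
  have := h.prob
  have hB := h.run.history_le s _ (measurableSet_epochEvent (M := M) (A := A) (S := S) (a := a)
    (s := s) (m := m))
  have hβ := epochFloor_pos h.card_pos (m := m) (by omega)
  have hmeas : Measurable fun ω => relEntropy u (runState M δ A S a ξ (s + k) ω) := by
    unfold relEntropy
    refine Finset.measurable_fun_sum _ fun i _ => ?_
    have := (h.measurable_state (s + k) i).mono (h.run.history_le _) le_rfl
    exact ((measurable_const.mul (measurable_const.sub (Real.measurable_log.comp this))).sub
      measurable_const).add this
  refine IntegrableOn.of_bound (measure_lt_top P _) hmeas.aestronglyMeasurable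
    (Real.log (1 / epochFloor K m)) ?_
  refine (ae_restrict_iff' hB).2 (ae_of_all _ fun ω hω => ?_)
  have hx := h.runState_mem_of_mem hω hk
  rw [Real.norm_of_nonneg (relEntropy_nonneg (fun i => hβ.trans_le (hu.2 i))
    fun i => hβ.trans_le (hx.2 i))]
  exact relEntropy_le hβ hu hx

theorem norm_queue_le (h : IsBoundedRun P M δ α 𝒜 𝒮 A S a ξ) {ω : Ω}
    (hω : ω ∈ epochEvent M A S a s m) : ‖queueProc A S a s ω‖ ≤ 2 * M * m := by
  have := norm_le_epochLen (M := M) (by linarith [h.one_le]) (queueProc A S a s ω)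
  rwa [hω.2] at this

theorem le_norm_queue (h : IsBoundedRun P M δ α 𝒜 𝒮 A S a ξ) (hm : 2 ≤ m) {ω : Ω}
    (hω : ω ∈ epochEvent M A S a s m) : 2 * M * ((m : ℝ) - 1) ≤ ‖queueProc A S a s ω‖ := by
  have := epochLen_le_norm (M := M) (by linarith [h.one_le]) (q := queueProc A S a s ω)
    (by rw [hω.2]; exact hm)
  rwa [hω.2] at this

theorem queue_le (h : IsBoundedRun P M δ α 𝒜 𝒮 A S a ξ) {ω : Ω}
    (hω : ω ∈ epochEvent M A S a s m) (i : Fin K) : queueProc A S a s ω i ≤ 2 * M * m :=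
  ((le_abs_self _).trans (norm_le_pi_norm (queueProc A S a s ω) i)).trans (h.norm_queue_le hω)

/-- At most 2Mm at the start, and at most M more on average in each of fewer than m slots. -/
theorem setIntegral_queue_le (h : IsBoundedRun P M δ α 𝒜 𝒮 A S a ξ) (hk : k < m) (i : Fin K) :
    ∫ ω in epochEvent M A S a s m, queueProc A S a (s + k) ω i ∂P ≤
      3 * M * m * P.real (epochEvent M A S a s m) := by
  refine (h.setIntegral_queue_add_le measurableSet_epochEvent i
    (fun ω hω => h.queue_le hω i) k).trans ?_
  refine mul_le_mul_of_nonneg_right ?_ measureReal_nonneg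
  have : (k : ℝ) ≤ m := by exact_mod_cast hk.le
  nlinarith [h.one_le]

theorem setIntegral_queue_sq_le (h : IsBoundedRun P M δ α 𝒜 𝒮 A S a ξ) (hk : k < m)
    (i : Fin K) : ∫ ω in epochEvent M A S a s m, queueProc A S a (s + k) ω i ^ 2 ∂P ≤
      (3 * M * m) ^ 2 * P.real (epochEvent M A S a s m) := by
  refine (h.setIntegral_queue_add_sq_le measurableSet_epochEvent i
    (fun ω hω => h.queue_le hω i) k).trans ?_
  refine mul_le_mul_of_nonneg_right ?_ measureReal_nonneg
  have h1 : (k : ℝ) ≤ m := by exact_mod_cast hk.le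
  have h2 := h.nonneg
  refine pow_le_pow_left₀ (by positivity) ?_ 2
  nlinarith

/-- The estimated gain of serving `i` in slot `t + 1`, together with its second order
correction, in an epoch beginning after time `s`. -/
noncomputable def gainEstimate (M δ η : ℝ) (A S : ℕ → Ω → Fin K → ℝ) (a : ℕ → Ω → Fin K)
    (ξ : ℕ → Ω → Fin K → ℝ) (s t : ℕ) (u : Fin K → ℝ) (i : Fin K) (ω : Ω) : ℝ :=
  η * (clipFeedback M δ (queueProc A S a s ω) (queueProc A S a t ω i * S (t + 1) ω i) /
      runPlay M δ A S a ξ t ω i) * (u i - runState M δ A S a ξ t ω i) -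
    η ^ 2 * (runState M δ A S a ξ t ω i *
      (clipFeedback M δ (queueProc A S a s ω) (queueProc A S a t ω i * S (t + 1) ω i) /
        runPlay M δ A S a ξ t ω i) ^ 2)

theorem measurable_gainEstimate (h : IsBoundedRun P M δ α 𝒜 𝒮 A S a ξ) (η : ℝ) {t : ℕ}
    (hst : s ≤ t) (u : Fin K → ℝ) (i : Fin K) :
    Measurable[history A S a t ⊔ innovation A S t] (gainEstimate M δ η A S a ξ s t u i) := by
  have hl : history A S a t ≤ history A S a t ⊔ innovation A S t := le_sup_left
  have hr : innovation A S t ≤ history A S a t ⊔ innovation A S t := le_sup_right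
  have h1 := (measurable_queue_apply (A := A) (S := S) (a := a) (le_refl t) i).mono hl le_rfl
  have h2 := (measurable_service_apply (A := A) (S := S) t i).mono hr le_rfl
  have h3 := (h.measurable_play t i).mono hl le_rfl
  have h4 := (h.measurable_state t i).mono hl le_rfl
  have h5 := (measurable_queueProc_history (A := A) (S := S) (a := a) hst).mono hl le_rfl
  have h7 := measurable_clipFeedback (M := M) (δ := δ) h5 (h1.mul h2)
  have h8 := h7.div h3
  exact ((h8.const_mul η).mul (measurable_const.sub h4)).sub
    ((h4.mul (h8.pow_const 2)).const_mul (η ^ 2))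

theorem clipFeedback_nonneg {q : Fin K → ℝ} {r : ℝ} (hr : 0 ≤ r) : 0 ≤ clipFeedback M δ q r := by
  unfold clipFeedback
  split_ifs
  · exact hr
  · exact le_rfl

theorem clipFeedback_le (hM : 0 ≤ M) (q : Fin K → ℝ) (r : ℝ) :
    clipFeedback M δ q r ≤ (epochLen M q : ℝ) ^ (δ / 3) * M * ‖q‖ := by
  unfold clipFeedback
  split_ifs with h
  · exact h
  · positivity

/-- All three bounds are read off p = (1-γ)x + γ/K with γ ≤ 1/2, where γ/K is η times the clipping
level. -/
theorem play_lower (h : IsBoundedRun P M δ α 𝒜 𝒮 A S a ξ) {ω : Ω}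
    (hω : ω ∈ epochEvent M A S a s m) (hk : k < m) (i : Fin K) :
    0 < runPlay M δ A S a ξ (s + k) ω i ∧
      runState M δ A S a ξ (s + k) ω i ≤ 2 * runPlay M δ A S a ξ (s + k) ω i ∧
      epochRate K M δ m * ((m : ℝ) ^ (δ / 3) * M * ‖queueProc A S a s ω‖) ≤
        runPlay M δ A S a ξ (s + k) ω i := by
  have hK : (0 : ℝ) < K := by exact_mod_cast h.card_pos
  obtain ⟨h0, -, h1⟩ := exploreRate_bounds h.card_pos h.one_le h.delta_pos (queueProc A S a s ω)
  have hx := (epochFloor_pos h.card_pos (by omega)).trans_le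
    ((h.runState_mem_of_mem hω hk).2 i)
  have h2 := exploreRate_eq (δ := δ) hω
  have h3 : exploreRate M δ (queueProc A S a s ω) / K =
      epochRate K M δ m * ((m : ℝ) ^ (δ / 3) * M * ‖queueProc A S a s ω‖) := by
    rw [h2]; field_simp
  have h4 : 0 ≤ exploreRate M δ (queueProc A S a s ω) / K := by positivity
  rw [runPlay_eq hω hk, exp3Play_apply, ← h3]
  refine ⟨?_, ?_, ?_⟩ <;> nlinarith

/-- Only for integrability: η g/p ≤ 1 bounds the linear and the quadratic term by 1 each. -/
theorem abs_gainEstimate_le (h : IsBoundedRun P M δ α 𝒜 𝒮 A S a ξ) {ω : Ω}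
    (hω : ω ∈ epochEvent M A S a s m) (hk : k < m) {u : Fin K → ℝ}
    (hu : u ∈ stdSimplex ℝ (Fin K)) (i : Fin K) (hS : 0 ≤ S (s + k + 1) ω i) :
    |gainEstimate M δ (epochRate K M δ m) A S a ξ s (s + k) u i ω| ≤ 2 := by
  obtain ⟨hp, -, hp'⟩ := h.play_lower hω hk i
  have hη := epochRate_pos (δ := δ) h.card_pos h.one_le (m := m) (by omega)
  have hg0 := clipFeedback_nonneg (M := M) (δ := δ) (q := queueProc A S a s ω)
    (mul_nonneg (queueProc_nonneg (A := A) (S := S) (a := a) (s + k) ω i) hS)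
  have hgc := clipFeedback_le (δ := δ) h.nonneg (queueProc A S a s ω)
    (queueProc A S a (s + k) ω i * S (s + k + 1) ω i)
  rw [hω.2] at hgc
  unfold gainEstimate
  set g := clipFeedback M δ (queueProc A S a s ω)
    (queueProc A S a (s + k) ω i * S (s + k + 1) ω i)
  set p := runPlay M δ A S a ξ (s + k) ω i
  have hw0 : 0 ≤ epochRate K M δ m * (g / p) := by positivity
  have hw1 : epochRate K M δ m * (g / p) ≤ 1 := by
    rw [← mul_div_assoc, div_le_one hp]
    exact (mul_le_mul_of_nonneg_left hgc hη.le).trans hp'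
  set w := epochRate K M δ m * (g / p)
  have hx0 := (h.state_mem (s + k) ω).1 i
  have hx1 := le_one_of_mem_stdSimplex (h.state_mem (s + k) ω) i
  set x := runState M δ A S a ξ (s + k) ω i
  have hu0 := hu.1 i
  have hu1 := le_one_of_mem_stdSimplex hu i
  have e : w * (u i - x) - epochRate K M δ m ^ 2 * (x * (g / p) ^ 2) =
      w * (u i - x) - x * w ^ 2 := by simp only [w]; ring
  rw [e]
  have h1 : |w * (u i - x)| ≤ 1 := by
    rw [abs_mul, abs_of_nonneg hw0]
    have : |u i - x| ≤ 1 := abs_le.2 ⟨by linarith, by linarith⟩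
    exact mul_le_one₀ hw1 (abs_nonneg _) this
  have h2 : |x * w ^ 2| ≤ 1 := by
    rw [abs_of_nonneg (by positivity)]
    exact mul_le_one₀ hx1 (by positivity) (pow_le_one₀ hw0 hw1)
  exact (abs_sub _ _).trans (by linarith)

theorem gainEstimate_action_le (h : IsBoundedRun P M δ α 𝒜 𝒮 A S a ξ) {ω : Ω}
    (hω : ω ∈ epochEvent M A S a s m) (hk : k < m) {u : Fin K → ℝ}
    (hu : u ∈ truncSimplex K (epochFloor K m)) (hS : ∀ i, 0 ≤ S (s + k + 1) ω i) :
    gainEstimate M δ (epochRate K M δ m) A S a ξ s (s + k) u (a (s + k + 1) ω) ω ≤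
      relEntropy u (runState M δ A S a ξ (s + k) ω) -
        if k + 1 < m then relEntropy u (runState M δ A S a ξ (s + k + 1) ω) else 0 := by
  have hβ := epochFloor_pos h.card_pos (m := m) (by omega)
  have hx := h.runState_mem_of_mem hω hk
  have hη := epochRate_pos (δ := δ) h.card_pos h.one_le (m := m) (by omega)
  have hg0 := clipFeedback_nonneg (M := M) (δ := δ) (q := queueProc A S a s ω)
    (mul_nonneg (queueProc_nonneg (A := A) (S := S) (a := a) (s + k) ω (a (s + k + 1) ω))
      (hS (a (s + k + 1) ω)))
  have hgc := clipFeedback_le (δ := δ) h.nonneg (queueProc A S a s ω)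
    (queueProc A S a (s + k) ω (a (s + k + 1) ω) * S (s + k + 1) ω (a (s + k + 1) ω))
  rw [hω.2] at hgc
  have hmain := exp3Step_regret hβ h.card_pos hx hu hη.le
    (exploreRate_bounds h.card_pos h.one_le h.delta_pos (queueProc A S a s ω)).2.2
    (exploreRate_eq hω) hg0 hgc (a (s + k + 1) ω) (runPlay_eq hω hk)
  refine hmain.trans (sub_le_sub_left ?_ _)
  split_ifs with hk'
  · rw [runState_succ hω hk']
  -- In the last slot the mirror step leads to a state that is never played; its entropy is
  -- nonnegative and is discarded.
  · refine relEntropy_nonneg (fun i => hβ.trans_le (hu.2 i)) fun i => hβ.trans_le ?_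
    rw [exp3Step_eq_entropicArgmin fun i => (hβ.trans_le (hx.2 i)).ne']
    exact (entropicArgmin_spec ⟨_, hx⟩ _).1.2 i

/-- The estimated regret of one slot against a fixed action `u`. -/
theorem mirror_step (h : IsBoundedRun P M δ α 𝒜 𝒮 A S a ξ) (hm : 2 ≤ m) (hk : k < m)
    {u : Fin K → ℝ} (hu : u ∈ truncSimplex K (epochFloor K m)) :
    epochRate K M δ m * ∑ i, meanVec (𝒮 (s + k + 1)) i *
        ∫ ω in epochEvent M A S a s m, queueProc A S a (s + k) ω i *
          (u i - runState M δ A S a ξ (s + k) ω i) ∂P ≤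
      (∫ ω in epochEvent M A S a s m, relEntropy u (runState M δ A S a ξ (s + k) ω) ∂P) -
      (if k + 1 < m then
        ∫ ω in epochEvent M A S a s m, relEntropy u (runState M δ A S a ξ (s + k + 1) ω) ∂P
        else 0) +
      (epochRate K M δ m / ((m : ℝ) ^ (δ / 3) * M * (M * m)) + 2 * epochRate K M δ m ^ 2 * K) *
        (M ^ 2 * (3 * M * m) ^ 2 * P.real (epochEvent M A S a s m)) := by
  have := h.prob
  set B := epochEvent M A S a s m with hBdef
  set η := epochRate K M δ m with hηdef
  set c₀ := (m : ℝ) ^ (δ / 3) * M * (M * m) with hc₀def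
  have hBs : MeasurableSet[history A S a (s + k)] B :=
    history_mono (by omega) _ measurableSet_epochEvent
  have hB : MeasurableSet B := h.run.history_le _ _ hBs
  have hM : 0 < M := by linarith [h.one_le]
  have hm' : (2 : ℝ) ≤ m := by exact_mod_cast hm
  have hη : 0 < η := epochRate_pos h.card_pos h.one_le (by omega)
  have hc₀ : 0 < c₀ := by positivity
  have hS : ∀ᵐ ω ∂P, ∀ i, 0 ≤ S (s + k + 1) ω i := by
    filter_upwards [h.ae_nonneg (s + k)] with ω hω using hω.2
  -- The bound on the estimates is available only on `B`. The indicator, redundant inside the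
  -- integrals over `B`, makes them integrable everywhere, as `setIntegral_action` requires.
  have hGmeas := fun i => (h.measurable_gainEstimate η (Nat.le_add_right s k) u i).indicator
    ((le_sup_left : history A S a (s + k) ≤ _) B hBs)
  have hm_le : history A S a (s + k) ⊔ innovation A S (s + k) ≤ ‹MeasurableSpace Ω› :=
    sup_le (h.run.history_le _) (h.run.innovation_le _)
  have hGint : ∀ i, Integrable (B.indicator (gainEstimate M δ η A S a ξ s (s + k) u i)) P := by
    intro i
    refine Integrable.of_bound ((hGmeas i).mono hm_le le_rfl).aestronglyMeasurable 2 ?_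
    filter_upwards [hS] with ω hω
    by_cases hωB : ω ∈ B
    · rw [Set.indicator_of_mem hωB]
      exact h.abs_gainEstimate_le hωB hk hu.1 i (hω i)
    · rw [Set.indicator_of_notMem hωB, norm_zero]
      exact zero_le_two
  have hact := h.run.setIntegral_action (s + k) hBs hGmeas hGint
  have hactint : IntegrableOn (fun ω => B.indicator
      (gainEstimate M δ η A S a ξ s (s + k) u (a (s + k + 1) ω)) ω) B P := by
    refine IntegrableOn.of_bound (measure_lt_top P _) ?_ 2 ?_
    · have h1 : Measurable fun p : Fin K × Ω =>
          B.indicator (gainEstimate M δ η A S a ξ s (s + k) u p.1) p.2 :=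
        measurable_from_prod_countable_right fun i => (hGmeas i).mono hm_le le_rfl
      exact (h1.comp ((h.run.measurable_action (s + k + 1) (by omega)).prodMk
        measurable_id)).aestronglyMeasurable
    · refine (ae_restrict_iff' hB).2 ?_
      filter_upwards [hS] with ω hω hωB
      rw [Set.indicator_of_mem hωB]
      exact h.abs_gainEstimate_le hωB hk hu.1 _ (hω _)
  have hD1 := h.integrableOn_relEntropy (s := s) hk hu
  have hD2 : IntegrableOn (fun ω => if k + 1 < m then
      relEntropy u (runState M δ A S a ξ (s + k + 1) ω) else 0) B P := by
    split_ifs with hk'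
    · exact h.integrableOn_relEntropy (s := s) hk' hu
    · exact integrableOn_zero
  have hupper : ∫ ω in B, B.indicator
      (gainEstimate M δ η A S a ξ s (s + k) u (a (s + k + 1) ω)) ω ∂P ≤
      (∫ ω in B, relEntropy u (runState M δ A S a ξ (s + k) ω) ∂P) -
      (if k + 1 < m then
        ∫ ω in B, relEntropy u (runState M δ A S a ξ (s + k + 1) ω) ∂P else 0) := by
    have h1 : ∫ ω in B, B.indicator
        (gainEstimate M δ η A S a ξ s (s + k) u (a (s + k + 1) ω)) ω ∂P ≤
        ∫ ω in B, (relEntropy u (runState M δ A S a ξ (s + k) ω) -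
          if k + 1 < m then relEntropy u (runState M δ A S a ξ (s + k + 1) ω) else 0) ∂P := by
      refine integral_mono_ae hactint (hD1.sub hD2) ((ae_restrict_iff' hB).2 ?_)
      filter_upwards [hS] with ω hω hωB
      rw [Set.indicator_of_mem hωB]
      exact h.gainEstimate_action_le hωB hk hu hω
    rw [integral_sub hD1 hD2] at h1
    refine h1.trans (sub_le_sub_left (le_of_eq ?_) _)
    split_ifs
    · rfl
    · simp
  have hlin : ∀ i, Integrable (fun ω => queueProc A S a (s + k) ω i *
      (u i - runState M δ A S a ξ (s + k) ω i)) P := by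
    intro i
    refine (h.integrable_queue (s + k) i).mul_bdd (c := 1) ?_ (ae_of_all _ fun ω => ?_)
    · exact (measurable_const.sub ((h.measurable_state (s + k) i).mono (h.run.history_le _)
        le_rfl)).aestronglyMeasurable
    · have hx0 := (h.state_mem (s + k) ω).1 i
      have hx1 := le_one_of_mem_stdSimplex (h.state_mem (s + k) ω) i
      have hu0 := hu.1.1 i
      have hu1 := le_one_of_mem_stdSimplex hu.1 i
      exact abs_le.2 ⟨by linarith, by linarith⟩
  have hlinm : ∀ i, Measurable[history A S a (s + k)] fun ω => queueProc A S a (s + k) ω i *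
      (u i - runState M δ A S a ξ (s + k) ω i) := fun i =>
    (measurable_queue_apply le_rfl i).mul (measurable_const.sub (h.measurable_state (s + k) i))
  -- Averaging over the action multiplies by p_i and so removes the importance weight; averaging
  -- over the independent service turns S into its mean and S² into at most M².
  have hlower : ∀ i, η * (meanVec (𝒮 (s + k + 1)) i * ∫ ω in B, queueProc A S a (s + k) ω i *
        (u i - runState M δ A S a ξ (s + k) ω i) ∂P) -
      (η * u i / c₀ + 2 * η ^ 2) * (M ^ 2 * (3 * M * m) ^ 2 * P.real B) ≤
      ∫ ω in B, B.indicator (gainEstimate M δ η A S a ξ s (s + k) u i) ω *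
        runPlay M δ A S a ξ (s + k) ω i ∂P := by
    intro i
    have hi1 := h.run.integrable_mul_innovation (s + k) (hlinm i)
      (measurable_service_apply (s + k) i) (hlin i) (h.integrable_service (s + k) i)
    have hi2 := h.run.integrable_mul_innovation (s + k)
      ((measurable_queue_apply (le_refl (s + k)) i).pow_const 2)
      ((measurable_service_apply (s + k) i).pow_const 2) (h.integrable_queue_sq (s + k) i)
      (h.memLp_service (s + k) i).integrable_sq
    have e1 := h.run.setIntegral_mul_innovation (s + k) hBs (hlinm i)
      (measurable_service_apply (s + k) i)
    have e2 := h.run.setIntegral_mul_innovation (s + k) hBs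
      ((measurable_queue_apply (le_refl (s + k)) i).pow_const 2)
      ((measurable_service_apply (s + k) i).pow_const 2)
    rw [h.integral_service] at e1
    have hsq : (∫ ω in B, queueProc A S a (s + k) ω i ^ 2 ∂P) *
        ∫ ω, S (s + k + 1) ω i ^ 2 ∂P ≤ M ^ 2 * (3 * M * m) ^ 2 * P.real B := by
      have h1 := h.setIntegral_queue_sq_le (s := s) hk i
      have h2 := h.integral_service_sq_le (s + k) i
      calc _ ≤ ((3 * M * m) ^ 2 * P.real B) * M ^ 2 :=
            mul_le_mul h1 h2 (integral_nonneg fun ω => sq_nonneg _)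
              (mul_nonneg (sq_nonneg _) measureReal_nonneg)
        _ = _ := by ring
    have hcoef : 0 ≤ η * u i / c₀ + 2 * η ^ 2 := by
      have := hu.1.1 i
      positivity
    have h3 : ∫ ω in B, (η * ((queueProc A S a (s + k) ω i *
          (u i - runState M δ A S a ξ (s + k) ω i)) * S (s + k + 1) ω i) -
        (η * u i / c₀ + 2 * η ^ 2) *
          (queueProc A S a (s + k) ω i ^ 2 * S (s + k + 1) ω i ^ 2)) ∂P ≤
        ∫ ω in B, B.indicator (gainEstimate M δ η A S a ξ s (s + k) u i) ω *
          runPlay M δ A S a ξ (s + k) ω i ∂P := by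
      refine integral_mono_ae ((hi1.const_mul η).sub (hi2.const_mul _)).integrableOn
        ((hGint i).mul_bdd (c := 1) ((h.measurable_play _ i).mono (h.run.history_le _)
          le_rfl).aestronglyMeasurable (ae_of_all _ (h.norm_play_le _ i))).integrableOn
        ((ae_restrict_iff' hB).2 ?_)
      filter_upwards [hS] with ω hω hωB
      simp only [Set.indicator_of_mem hωB]
      obtain ⟨hp, hxp, -⟩ := h.play_lower hωB hk i
      have hnorm := h.le_norm_queue hm hωB
      -- On the event the norm is at least 2M(m-1) ≥ Mm, since m ≥ 2; thus `c₀` is a deterministic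
      -- lower bound of the random clipping level.
      have hc : c₀ ≤ (m : ℝ) ^ (δ / 3) * M * ‖queueProc A S a s ω‖ := by
        refine mul_le_mul_of_nonneg_left ?_ (by positivity)
        nlinarith
      have := clipped_gain_ge hη.le hp ((h.state_mem (s + k) ω).1 i) hxp (hu.1.1 i)
        (mul_nonneg (queueProc_nonneg (A := A) (S := S) (a := a) (s + k) ω i) (hω i)) hc₀ hc
        (g := clipFeedback M δ (queueProc A S a s ω)
          (queueProc A S a (s + k) ω i * S (s + k + 1) ω i))
        (by rw [clipFeedback, hωB.2])
      refine le_trans (le_of_eq ?_) this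
      ring
    rw [integral_sub (hi1.const_mul η).integrableOn (hi2.const_mul _).integrableOn,
      integral_const_mul, integral_const_mul, e1, e2] at h3
    have h4 := mul_le_mul_of_nonneg_left hsq hcoef
    linarith
  -- The clipping error carries the weight u_i and is counted once in total, while the variance is
  -- counted K times.
  have hsum := Finset.sum_le_sum fun i (_ : i ∈ Finset.univ) => hlower i
  rw [← hact, Finset.sum_sub_distrib, ← Finset.mul_sum, ← Finset.sum_mul,
    Finset.sum_add_distrib, ← Finset.sum_div, ← Finset.mul_sum, hu.1.2] at hsum
  simp only [Finset.sum_const, Finset.card_univ, Fintype.card_fin, nsmul_eq_mul, mul_one] at hsum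
  have hcomm : 2 * η ^ 2 * (K : ℝ) = K * (2 * η ^ 2) := by ring
  rw [hcomm]
  linarith

end IsBoundedRun

/-! ### Summing the regret over an epoch -/

section Comparator

variable {K : ℕ}

/-- The comparator, pushed into the truncated simplex of an epoch of length `m`. -/
noncomputable def truncComparator {K : ℕ} (m : ℕ) (v : Fin K → ℝ) : Fin K → ℝ :=
  fun i => (1 - ((m : ℝ) ^ 3)⁻¹) * v i + epochFloor K m

theorem inv_cube_le_one {m : ℕ} (hm : 1 ≤ m) : ((m : ℝ) ^ 3)⁻¹ ≤ 1 :=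
  inv_le_one_of_one_le₀ (one_le_pow₀ (by exact_mod_cast hm))

theorem truncComparator_mem (hK : 0 < K) {m : ℕ} (hm : 1 ≤ m) {v : Fin K → ℝ}
    (hv : v ∈ stdSimplex ℝ (Fin K)) : truncComparator m v ∈ truncSimplex K (epochFloor K m) := by
  have h1 := inv_cube_le_one hm
  have hβ := epochFloor_pos hK hm
  have hle : ∀ i, epochFloor K m ≤ truncComparator m v i := fun i =>
    le_add_of_nonneg_left (mul_nonneg (by linarith) (hv.1 i))
  refine ⟨⟨fun i => hβ.le.trans (hle i), ?_⟩, hle⟩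
  have hK' : (K : ℝ) ≠ 0 := by exact_mod_cast hK.ne'
  simp only [truncComparator, Finset.sum_add_distrib, ← Finset.mul_sum, hv.2, epochFloor]
  simp only [Finset.sum_const, Finset.card_univ, Fintype.card_fin, nsmul_eq_mul]
  field_simp
  ring

theorem sum_abs_truncComparator_sub_le {m : ℕ} (hm : 1 ≤ m) (v v' : Fin K → ℝ) :
    ∑ i, |truncComparator m v i - truncComparator m v' i| ≤ ∑ i, |v i - v' i| := by
  refine Finset.sum_le_sum fun i _ => ?_
  have h1 := inv_cube_le_one hm
  have h2 : 0 ≤ ((m : ℝ) ^ 3)⁻¹ := by positivity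
  have : truncComparator m v i - truncComparator m v' i =
      (1 - ((m : ℝ) ^ 3)⁻¹) * (v i - v' i) := by
    simp only [truncComparator]; ring
  rw [this, abs_mul, abs_of_nonneg (by linarith)]
  exact mul_le_of_le_one_left (abs_nonneg _) (by linarith)

theorem log_inv_epochFloor (hK : 0 < K) {m : ℕ} (hm : 1 ≤ m) :
    Real.log (1 / epochFloor K m) = 3 * Real.log m + Real.log K := by
  have h1 : (m : ℝ) ≠ 0 := by exact_mod_cast (by omega : m ≠ 0)
  have h2 : (K : ℝ) ≠ 0 := by exact_mod_cast hK.ne'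
  have : 1 / epochFloor K m = (m : ℝ) ^ 3 * K := by
    unfold epochFloor; field_simp
  rw [this, Real.log_mul (by positivity) h2, Real.log_pow]
  norm_num

/-- The error terms of an epoch of length `m` are dominated by `ssmwRate`. -/
theorem epoch_error_le {M δ C_V : ℝ} {m : ℕ} (hK : 0 < K) (hM : 1 ≤ M) (hδ : 0 < δ) (hδ1 : δ ≤ 1)
    (hC : 0 < C_V) (hm : 2 ≤ m) :
    (3 * Real.log m + Real.log K) * ((1 + C_V) * (m : ℝ) ^ (1 - δ)) / epochRate K M δ m +
      m * ((1 / ((m : ℝ) ^ (δ / 3) * M * (M * m)) + 2 * epochRate K M δ m * K) *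
        (M ^ 2 * (3 * M * m) ^ 2)) +
      m * ((((m : ℝ) ^ 3)⁻¹ + (2 * M * (m : ℝ) ^ (δ / 3))⁻¹ * K) * (M * (3 * M * m))) ≤
    2 / 7 * ssmwRate K M δ C_V m * (M * m ^ 2) := by
  have hK1 : (1 : ℝ) ≤ K := by exact_mod_cast hK
  have hm2 : (2 : ℝ) ≤ m := by exact_mod_cast hm
  have hm0 : (0 : ℝ) < m := by linarith
  set r : ℝ := (m : ℝ) ^ (δ / 3) with hr
  have hr1 : 1 ≤ r := Real.one_le_rpow (by linarith) (by positivity)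
  have hrm : r ≤ m := by
    calc r ≤ (m : ℝ) ^ (1 : ℝ) := Real.rpow_le_rpow_of_exponent_le (by linarith) (by linarith)
      _ = m := Real.rpow_one _
  -- Already 3 ln 2 exceeds 2.
  have hL : 2 ≤ 3 * Real.log m + Real.log K := by
    have h1 : Real.log 2 ≤ Real.log m := Real.log_le_log two_pos hm2
    have h2 := Real.log_two_gt_d9
    have h3 := Real.log_nonneg hK1
    linarith
  set L := 3 * Real.log m + Real.log K
  have e1 : (m : ℝ) ^ (1 - δ) = m / r ^ 3 := by
    rw [Real.rpow_sub hm0, Real.rpow_one, hr, ← Real.rpow_natCast, ← Real.rpow_mul hm0.le]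
    norm_num
  have e2 : epochRate K M δ m = (4 * M ^ 3 * K * (m * r ^ 2))⁻¹ := by
    have h1 : (m : ℝ) ^ (2 / 3 * δ) = r ^ 2 := by
      rw [hr, ← Real.rpow_natCast, ← Real.rpow_mul hm0.le]
      congr 1
      push_cast
      ring
    rw [epochRate, Real.rpow_add hm0, Real.rpow_one, h1]
  have e3 : ssmwRate K M δ C_V m = 42 * (1 + C_V) * M ^ 2 * K * L / r := by
    unfold ssmwRate
    rw [neg_div, Real.rpow_neg hm0.le, ← hr]
    field_simp
    rfl
  rw [e1, e2, e3]
  have hM0 : 0 < M := by linarith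
  have t1 : L * ((1 + C_V) * (m / r ^ 3)) / (4 * M ^ 3 * K * (m * r ^ 2))⁻¹ =
      4 * ((1 + C_V) * L) * (M ^ 3 * K * m ^ 2 / r) := by
    field_simp
  have t2 : m * ((1 / (r * M * (M * m)) + 2 * (4 * M ^ 3 * K * (m * r ^ 2))⁻¹ * K) *
      (M ^ 2 * (3 * M * m) ^ 2)) = 9 * M ^ 2 * (m ^ 2 / r) + 9 / 2 * M * (m ^ 2 / r) / r := by
    field_simp
    ring
  have t3 : m * ((((m : ℝ) ^ 3)⁻¹ + (2 * M * r)⁻¹ * K) * (M * (3 * M * m))) =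
      3 * M ^ 2 / m + 3 / 2 * M * K * (m ^ 2 / r) := by
    field_simp
  have t4 : 2 / 7 * (42 * (1 + C_V) * M ^ 2 * K * L / r) * (M * m ^ 2) =
      12 * ((1 + C_V) * L) * (M ^ 3 * K * m ^ 2 / r) := by
    field_simp
    ring
  rw [t1, t2, t3, t4]
  set y : ℝ := (m : ℝ) ^ 2 / r with hy
  have hy0 : 2 ≤ y := by
    rw [hy, le_div_iff₀ (by linarith)]
    nlinarith
  have ey : M ^ 3 * K * m ^ 2 / r = M ^ 3 * K * y := by rw [hy]; ring
  rw [ey]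
  have hM3 : M ^ 2 ≤ M ^ 3 := pow_le_pow_right₀ hM (by norm_num)
  have hM13 : M ≤ M ^ 3 := by simpa using pow_le_pow_right₀ hM (show 1 ≤ 3 by norm_num)
  have hMK : M ^ 3 ≤ M ^ 3 * K := le_mul_of_one_le_right (by positivity) hK1
  have i1 : 9 * M ^ 2 * y ≤ 9 * (M ^ 3 * K * y) := by
    have : M ^ 2 * y ≤ M ^ 3 * K * y := by gcongr; linarith
    linarith
  have i2 : 9 / 2 * M * y / r ≤ 9 / 2 * (M ^ 3 * K * y) := by
    have h1 : 9 / 2 * M * y / r ≤ 9 / 2 * M * y := div_le_self (by positivity) hr1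
    have : M * y ≤ M ^ 3 * K * y := by gcongr; linarith
    linarith
  have i3 : 3 * M ^ 2 / m ≤ 3 / 4 * (M ^ 3 * K * y) := by
    have h1 : 3 * M ^ 2 / m ≤ 3 * M ^ 2 / 2 := by gcongr
    have : M ^ 2 * 2 ≤ M ^ 3 * K * y := by gcongr; linarith
    linarith
  have i4 : 3 / 2 * M * K * y ≤ 3 / 2 * (M ^ 3 * K * y) := by
    have : M * K * y ≤ M ^ 3 * K * y := by gcongr
    linarith
  -- In units of M³Ky the right side is 12(1 + C_V)L and the entropy term is 4(1 + C_V)L. The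
  -- difference is at least 16, which covers the other errors, at most 9 + 9/2 + 3/4 + 3/2 = 63/4.
  have i5 : 2 * (M ^ 3 * K * y) ≤ (1 + C_V) * L * (M ^ 3 * K * y) := by
    refine mul_le_mul_of_nonneg_right ?_ (by positivity)
    nlinarith
  have hY : 0 ≤ M ^ 3 * K * y := by positivity
  linarith

end Comparator

/-- The regret of slot `t + 1` against the reference policy `θ`, given the past. -/
noncomputable def slotRegret {Ω : Type*} {K : ℕ} (M δ : ℝ) (𝒮 : ℕ → Measure (Fin K → ℝ))
    (θ : ℕ → Fin K → ℝ) (A S : ℕ → Ω → Fin K → ℝ) (a : ℕ → Ω → Fin K) (ξ : ℕ → Ω → Fin K → ℝ)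
    (t : ℕ) (ω : Ω) : ℝ :=
  ∑ i, meanVec (𝒮 (t + 1)) i *
    (queueProc A S a t ω i * (θ (t + 1) i - runPlay M δ A S a ξ t ω i))

namespace IsBoundedRun

variable {Ω : Type*} {K : ℕ} {M δ α C_V : ℝ} {A S : ℕ → Ω → Fin K → ℝ} {a : ℕ → Ω → Fin K}
  {ξ : ℕ → Ω → Fin K → ℝ} [MeasurableSpace Ω] {P : Measure Ω} {𝒜 𝒮 : ℕ → Measure (Fin K → ℝ)}
  {θ : ℕ → Fin K → ℝ} {s m k : ℕ}

/-- The relative entropies telescope, except that the comparator moves: replacing u_k by u_{k+1}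
costs ln(1/β) times their ℓ¹ distance. The leading 1 is the initial entropy. The entropy of the
current state is kept on the left so that one more slot can be added. -/
theorem mirror_sum (h : IsBoundedRun P M δ α 𝒜 𝒮 A S a ξ) (hm : 2 ≤ m) {u : ℕ → Fin K → ℝ}
    (hu : ∀ k, u k ∈ truncSimplex K (epochFloor K m)) {c : ℝ}
    (hstep : ∀ k < m, epochRate K M δ m * ∑ i, meanVec (𝒮 (s + k + 1)) i *
        ∫ ω in epochEvent M A S a s m, queueProc A S a (s + k) ω i *
          (u k i - runState M δ A S a ξ (s + k) ω i) ∂P ≤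
      (∫ ω in epochEvent M A S a s m, relEntropy (u k) (runState M δ A S a ξ (s + k) ω) ∂P) -
      (if k + 1 < m then
        ∫ ω in epochEvent M A S a s m,
          relEntropy (u k) (runState M δ A S a ξ (s + k + 1) ω) ∂P
        else 0) + c) (n : ℕ) (hn : n < m) :
    (∑ k ∈ Finset.range n, epochRate K M δ m * ∑ i, meanVec (𝒮 (s + k + 1)) i *
        ∫ ω in epochEvent M A S a s m, queueProc A S a (s + k) ω i *
          (u k i - runState M δ A S a ξ (s + k) ω i) ∂P) +
      ∫ ω in epochEvent M A S a s m, relEntropy (u n) (runState M δ A S a ξ (s + n) ω) ∂P ≤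
    Real.log (1 / epochFloor K m) *
      (1 + ∑ k ∈ Finset.range n, ∑ i, |u (k + 1) i - u k i|) *
        P.real (epochEvent M A S a s m) + n * c := by
  have := h.prob
  have hβ := epochFloor_pos h.card_pos (m := m) (by omega)
  have hB := h.run.history_le s _ (measurableSet_epochEvent (M := M) (A := A) (S := S) (a := a)
    (s := s) (m := m))
  induction n with
  | zero =>
    have := setIntegral_mono_on (h.integrableOn_relEntropy (s := s) hn (hu 0))
      (integrable_const (Real.log (1 / epochFloor K m))).integrableOn hB
      fun ω hω => relEntropy_le hβ (hu 0) (h.runState_mem_of_mem hω hn)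
    simpa [mul_comm] using this
  | succ n ih =>
    have ih := ih (by omega)
    have h1 := hstep n (by omega)
    rw [if_pos hn] at h1
    have i1 := h.integrableOn_relEntropy (s := s) hn (hu (n + 1))
    have i2 := h.integrableOn_relEntropy (s := s) hn (hu n)
    have h2 : (∫ ω in epochEvent M A S a s m,
          relEntropy (u (n + 1)) (runState M δ A S a ξ (s + (n + 1)) ω) ∂P) -
        ∫ ω in epochEvent M A S a s m,
          relEntropy (u n) (runState M δ A S a ξ (s + (n + 1)) ω) ∂P ≤
        Real.log (1 / epochFloor K m) * (∑ i, |u (n + 1) i - u n i|) *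
          P.real (epochEvent M A S a s m) := by
      rw [← integral_sub i1 i2]
      have := setIntegral_mono_on (i1.sub i2)
        (integrable_const (Real.log (1 / epochFloor K m) *
          (∑ i, |u (n + 1) i - u n i|))).integrableOn hB
        fun ω hω => relEntropy_sub_le hβ (hu (n + 1)) (hu n) (h.runState_mem_of_mem hω hn)
      simpa [mul_comm, mul_assoc, mul_left_comm] using this
    rw [Finset.sum_range_succ, Finset.sum_range_succ]
    push_cast
    rw [← add_assoc] at h2 ⊢
    linarith

/-- Two replacements: θ is moved into the truncated simplex, at a cost m^{-3}θ_i in coordinate i,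
and the played distribution is replaced by the state, at a cost of at most the exploration rate γ in
each coordinate. Summing over i gives m^{-3} + γK. -/
theorem setIntegral_slotRegret_le (h : IsBoundedRun P M δ α 𝒜 𝒮 A S a ξ) (hk : k < m)
    (hθ : ∀ t, 1 ≤ t → θ t ∈ stdSimplex ℝ (Fin K)) :
    ∫ ω in epochEvent M A S a s m, slotRegret M δ 𝒮 θ A S a ξ (s + k) ω ∂P ≤
      (∑ i, meanVec (𝒮 (s + k + 1)) i *
        ∫ ω in epochEvent M A S a s m, queueProc A S a (s + k) ω i *
          (truncComparator m (θ (s + k + 1)) i - runState M δ A S a ξ (s + k) ω i) ∂P) +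
      (((m : ℝ) ^ 3)⁻¹ + (2 * M * (m : ℝ) ^ (δ / 3))⁻¹ * K) * (M * (3 * M * m)) *
        P.real (epochEvent M A S a s m) := by
  have := h.prob
  set B := epochEvent M A S a s m with hBdef
  have hB : MeasurableSet B := h.run.history_le s _ measurableSet_epochEvent
  have hm : 1 ≤ m := by omega
  have hM := h.nonneg
  set γ := (2 * M * (m : ℝ) ^ (δ / 3))⁻¹ with hγ
  set b := ((m : ℝ) ^ 3)⁻¹ with hb
  have hb0 : 0 ≤ b := by positivity
  have hγ0 : 0 ≤ γ := by positivity
  have hθ' := hθ (s + k + 1) (by omega)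
  have hbdd : ∀ (v : ℝ) (i : Fin K) {x : Ω → ℝ}, Measurable x → (∀ ω, |x ω| ≤ 1) →
      Integrable (fun ω => queueProc A S a (s + k) ω i * (v - x ω)) P := by
    intro v i x hx hx1
    refine (h.integrable_queue (s + k) i).mul_bdd (c := |v| + 1)
      (measurable_const.sub hx).aestronglyMeasurable (ae_of_all _ fun ω => ?_)
    exact (abs_sub _ _).trans (add_le_add_right (hx1 ω) _)
  have hreg : ∀ i, Integrable (fun ω => queueProc A S a (s + k) ω i *
      (θ (s + k + 1) i - runPlay M δ A S a ξ (s + k) ω i)) P := fun i =>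
    hbdd _ i ((h.measurable_play _ i).mono (h.run.history_le _) le_rfl) (h.norm_play_le _ i)
  have hst : ∀ i, Integrable (fun ω => queueProc A S a (s + k) ω i *
      (truncComparator m (θ (s + k + 1)) i - runState M δ A S a ξ (s + k) ω i)) P := fun i =>
    hbdd _ i ((h.measurable_state _ i).mono (h.run.history_le _) le_rfl) fun ω => by
      have hx := h.state_mem (s + k) ω
      rw [abs_of_nonneg (hx.1 i)]
      exact le_one_of_mem_stdSimplex hx i
  have hcoord : ∀ i, meanVec (𝒮 (s + k + 1)) i * ∫ ω in B, queueProc A S a (s + k) ω i *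
        (θ (s + k + 1) i - runPlay M δ A S a ξ (s + k) ω i) ∂P ≤
      meanVec (𝒮 (s + k + 1)) i * (∫ ω in B, queueProc A S a (s + k) ω i *
        (truncComparator m (θ (s + k + 1)) i - runState M δ A S a ξ (s + k) ω i) ∂P) +
      (b * θ (s + k + 1) i + γ) * (M * (3 * M * m) * P.real B) := by
    intro i
    have hσ0 := (h.service (s + k + 1) (by omega)).meanVec_nonneg i
    have hσ1 := (h.service (s + k + 1) (by omega)).meanVec_le h.two_le h.one_le i
    have h1 : ∫ ω in B, queueProc A S a (s + k) ω i *
          (θ (s + k + 1) i - runPlay M δ A S a ξ (s + k) ω i) ∂P ≤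
        ∫ ω in B, (queueProc A S a (s + k) ω i *
          (truncComparator m (θ (s + k + 1)) i - runState M δ A S a ξ (s + k) ω i) +
          (b * θ (s + k + 1) i + γ) * queueProc A S a (s + k) ω i) ∂P := by
      refine setIntegral_mono_on (hreg i).integrableOn
        ((hst i).add ((h.integrable_queue _ i).const_mul _)).integrableOn hB fun ω hω => ?_
      have hq := queueProc_nonneg (A := A) (S := S) (a := a) (s + k) ω i
      have hx := h.state_mem (s + k) ω
      obtain ⟨g0, g1, -⟩ := exploreRate_bounds h.card_pos h.one_le h.delta_pos
        (queueProc A S a s ω)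
      rw [hω.2, ← hγ] at g1
      have hp : runState M δ A S a ξ (s + k) ω i - γ ≤ runPlay M δ A S a ξ (s + k) ω i := by
        rw [runPlay_eq hω hk, exp3Play_apply]
        have h2 := mul_le_mul g1 (le_one_of_mem_stdSimplex hx i) (hx.1 i) hγ0
        have h3 : 0 ≤ exploreRate M δ (queueProc A S a s ω) / K := by positivity
        nlinarith
      have hu : θ (s + k + 1) i ≤
          truncComparator m (θ (s + k + 1)) i + b * θ (s + k + 1) i := by
        have := epochFloor_pos h.card_pos hm
        simp only [truncComparator]
        linarith
      have h4 : θ (s + k + 1) i - runPlay M δ A S a ξ (s + k) ω i ≤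
          truncComparator m (θ (s + k + 1)) i - runState M δ A S a ξ (s + k) ω i +
            (b * θ (s + k + 1) i + γ) := by linarith
      have := mul_le_mul_of_nonneg_left h4 hq
      linarith
    rw [integral_add (hst i).integrableOn ((h.integrable_queue _ i).const_mul _).integrableOn,
      integral_const_mul] at h1
    have h2 := h.setIntegral_queue_le (s := s) hk i
    have h3 : 0 ≤ ∫ ω in B, queueProc A S a (s + k) ω i ∂P :=
      integral_nonneg fun ω => queueProc_nonneg _ _ _
    have h5 : 0 ≤ b * θ (s + k + 1) i + γ := add_nonneg (mul_nonneg hb0 (hθ'.1 i)) hγ0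
    have h6 : meanVec (𝒮 (s + k + 1)) i * ∫ ω in B, queueProc A S a (s + k) ω i ∂P ≤
        M * (3 * M * m * P.real B) := mul_le_mul hσ1 h2 h3 hM
    have h7 := mul_le_mul_of_nonneg_left h6 h5
    have h8 := mul_le_mul_of_nonneg_left h1 hσ0
    linarith
  have hsum := Finset.sum_le_sum fun i (_ : i ∈ Finset.univ) => hcoord i
  unfold slotRegret
  rw [integral_finsetSum _ fun i _ => ((hreg i).const_mul _).integrableOn]
  simp_rw [integral_const_mul]
  refine hsum.trans (le_of_eq ?_)
  rw [Finset.sum_add_distrib, ← Finset.sum_mul, Finset.sum_add_distrib, ← Finset.mul_sum, hθ'.2]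
  simp only [Finset.sum_const, Finset.card_univ, Fintype.card_fin, nsmul_eq_mul]
  ring

/-- Any initial segment of the epoch is allowed, because the horizon may cut the epoch off. -/
theorem epoch_regret_le (h : IsBoundedRun P M δ α 𝒜 𝒮 A S a ξ) (hm : 2 ≤ m) (hδ1 : δ ≤ 1)
    (hC : 0 < C_V) (hθ : ∀ t, 1 ≤ t → θ t ∈ stdSimplex ℝ (Fin K))
    (hV : TimeHomogeneousVariation θ C_V δ) {n : ℕ} (hn : n ≤ m) :
    ∑ k ∈ Finset.range n,
        ∫ ω in epochEvent M A S a s m, slotRegret M δ 𝒮 θ A S a ξ (s + k) ω ∂P ≤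
      2 / 7 * ssmwRate K M δ C_V m * (M * m ^ 2) * P.real (epochEvent M A S a s m) := by
  have := h.prob
  set B := epochEvent M A S a s m with hBdef
  set u : ℕ → Fin K → ℝ := fun k => truncComparator m (θ (s + k + 1)) with hu
  set η := epochRate K M δ m with hη
  set L := 3 * Real.log m + Real.log K with hL
  have hηpos : 0 < η := epochRate_pos h.card_pos h.one_le (by omega)
  have hmem : ∀ k, u k ∈ truncSimplex K (epochFloor K m) := fun k =>
    truncComparator_mem h.card_pos (by omega) (hθ _ (by omega))
  have hlog : Real.log (1 / epochFloor K m) = L := log_inv_epochFloor h.card_pos (by omega)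
  have hm2 : (2 : ℝ) ≤ m := by exact_mod_cast hm
  -- This merges the initial entropy with the path length: 1 + C_V m^{1-δ} ≤ (1 + C_V) m^{1-δ}.
  have hpow : 1 ≤ (m : ℝ) ^ (1 - δ) := Real.one_le_rpow (by linarith) (by linarith)
  have hL0 : 0 ≤ L := by
    have h1 : (1 : ℝ) ≤ K := by exact_mod_cast h.card_pos
    have := Real.log_nonneg h1
    have := Real.log_nonneg (by linarith : (1 : ℝ) ≤ m)
    positivity
  set c := (1 / ((m : ℝ) ^ (δ / 3) * M * (M * m)) + 2 * η * K) * (M ^ 2 * (3 * M * m) ^ 2)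
    with hc
  set e := (((m : ℝ) ^ 3)⁻¹ + (2 * M * (m : ℝ) ^ (δ / 3))⁻¹ * K) * (M * (3 * M * m)) with he
  have hM := h.nonneg
  have hc0 : 0 ≤ c := by positivity
  have he0 : 0 ≤ e := by positivity
  set R : ℕ → ℝ := fun k => ∑ i, meanVec (𝒮 (s + k + 1)) i *
    ∫ ω in B, queueProc A S a (s + k) ω i * (u k i - runState M δ A S a ξ (s + k) ω i) ∂P
    with hR
  have hcη : (η / ((m : ℝ) ^ (δ / 3) * M * (M * m)) + 2 * η ^ 2 * K) *
      (M ^ 2 * (3 * M * m) ^ 2 * P.real B) = η * c * P.real B := by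
    rw [hc]; ring
  have hstep := fun k (hk : k < m) => h.mirror_step (s := s) hm hk (hmem k)
  simp only [← hη, ← hBdef, hcη] at hstep
  have hRsum : ∑ k ∈ Finset.range n, R k ≤
      (L * ((1 + C_V) * (m : ℝ) ^ (1 - δ)) / η + n * c) * P.real B := by
    rcases n with _ | n
    · simp only [Finset.range_zero, Finset.sum_empty, Nat.cast_zero, zero_mul, add_zero]
      positivity
    have h1 := h.mirror_sum hm hmem hstep n (by omega)
    -- The last slot is added separately, since it may be the end of the epoch, where no next state
    -- exists.
    have h2 := hstep n (by omega)
    have h3 : 0 ≤ if n + 1 < m then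
        ∫ ω in B, relEntropy (u n) (runState M δ A S a ξ (s + n + 1) ω) ∂P else 0 := by
      split_ifs with hn'
      · refine setIntegral_nonneg (h.run.history_le s _ measurableSet_epochEvent) fun ω hω => ?_
        have hβ := epochFloor_pos h.card_pos (m := m) (by omega)
        exact relEntropy_nonneg (fun i => hβ.trans_le ((hmem n).2 i))
          fun i => hβ.trans_le ((h.runState_mem_of_mem hω hn').2 i)
      · exact le_rfl
    -- The n + 1 slots have n increments, which is the count in the variation assumption; its
    -- uniformity in the starting time matters because epochs begin at random times.
    have hvar : ∑ k ∈ Finset.range n, ∑ i, |u (k + 1) i - u k i| ≤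
        C_V * (m : ℝ) ^ (1 - δ) := by
      calc ∑ k ∈ Finset.range n, ∑ i, |u (k + 1) i - u k i|
          ≤ ∑ k ∈ Finset.range n, ∑ i, |θ (s + 1 + k + 1) i - θ (s + 1 + k) i| := by
            refine Finset.sum_le_sum fun k _ => ?_
            rw [show s + 1 + k = s + k + 1 by omega]
            exact sum_abs_truncComparator_sub_le (by omega) (θ (s + (k + 1) + 1))
              (θ (s + k + 1))
        _ = ∑ t ∈ Finset.Ico (s + 1) (s + (n + 1)), ∑ i, |θ (t + 1) i - θ t i| := by
            rw [Finset.sum_Ico_eq_sum_range]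
            congr 2
            omega
        _ ≤ C_V * ((n + 1 : ℕ) : ℝ) ^ (1 - δ) := hV s (n + 1) (by omega)
        _ ≤ C_V * (m : ℝ) ^ (1 - δ) := by
            refine mul_le_mul_of_nonneg_left (Real.rpow_le_rpow (by positivity) ?_ (by linarith))
              hC.le
            exact_mod_cast hn
    rw [hlog] at h1
    have h4 : η * ∑ k ∈ Finset.range (n + 1), R k ≤
        L * (1 + ∑ k ∈ Finset.range n, ∑ i, |u (k + 1) i - u k i|) * P.real B +
          (n + 1) * (η * c * P.real B) := by
      rw [Finset.sum_range_succ, mul_add, Finset.mul_sum]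
      simp only [hR]
      linarith
    have h5 : L * (1 + ∑ k ∈ Finset.range n, ∑ i, |u (k + 1) i - u k i|) * P.real B ≤
        L * ((1 + C_V) * (m : ℝ) ^ (1 - δ)) * P.real B := by
      refine mul_le_mul_of_nonneg_right (mul_le_mul_of_nonneg_left ?_ hL0) measureReal_nonneg
      linarith
    refine le_of_mul_le_mul_left ?_ hηpos
    have h6 : η * ((L * ((1 + C_V) * (m : ℝ) ^ (1 - δ)) / η + ((n + 1 : ℕ) : ℝ) * c) *
        P.real B) = L * ((1 + C_V) * (m : ℝ) ^ (1 - δ)) * P.real B +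
          (n + 1) * (η * c * P.real B) := by
      push_cast
      field_simp
    linarith
  have hn' : (n : ℝ) ≤ m := by exact_mod_cast hn
  calc ∑ k ∈ Finset.range n, ∫ ω in B, slotRegret M δ 𝒮 θ A S a ξ (s + k) ω ∂P
      ≤ ∑ k ∈ Finset.range n, (R k + e * P.real B) := by
        refine Finset.sum_le_sum fun k hk => ?_
        exact h.setIntegral_slotRegret_le (by have := Finset.mem_range.1 hk; omega) hθ
    _ = ∑ k ∈ Finset.range n, R k + n * (e * P.real B) := by
        rw [Finset.sum_add_distrib]; simp
    _ ≤ (L * ((1 + C_V) * (m : ℝ) ^ (1 - δ)) / η + m * c + m * e) * P.real B := by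
        have h1 : (n : ℝ) * c * P.real B ≤ m * c * P.real B := by gcongr
        have h2 : (n : ℝ) * (e * P.real B) ≤ m * (e * P.real B) := by gcongr
        linarith
    _ ≤ _ := mul_le_mul_of_nonneg_right
        (epoch_error_le h.card_pos h.one_le h.delta_pos hδ1 hC hm) measureReal_nonneg

end IsBoundedRun

/-! ### The regret over a finite horizon -/

/-- An epoch length is unbounded, so splitting an integral by its value needs countable additivity.
-/
theorem integral_nonpos_of_fibers {Ω : Type*} [MeasurableSpace Ω] {P : Measure Ω} {f : Ω → ℕ}
    (hf : Measurable f) {H : Ω → ℝ} (hH : Integrable H P)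
    (h : ∀ m, ∫ ω in f ⁻¹' {m}, H ω ∂P ≤ 0) : ∫ ω, H ω ∂P ≤ 0 := by
  have hU : ⋃ m, f ⁻¹' {m} = Set.univ := by
    ext ω; simp
  have hs := hasSum_integral_iUnion (μ := P) (f := H) (s := fun m => f ⁻¹' {m})
    (fun m => hf (measurableSet_singleton m))
    (fun i j hij => Set.disjoint_left.2 fun ω hi hj => hij (hi.symm.trans hj))
    hH.integrableOn
  rw [hU, setIntegral_univ] at hs
  exact hasSum_le h hs hasSum_zero

/-- At m = 2 the rate is at least 21M, far above ε/2. Length 2 must be excluded because m²/7 ≤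
(m-1)²/2, used for truncated epochs, fails there. -/
theorem three_le_of_ssmwRate_le {K m : ℕ} {M δ C_V ε : ℝ} (hK : 0 < K) (hM : 1 ≤ M)
    (hδ1 : δ ≤ 1) (hC : 0 < C_V) (hε : ε ≤ M) (hm : 2 ≤ m)
    (hf : ssmwRate K M δ C_V m ≤ ε / 2) : 3 ≤ m := by
  by_contra hlt
  obtain rfl : m = 2 := by omega
  have hK1 : (1 : ℝ) ≤ K := by exact_mod_cast hK
  have h1 : (1 : ℝ) / 2 ≤ (2 : ℝ) ^ (-δ / 3) := by
    calc (1 : ℝ) / 2 = (2 : ℝ) ^ (-1 : ℝ) := by rw [Real.rpow_neg_one]; norm_num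
      _ ≤ _ := Real.rpow_le_rpow_of_exponent_le one_le_two (by linarith)
  have h2 := Real.log_two_gt_d9
  have h3 := Real.log_nonneg hK1
  have h4 : M ≤ M ^ 2 := by nlinarith
  unfold ssmwRate at hf
  push_cast at hf
  have h5 : 42 * 1 * M * 1 * (1 / 2) * 1 ≤ 42 * (1 + C_V) * M ^ 2 * K * (2 : ℝ) ^ (-δ / 3) *
      (3 * Real.log 2 + Real.log K) := by
    gcongr
    · linarith
    · linarith
  linarith

namespace IsBoundedRun

variable {Ω : Type*} {K : ℕ} {M δ α C_V ε : ℝ} {A S : ℕ → Ω → Fin K → ℝ} {a : ℕ → Ω → Fin K}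
  {ξ : ℕ → Ω → Fin K → ℝ} [MeasurableSpace Ω] {P : Measure Ω} {𝒜 𝒮 : ℕ → Measure (Fin K → ℝ)}
  {θ : ℕ → Fin K → ℝ} {s m m₀ k : ℕ}

theorem integrable_queue_mul_play (h : IsBoundedRun P M δ α 𝒜 𝒮 A S a ξ) (t : ℕ) (i : Fin K) :
    Integrable (fun ω => queueProc A S a t ω i * runPlay M δ A S a ξ t ω i) P :=
  (h.integrable_queue t i).mul_bdd (c := 1)
    ((h.measurable_play _ i).mono (h.run.history_le _) le_rfl).aestronglyMeasurable
    (ae_of_all _ (h.norm_play_le t i))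

theorem integrable_queue_mul_sub_play (h : IsBoundedRun P M δ α 𝒜 𝒮 A S a ξ) (t : ℕ) (v : ℝ)
    (i : Fin K) :
    Integrable (fun ω => queueProc A S a t ω i * (v - runPlay M δ A S a ξ t ω i)) P := by
  simp only [mul_sub]
  exact ((h.integrable_queue t i).mul_const v).sub (h.integrable_queue_mul_play t i)

theorem integrable_slotRegret (h : IsBoundedRun P M δ α 𝒜 𝒮 A S a ξ) (θ : ℕ → Fin K → ℝ)
    (t : ℕ) : Integrable (slotRegret M δ 𝒮 θ A S a ξ t) P :=
  integrable_finsetSum _ fun i _ => (h.integrable_queue_mul_sub_play t _ i).const_mul _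

theorem integrable_sum_queue (h : IsBoundedRun P M δ α 𝒜 𝒮 A S a ξ) (t : ℕ) :
    Integrable (fun ω => ∑ i, queueProc A S a t ω i) P :=
  integrable_finsetSum _ fun i _ => h.integrable_queue t i

theorem integrable_sum_queue_sq (h : IsBoundedRun P M δ α 𝒜 𝒮 A S a ξ) (t : ℕ) :
    Integrable (fun ω => ∑ i, queueProc A S a t ω i ^ 2) P :=
  integrable_finsetSum _ fun i _ => h.integrable_queue_sq t i

/-- The service of the algorithm is dropped. The weights of θ sum to 1, so the remaining bound
carries no factor K. -/
theorem setIntegral_slotRegret_le_of_short (h : IsBoundedRun P M δ α 𝒜 𝒮 A S a ξ) (hk : k < m)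
    (hθ : ∀ t, 1 ≤ t → θ t ∈ stdSimplex ℝ (Fin K)) :
    ∫ ω in epochEvent M A S a s m, slotRegret M δ 𝒮 θ A S a ξ (s + k) ω ∂P ≤
      3 * M ^ 2 * m * P.real (epochEvent M A S a s m) := by
  have := h.prob
  have hθ' := hθ (s + k + 1) (by omega)
  have h1 : ∫ ω in epochEvent M A S a s m, slotRegret M δ 𝒮 θ A S a ξ (s + k) ω ∂P ≤
      ∫ ω in epochEvent M A S a s m, ∑ i, M * θ (s + k + 1) i *
        queueProc A S a (s + k) ω i ∂P := by
    refine integral_mono (h.integrable_slotRegret θ _).integrableOn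
      (integrable_finsetSum _ fun i _ => ((h.integrable_queue _ i).const_mul _)).integrableOn
      fun ω => Finset.sum_le_sum fun i _ => ?_
    have hσ0 := (h.service (s + k + 1) (by omega)).meanVec_nonneg i
    have hσ1 := (h.service (s + k + 1) (by omega)).meanVec_le h.two_le h.one_le i
    have hq := queueProc_nonneg (A := A) (S := S) (a := a) (s + k) ω i
    have hp := (h.play_mem (s + k) ω).1 i
    calc _ ≤ meanVec (𝒮 (s + k + 1)) i * (queueProc A S a (s + k) ω i * θ (s + k + 1) i) := by
          refine mul_le_mul_of_nonneg_left (mul_le_mul_of_nonneg_left ?_ hq) hσ0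
          linarith
      _ ≤ M * (queueProc A S a (s + k) ω i * θ (s + k + 1) i) :=
          mul_le_mul_of_nonneg_right hσ1 (mul_nonneg hq (hθ'.1 i))
      _ = _ := by ring
  rw [integral_finsetSum _ fun i _ => ((h.integrable_queue _ i).const_mul _).integrableOn] at h1
  simp_rw [integral_const_mul] at h1
  calc _ ≤ _ := h1
    _ ≤ ∑ i, M * θ (s + k + 1) i * (3 * M * m * P.real (epochEvent M A S a s m)) :=
        Finset.sum_le_sum fun i _ => mul_le_mul_of_nonneg_left (h.setIntegral_queue_le hk i)
          (mul_nonneg h.nonneg (hθ'.1 i))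
    _ = _ := by
        rw [← Finset.sum_mul, ← Finset.mul_sum, hθ'.2]
        ring

/-- The regret of a (possibly truncated) epoch is compensated by the queue lengths of its slots,
or by the final queue lengths if the epoch is truncated at the horizon `T`. -/
theorem epoch_balance (h : IsBoundedRun P M δ α 𝒜 𝒮 A S a ξ) (hδ1 : δ ≤ 1) (hC : 0 < C_V)
    (hθ : ∀ t, 1 ≤ t → θ t ∈ stdSimplex ℝ (Fin K)) (hV : TimeHomogeneousVariation θ C_V δ)
    (hε : 0 < ε) (hεM : ε ≤ M) (hm₀ : 2 ≤ m₀)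
    (hrate : ∀ m, m₀ ≤ m → ssmwRate K M δ C_V m ≤ ε / 2) (N : ℕ) :
    ∑ k ∈ Finset.range (min m N), ∫ ω in epochEvent M A S a s m,
        (slotRegret M δ 𝒮 θ A S a ξ (s + k) ω - ε / 2 * ∑ i, queueProc A S a (s + k) ω i -
          3 * M ^ 2 * m₀) ∂P ≤
      if N < m then
        ∫ ω in epochEvent M A S a s m, 1 / 2 * ∑ i, queueProc A S a (s + N) ω i ^ 2 ∂P
      else 0 := by
  have := h.prob
  set B := epochEvent M A S a s m with hBdef
  have hBs : MeasurableSet[history A S a s] B := measurableSet_epochEvent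
  have hB : MeasurableSet B := h.run.history_le s _ hBs
  have hM := h.nonneg
  have hP : 0 ≤ P.real B := measureReal_nonneg
  have hsplit : ∀ k, ∫ ω in B, (slotRegret M δ 𝒮 θ A S a ξ (s + k) ω -
        ε / 2 * ∑ i, queueProc A S a (s + k) ω i - 3 * M ^ 2 * m₀) ∂P =
      (∫ ω in B, slotRegret M δ 𝒮 θ A S a ξ (s + k) ω ∂P) -
        ε / 2 * (∫ ω in B, ∑ i, queueProc A S a (s + k) ω i ∂P) -
        3 * M ^ 2 * m₀ * P.real B := by
    intro k
    have i1 : Integrable (fun ω => slotRegret M δ 𝒮 θ A S a ξ (s + k) ω -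
        ε / 2 * ∑ i, queueProc A S a (s + k) ω i) P :=
      (h.integrable_slotRegret θ _).sub ((h.integrable_sum_queue _).const_mul _)
    rw [integral_sub i1.integrableOn (integrable_const _).integrableOn,
      integral_sub (h.integrable_slotRegret θ _).integrableOn
        ((h.integrable_sum_queue _).const_mul _).integrableOn, integral_const_mul]
    simp [mul_comm]
  have hQ0 : ∀ k, 0 ≤ ∫ ω in B, ∑ i, queueProc A S a (s + k) ω i ∂P := fun k =>
    integral_nonneg fun ω => Finset.sum_nonneg fun i _ => queueProc_nonneg _ _ _
  have hV0 : 0 ≤ if N < m then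
      ∫ ω in B, 1 / 2 * ∑ i, queueProc A S a (s + N) ω i ^ 2 ∂P else 0 := by
    split_ifs
    · exact integral_nonneg fun ω => mul_nonneg (by norm_num)
        (Finset.sum_nonneg fun i _ => sq_nonneg _)
    · exact le_rfl
  simp_rw [hsplit]
  rcases lt_or_ge m m₀ with hlt | hge
  · refine le_trans (Finset.sum_nonpos fun k hk => ?_) hV0
    have hk : k < m := (Finset.mem_range.1 hk).trans_le (min_le_left _ _)
    have h1 := h.setIntegral_slotRegret_le_of_short (s := s) hk hθ
    have h2 : (m : ℝ) ≤ m₀ := by exact_mod_cast hlt.le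
    have h3 : 3 * M ^ 2 * m * P.real B ≤ 3 * M ^ 2 * m₀ * P.real B := by gcongr
    have h4 := mul_nonneg (half_pos hε).le (hQ0 k)
    linarith
  have hm3 := three_le_of_ssmwRate_le h.card_pos h.one_le hδ1 hC hεM
    (hm₀.trans hge) (hrate m hge)
  have hm3' : (3 : ℝ) ≤ m := by exact_mod_cast hm3
  have hreg := h.epoch_regret_le (s := s) (hm₀.trans hge) hδ1 hC hθ hV (min_le_left m N)
  have hreg' : 2 / 7 * ssmwRate K M δ C_V m * (M * m ^ 2) * P.real B ≤
      ε / 7 * (M * m ^ 2) * P.real B := by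
    have := hrate m hge
    gcongr
    linarith
  have hnorm : ∀ k, (2 * M * ((m : ℝ) - 1) - k * M) * P.real B ≤
      ∫ ω in B, ‖queueProc A S a (s + k) ω‖ ∂P := fun k =>
    h.le_setIntegral_norm_queue_add hBs (fun ω hω => h.le_norm_queue (by omega) hω) k
  rw [Finset.sum_sub_distrib, Finset.sum_sub_distrib, ← Finset.mul_sum]
  have hc0 : 0 ≤ ∑ _k ∈ Finset.range (min m N), 3 * M ^ 2 * m₀ * P.real B :=
    Finset.sum_nonneg fun _ _ => by positivity
  have hS0 : 0 ≤ ∑ k ∈ Finset.range (min m N),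
      ∫ ω in B, ∑ i, queueProc A S a (s + k) ω i ∂P := Finset.sum_nonneg fun k _ => hQ0 k
  split_ifs with hN
  · have h1 := hnorm N
    have hNm : (N : ℝ) ≤ m - 1 := by
      have : (N : ℝ) + 1 ≤ m := by exact_mod_cast hN
      linarith
    set c := M * ((m : ℝ) - 1) with hc
    -- The truncated epoch has run for at most m-1 slots, and each lowers the maximal queue by at
    -- most M on average.
    have h2 : c * P.real B ≤ ∫ ω in B, ‖queueProc A S a (s + N) ω‖ ∂P := by
      refine le_trans (mul_le_mul_of_nonneg_right ?_ hP) h1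
      nlinarith
    -- The tangent bound x²/2 ≥ cx - c²/2 converts the first moment of the maximal queue into a
    -- lower bound c²/2 for the quadratic function.
    have h3 : ∫ ω in B, (c * ‖queueProc A S a (s + N) ω‖ - c ^ 2 / 2) ∂P ≤
        ∫ ω in B, 1 / 2 * ∑ i, queueProc A S a (s + N) ω i ^ 2 ∂P := by
      refine integral_mono (((h.integrable_norm_queue _).const_mul c).sub
        (integrable_const _)).integrableOn
        ((h.integrable_sum_queue_sq _).const_mul _).integrableOn fun ω => ?_
      have := norm_sq_le_sum_queue_sq (A := A) (S := S) (a := a) (s + N) ω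
      change c * ‖queueProc A S a (s + N) ω‖ - c ^ 2 / 2 ≤ _
      nlinarith [sq_nonneg (‖queueProc A S a (s + N) ω‖ - c)]
    rw [integral_sub ((h.integrable_norm_queue _).const_mul c).integrableOn
      (integrable_const _).integrableOn, integral_const_mul] at h3
    simp only [integral_const, MeasurableSet.univ, measureReal_restrict_apply, Set.univ_inter,
      smul_eq_mul] at h3
    have hc00 : 0 ≤ c := by rw [hc]; exact mul_nonneg hM (by linarith)
    have h4 := mul_le_mul_of_nonneg_left h2 hc00
    have h5 : ε / 7 * (M * m ^ 2) * P.real B ≤ c ^ 2 / 2 * P.real B := by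
      refine mul_le_mul_of_nonneg_right ?_ hP
      calc ε / 7 * (M * m ^ 2) ≤ M / 7 * (M * m ^ 2) := by gcongr
        _ = M ^ 2 * (m ^ 2 / 7) := by ring
        _ ≤ M ^ 2 * (((m : ℝ) - 1) ^ 2 / 2) := by gcongr M ^ 2 * ?_; nlinarith
        _ = c ^ 2 / 2 := by rw [hc]; ring
    have h6 := mul_nonneg (half_pos hε).le hS0
    linarith
  · rw [min_eq_left (not_lt.1 hN)] at hreg hc0 ⊢
    have h1 : ∑ k ∈ Finset.range m, (2 * M * ((m : ℝ) - 1) - k * M) * P.real B ≤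
        ∑ k ∈ Finset.range m, ∫ ω in B, ∑ i, queueProc A S a (s + k) ω i ∂P := by
      refine Finset.sum_le_sum fun k _ => (hnorm k).trans ?_
      exact integral_mono (h.integrable_norm_queue _).integrableOn
        (h.integrable_sum_queue _).integrableOn fun ω => norm_le_sum_queue _ ω
    have hgauss : ∑ k ∈ Finset.range m, (k : ℝ) = m * (m - 1) / 2 := by
      have := Finset.sum_range_id_mul_two m
      have h2 : ((∑ k ∈ Finset.range m, k : ℕ) : ℝ) * 2 = m * ((m - 1 : ℕ) : ℝ) := by
        exact_mod_cast this
      rw [Nat.cast_sub (by omega)] at h2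
      push_cast at h2
      linarith
    have h2 : ∑ k ∈ Finset.range m, (2 * M * ((m : ℝ) - 1) - k * M) * P.real B =
        3 / 2 * (M * (m * (m - 1))) * P.real B := by
      rw [← Finset.sum_mul, Finset.sum_sub_distrib,
        ← Finset.sum_mul (Finset.range m) (fun k => (k : ℝ)) M, hgauss]
      simp only [Finset.sum_const, Finset.card_range, nsmul_eq_mul]
      ring
    rw [h2] at h1
    -- A completed epoch: the queue lengths sum to at least (3/2)Mm(m-1), and m²/7 ≤ (3/4)m(m-1).
    have h3 : ε / 7 * (M * m ^ 2) * P.real B ≤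
        ε / 2 * (3 / 2 * (M * (m * (m - 1))) * P.real B) := by
      have : ε / 7 * (M * m ^ 2) ≤ ε / 2 * (3 / 2 * (M * (m * (m - 1)))) := by
        have : ε * M * (m ^ 2 / 7) ≤ ε * M * (3 / 4 * (m * (m - 1))) := by
          gcongr ε * M * ?_
          nlinarith
        linarith
      have := mul_le_mul_of_nonneg_right this hP
      linarith
    have h4 := mul_le_mul_of_nonneg_left h1 (half_pos hε).le
    linarith

/-- The total regret up to a horizon `T`. -/
theorem sum_slotRegret_le (h : IsBoundedRun P M δ α 𝒜 𝒮 A S a ξ) (hδ1 : δ ≤ 1) (hC : 0 < C_V)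
    (hθ : ∀ t, 1 ≤ t → θ t ∈ stdSimplex ℝ (Fin K)) (hV : TimeHomogeneousVariation θ C_V δ)
    (hε : 0 < ε) (hεM : ε ≤ M) (hm₀ : 2 ≤ m₀)
    (hrate : ∀ m, m₀ ≤ m → ssmwRate K M δ C_V m ≤ ε / 2) (T : ℕ) :
    ∑ t ∈ Finset.range T, ∫ ω, slotRegret M δ 𝒮 θ A S a ξ t ω ∂P ≤
      ε / 2 * ∑ t ∈ Finset.range T, ∫ ω, ∑ i, queueProc A S a t ω i ∂P +
        3 * M ^ 2 * m₀ * T + ∫ ω, 1 / 2 * ∑ i, queueProc A S a T ω i ^ 2 ∂P := by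
  have := h.prob
  set cost : ℕ → Ω → ℝ := fun t ω => slotRegret M δ 𝒮 θ A S a ξ t ω -
    ε / 2 * ∑ i, queueProc A S a t ω i - 3 * M ^ 2 * m₀ with hcost
  set V : Ω → ℝ := fun ω => 1 / 2 * ∑ i, queueProc A S a T ω i ^ 2 with hVdef
  have hV0 : ∀ ω, 0 ≤ V ω := fun ω => mul_nonneg (by norm_num)
    (Finset.sum_nonneg fun i _ => sq_nonneg _)
  have hVint : Integrable V P := (h.integrable_sum_queue_sq T).const_mul _
  have hcint : ∀ t, Integrable (cost t) P := fun t =>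
    ((h.integrable_slotRegret θ t).sub ((h.integrable_sum_queue t).const_mul _)).sub
      (integrable_const _)
  have hstart : ∀ t s, MeasurableSet {ω | runStart M A S a t ω = s} := fun t s =>
    h.run.history_le t _ (measurable_runStart t (measurableSet_singleton s))
  -- The balance of the epoch beginning after s: the costs of its slots before the horizon, minus V
  -- if the horizon falls inside it.
  set H : ℕ → Ω → ℝ := fun s ω => (∑ t ∈ Finset.range T,
      {ω | runStart M A S a t ω = s}.indicator (cost t) ω) -
    {ω | runStart M A S a T ω = s}.indicator V ω with hH
  have hHint : ∀ s, Integrable (H s) P := fun s =>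
    (integrable_finsetSum _ fun t _ => (hcint t).indicator (hstart t s)).sub
      (hVint.indicator (hstart T s))
  have hHneg : ∀ s ∈ Finset.range T, ∫ ω, H s ω ∂P ≤ 0 := by
    intro s hs
    have hsT : s < T := Finset.mem_range.1 hs
    -- The value 0, which is not an epoch length, marks that no epoch begins after s; then `H s`
    -- vanishes.
    have hmf : Measurable fun ω => if runStart M A S a s ω = s then
        epochLen M (queueProc A S a s ω) else 0 :=
      Measurable.ite (hstart s s) (measurable_epochLen.comp (h.run.measurable_queueProc s))
        measurable_const
    refine integral_nonpos_of_fibers hmf (hHint s) fun m => ?_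
    rcases Nat.eq_zero_or_pos m with rfl | hm
    · refine le_of_eq (setIntegral_eq_zero_of_forall_eq_zero fun ω hω => ?_)
      have hne : runStart M A S a s ω ≠ s := by
        intro heq
        have h1 : (if runStart M A S a s ω = s then
          epochLen M (queueProc A S a s ω) else 0) = 0 := hω
        rw [if_pos heq] at h1
        have := one_le_epochLen (M := M) (queueProc A S a s ω)
        omega
      have hne' : ∀ t, runStart M A S a t ω ≠ s := fun t ht => hne (epochStart_self ht)
      simp [hH, hne']
    · have hB : (fun ω => if runStart M A S a s ω = s then
          epochLen M (queueProc A S a s ω) else 0) ⁻¹' {m} = epochEvent M A S a s m := by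
        ext ω
        simp only [Set.mem_preimage, Set.mem_singleton_iff, epochEvent, Set.mem_ofPred_eq]
        split_ifs with h1
        · simp [h1]
        · simp only [h1, false_and, iff_false]; omega
      rw [hB]
      have hBm : MeasurableSet (epochEvent M A S a s m) :=
        h.run.history_le s _ measurableSet_epochEvent
      have hbal := h.epoch_balance (s := s) (m := m) hδ1 hC hθ hV hε hεM hm₀ hrate (T - s)
      have hHB : ∀ ω ∈ epochEvent M A S a s m, H s ω =
          (∑ k ∈ Finset.range (min m (T - s)), cost (s + k) ω) -
            if T - s < m then V ω else 0 := by
        intro ω hω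
        simp only [hH, Set.indicator_apply, Set.mem_ofPred_eq]
        have hT : runStart M A S a T ω = s ↔ T - s < m := by
          have := runStart_add_eq_iff hω (T - s)
          rwa [Nat.add_sub_cancel' hsT.le] at this
        simp only [hT]
        congr 1
        rw [← Finset.sum_filter]
        have hset : (Finset.range T).filter (fun t => runStart M A S a t ω = s) =
            (Finset.range (min m (T - s))).map (addLeftEmbedding s) := by
          ext t
          simp only [Finset.mem_filter, Finset.mem_range, Finset.mem_map, addLeftEmbedding_apply]
          constructor
          · rintro ⟨h1, h2⟩
            have h3 : s ≤ t := by
              rw [← h2]; exact epochStart_le (M := M) _ t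
            refine ⟨t - s, ?_, by omega⟩
            have h4 := (runStart_add_eq_iff hω (t - s)).1 (by
              rwa [Nat.add_sub_cancel' h3])
            omega
          · rintro ⟨k, hk, rfl⟩
            exact ⟨by omega, (runStart_add_eq_iff hω k).2 (by omega)⟩
        rw [hset, Finset.sum_map]
        rfl
      rw [setIntegral_congr_fun hBm hHB, integral_sub
        (integrable_finsetSum _ fun k _ => (hcint _)).integrableOn (by
          split_ifs
          · exact hVint.integrableOn
          · exact integrableOn_zero),
        integral_finsetSum _ fun k _ => (hcint _).integrableOn, sub_nonpos]
      refine hbal.trans (le_of_eq ?_)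
      rw [Nat.add_sub_cancel' hsT.le]
      split_ifs
      · rfl
      · simp
  have hle : ∀ ω, ∑ t ∈ Finset.range T, cost t ω - V ω ≤ ∑ s ∈ Finset.range T, H s ω := by
    intro ω
    simp only [hH, Finset.sum_sub_distrib, Set.indicator_apply, Set.mem_ofPred_eq]
    rw [Finset.sum_comm]
    refine sub_le_sub (le_of_eq (Finset.sum_congr rfl fun t ht => ?_)) ?_
    · rw [Finset.sum_ite_eq, if_pos]
      have := epochStart_le (M := M) (fun s => queueProc A S a s ω) t
      have h1 := Finset.mem_range.1 ht
      exact Finset.mem_range.2 (lt_of_le_of_lt this h1)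
    -- If an epoch begins exactly at T, no s < T is charged with V; as V is nonnegative this only
    -- helps.
    · rw [Finset.sum_ite_eq]
      split_ifs
      · exact le_rfl
      · exact hV0 ω
  have hint := integral_mono ((integrable_finsetSum (Finset.range T) fun t _ => hcint t).sub hVint)
    (integrable_finsetSum (Finset.range T) fun s _ => hHint s) hle
  rw [integral_finsetSum _ fun s _ => hHint s] at hint
  have hint2 := hint.trans (Finset.sum_nonpos hHneg)
  have e1 : ∫ ω, ((fun ω => ∑ t ∈ Finset.range T, cost t ω) - V) ω ∂P =
      ∑ t ∈ Finset.range T, ∫ ω, cost t ω ∂P - ∫ ω, V ω ∂P := by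
    rw [← integral_finsetSum _ fun t _ => hcint t]
    exact integral_sub (integrable_finsetSum (Finset.range T) fun t _ => hcint t) hVint
  rw [e1] at hint2
  have e2 : ∀ t, ∫ ω, cost t ω ∂P = (∫ ω, slotRegret M δ 𝒮 θ A S a ξ t ω ∂P) -
      ε / 2 * (∫ ω, ∑ i, queueProc A S a t ω i ∂P) - 3 * M ^ 2 * m₀ := by
    intro t
    have i1 : Integrable (fun ω => slotRegret M δ 𝒮 θ A S a ξ t ω -
        ε / 2 * ∑ i, queueProc A S a t ω i) P :=
      (h.integrable_slotRegret θ _).sub ((h.integrable_sum_queue _).const_mul _)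
    simp only [hcost]
    rw [integral_sub i1 (integrable_const _), integral_sub (h.integrable_slotRegret θ _)
      ((h.integrable_sum_queue _).const_mul _), integral_const_mul]
    simp
  simp_rw [e2] at hint2
  rw [Finset.sum_sub_distrib, Finset.sum_sub_distrib, ← Finset.mul_sum] at hint2
  simp only [Finset.sum_const, Finset.card_range, nsmul_eq_mul] at hint2
  linarith

/-- The drift of the quadratic Lyapunov function in one slot. -/
theorem lyapunov_drift (h : IsBoundedRun P M δ α 𝒜 𝒮 A S a ξ) (θ : ℕ → Fin K → ℝ) (t : ℕ) :
    ∫ ω, 1 / 2 * ∑ i, queueProc A S a (t + 1) ω i ^ 2 ∂P ≤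
      (∫ ω, 1 / 2 * ∑ i, queueProc A S a t ω i ^ 2 ∂P) +
      ∑ i, (∫ ω, queueProc A S a t ω i ∂P) *
        (meanVec (𝒜 (t + 1)) i - θ (t + 1) i * meanVec (𝒮 (t + 1)) i) +
      (∫ ω, slotRegret M δ 𝒮 θ A S a ξ t ω ∂P) + (K + 1) * M ^ 2 / 2 := by
  have := h.prob
  set Q : Fin K → Ω → ℝ := fun i ω => queueProc A S a t ω i with hQ
  set F : Fin K → Ω → ℝ := fun i ω => S (t + 1) ω i ^ 2 - 2 * (Q i ω * S (t + 1) ω i) with hF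
  have iQ2 : ∀ i, Integrable (fun ω => Q i ω ^ 2) P := h.integrable_queue_sq t
  have iA2 : ∀ i, Integrable (fun ω => A (t + 1) ω i ^ 2) P := fun i =>
    (h.memLp_arrival t i).integrable_sq
  have iS2 : ∀ i, Integrable (fun ω => S (t + 1) ω i ^ 2) P := fun i =>
    (h.memLp_service t i).integrable_sq
  have iQA : ∀ i, Integrable (fun ω => Q i ω * A (t + 1) ω i) P := fun i =>
    (h.memLp_queue t i).integrable_mul (h.memLp_arrival t i)
  have iQS : ∀ i, Integrable (fun ω => Q i ω * S (t + 1) ω i) P := fun i =>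
    (h.memLp_queue t i).integrable_mul (h.memLp_service t i)
  have iF : ∀ i, Integrable (F i) P := fun i => (iS2 i).sub ((iQS i).const_mul 2)
  have mF : ∀ i, Measurable[history A S a t ⊔ innovation A S t] (F i) := fun i =>
    (((measurable_service_apply t i).pow_const 2).mono le_sup_right le_rfl).sub
      ((((measurable_queue_apply (le_refl t) i).mono le_sup_left le_rfl).mul
        ((measurable_service_apply t i).mono le_sup_right le_rfl)).const_mul 2)
  have hact := h.run.integral_action t mF iF
  have iFa : Integrable (fun ω => F (a (t + 1) ω) ω) P := by
    refine Integrable.mono' (integrable_finsetSum Finset.univ fun i _ => (iF i).norm) ?_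
      (ae_of_all _ fun ω => Finset.single_le_sum (f := fun i => ‖F i ω‖)
        (fun _ _ => norm_nonneg _) (Finset.mem_univ _))
    have h1 : Measurable fun p : Fin K × Ω => F p.1 p.2 :=
      measurable_from_prod_countable_right fun i =>
        (mF i).mono (sup_le (h.run.history_le _) (h.run.innovation_le _)) le_rfl
    exact (h1.comp ((h.run.measurable_action (t + 1) (by omega)).prodMk
      measurable_id)).aestronglyMeasurable
  set Z : Fin K → Ω → ℝ := fun i ω =>
    Q i ω ^ 2 + 2 * (Q i ω * A (t + 1) ω i) + A (t + 1) ω i ^ 2 with hZ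
  have iZ : ∀ i, Integrable (Z i) P := fun i => ((iQ2 i).add ((iQA i).const_mul 2)).add (iA2 i)
  have hpath : ∀ᵐ ω ∂P, ∑ i, queueProc A S a (t + 1) ω i ^ 2 ≤
      ∑ i, Z i ω + F (a (t + 1) ω) ω := by
    filter_upwards [h.ae_nonneg t] with ω hω
    have h1 : F (a (t + 1) ω) ω = ∑ i, if i = a (t + 1) ω then F i ω else 0 := by simp
    rw [h1, ← Finset.sum_add_distrib]
    refine Finset.sum_le_sum fun i _ => ?_
    -- Reflection at 0 only lowers the square. After expansion, the product -2AS of the served type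
    -- is dropped by nonnegativity.
    have h2 : ∀ z : ℝ, max z 0 ^ 2 ≤ z ^ 2 := fun z => by
      rcases le_total z 0 with hz | hz
      · rw [max_eq_right hz]; simpa using sq_nonneg z
      · rw [max_eq_left hz]
    rw [queueProc_succ]
    refine (h2 _).trans ?_
    have hA := hω.1 i
    have hS := hω.2 i
    simp only [hZ, hF, hQ]
    split_ifs
    · nlinarith [mul_nonneg hA hS]
    · exact le_of_eq (by ring)
  have hint := integral_mono_ae (h.integrable_sum_queue_sq (t + 1))
    ((integrable_finsetSum Finset.univ fun i _ => iZ i).add iFa) hpath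
  have e1 : ∫ ω, ((fun ω => ∑ i, Z i ω) + fun ω => F (a (t + 1) ω) ω) ω ∂P =
      ∑ i, ∫ ω, Z i ω ∂P + ∑ i, ∫ ω, F i ω * runPlay M δ A S a ξ t ω i ∂P := by
    rw [← hact, ← integral_finsetSum _ fun i _ => iZ i]
    exact integral_add (integrable_finsetSum Finset.univ fun i _ => iZ i) iFa
  rw [e1] at hint
  have hZi : ∀ i, ∫ ω, Z i ω ∂P ≤ (∫ ω, Q i ω ^ 2 ∂P) +
      2 * ((∫ ω, Q i ω ∂P) * meanVec (𝒜 (t + 1)) i) + M ^ 2 := by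
    intro i
    have i1 : Integrable (fun ω => Q i ω ^ 2 + 2 * (Q i ω * A (t + 1) ω i)) P :=
      (iQ2 i).add ((iQA i).const_mul 2)
    have e := h.run.setIntegral_mul_innovation t MeasurableSet.univ
      (measurable_queue_apply (le_refl t) i) (measurable_arrival_apply t i)
    simp only [setIntegral_univ] at e
    simp only [hZ]
    rw [integral_add i1 (iA2 i), integral_add (iQ2 i) ((iQA i).const_mul 2), integral_const_mul,
      e, h.integral_arrival]
    have := h.integral_arrival_sq_le t i
    linarith
  have hFi : ∀ i, ∫ ω, F i ω * runPlay M δ A S a ξ t ω i ∂P ≤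
      M ^ 2 * (∫ ω, runPlay M δ A S a ξ t ω i ∂P) -
        2 * ((∫ ω, Q i ω * runPlay M δ A S a ξ t ω i ∂P) * meanVec (𝒮 (t + 1)) i) := by
    intro i
    have e2 := h.run.setIntegral_mul_innovation t MeasurableSet.univ
      (h.measurable_play t i) ((measurable_service_apply t i).pow_const 2)
    have hQp : Measurable[history A S a t] fun ω =>
        queueProc A S a t ω i * runPlay M δ A S a ξ t ω i :=
      (measurable_queue_apply (le_refl t) i).mul (h.measurable_play t i)
    have e3 := h.run.setIntegral_mul_innovation t MeasurableSet.univ hQp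
      (measurable_service_apply t i)
    have i2 := h.run.integrable_mul_innovation t (h.measurable_play t i)
      ((measurable_service_apply t i).pow_const 2) (h.integrable_play t i) (iS2 i)
    have i3 := h.run.integrable_mul_innovation t hQp
      (measurable_service_apply t i) (h.integrable_queue_mul_play t i) (h.integrable_service t i)
    simp only [setIntegral_univ] at e2 e3
    rw [h.integral_service] at e3
    have e4 : ∀ ω, F i ω * runPlay M δ A S a ξ t ω i =
        runPlay M δ A S a ξ t ω i * S (t + 1) ω i ^ 2 -
          2 * (queueProc A S a t ω i * runPlay M δ A S a ξ t ω i * S (t + 1) ω i) := fun ω => by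
      simp only [hF, hQ]; ring
    simp_rw [e4]
    rw [integral_sub i2 (i3.const_mul 2), integral_const_mul, e2, e3]
    have h1 := h.integral_service_sq_le t i
    have h2 : 0 ≤ ∫ ω, runPlay M δ A S a ξ t ω i ∂P :=
      integral_nonneg fun ω => (h.play_mem t ω).1 i
    have h3 := mul_le_mul_of_nonneg_left h1 h2
    simp only [hQ]
    linarith
  have hreg : ∫ ω, slotRegret M δ 𝒮 θ A S a ξ t ω ∂P =
      ∑ i, meanVec (𝒮 (t + 1)) i * (θ (t + 1) i * (∫ ω, Q i ω ∂P) -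
        ∫ ω, Q i ω * runPlay M δ A S a ξ t ω i ∂P) := by
    unfold slotRegret
    rw [integral_finsetSum _ fun i _ => (h.integrable_queue_mul_sub_play t _ i).const_mul _]
    refine Finset.sum_congr rfl fun i _ => ?_
    rw [integral_const_mul]
    simp only [mul_sub]
    rw [integral_sub ((h.integrable_queue t i).mul_const _) (h.integrable_queue_mul_play t i),
      integral_mul_const]
    simp only [hQ]
    ring
  -- A single type is served, so the squared services contribute M² in total and the arrivals KM²;
  -- together they give (K+1)M²/2.
  have hp1 : ∑ i, ∫ ω, runPlay M δ A S a ξ t ω i ∂P = 1 := by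
    rw [← integral_finsetSum _ fun i _ => h.integrable_play t i]
    simp only [(h.play_mem t _).2]
    simp
  have s1 := Finset.sum_le_sum fun i (_ : i ∈ Finset.univ) => hZi i
  have s2 := Finset.sum_le_sum fun i (_ : i ∈ Finset.univ) => hFi i
  rw [Finset.sum_sub_distrib, ← Finset.mul_sum, hp1, ← Finset.mul_sum] at s2
  rw [Finset.sum_add_distrib, Finset.sum_add_distrib, ← Finset.mul_sum] at s1
  simp only [Finset.sum_const, Finset.card_univ, Fintype.card_fin, nsmul_eq_mul] at s1
  rw [integral_const_mul, integral_const_mul, integral_finsetSum _ fun i _ => iQ2 i, hreg]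
  have e5 : ∑ i, (∫ ω, queueProc A S a t ω i ∂P) *
        (meanVec (𝒜 (t + 1)) i - θ (t + 1) i * meanVec (𝒮 (t + 1)) i) +
      ∑ i, meanVec (𝒮 (t + 1)) i * (θ (t + 1) i * (∫ ω, Q i ω ∂P) -
        ∫ ω, Q i ω * runPlay M δ A S a ξ t ω i ∂P) =
      ∑ i, (∫ ω, Q i ω ∂P) * meanVec (𝒜 (t + 1)) i -
        ∑ i, (∫ ω, Q i ω * runPlay M δ A S a ξ t ω i ∂P) * meanVec (𝒮 (t + 1)) i := by
    rw [← Finset.sum_add_distrib, ← Finset.sum_sub_distrib]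
    refine Finset.sum_congr rfl fun i _ => ?_
    simp only [hQ]
    ring
  linarith

end IsBoundedRun

/-! ### The threshold of the epoch length -/

section Rate

variable {K : ℕ} {M δ C_V ε : ℝ}

/-- Half of the decay m^{-δ/3} is given up to bound ln m by (6/δ) m^{δ/6}. -/
theorem ssmwRate_le (hK : 0 < K) (hδ : 0 < δ) (hC : 0 < C_V) {m : ℕ} (hm : 1 ≤ m) :
    ssmwRate K M δ C_V m ≤
      42 * (1 + C_V) * M ^ 2 * K * (18 / δ + Real.log K) * (m : ℝ) ^ (-(δ / 6)) := by
  have hm1 : (1 : ℝ) ≤ m := by exact_mod_cast hm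
  have hm0 : (0 : ℝ) < m := by linarith
  have h1 := Real.log_le_rpow_div hm0.le (show 0 < δ / 6 by positivity)
  have hK0 := Real.log_nonneg (by exact_mod_cast hK : (1 : ℝ) ≤ K)
  have h2 : 1 ≤ (m : ℝ) ^ (δ / 6) := Real.one_le_rpow hm1 (by positivity)
  have h3 : 3 * Real.log m + Real.log K ≤ (18 / δ + Real.log K) * (m : ℝ) ^ (δ / 6) := by
    have h4 : 3 * ((m : ℝ) ^ (δ / 6) / (δ / 6)) = 18 / δ * (m : ℝ) ^ (δ / 6) := by
      field_simp; norm_num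
    nlinarith
  have h5 : (m : ℝ) ^ (-δ / 3) * (m : ℝ) ^ (δ / 6) = (m : ℝ) ^ (-(δ / 6)) := by
    rw [← Real.rpow_add hm0]
    ring_nf
  unfold ssmwRate
  calc _ ≤ 42 * (1 + C_V) * M ^ 2 * K * (m : ℝ) ^ (-δ / 3) *
        ((18 / δ + Real.log K) * (m : ℝ) ^ (δ / 6)) := by gcongr
    _ = 42 * (1 + C_V) * M ^ 2 * K * (18 / δ + Real.log K) *
        ((m : ℝ) ^ (-δ / 3) * (m : ℝ) ^ (δ / 6)) := by ring
    _ = _ := by rw [h5]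

theorem ssmwRate_le_half (hK : 0 < K) (hM : 1 ≤ M) (hδ : 0 < δ) (hC : 0 < C_V) (hε : 0 < ε)
    {m : ℕ} (hm : 1 ≤ m)
    (hle : (84 * (1 + C_V) * M ^ 2 * K * (18 / δ + Real.log K) / ε) ^ (6 / δ) ≤ m) :
    ssmwRate K M δ C_V m ≤ ε / 2 := by
  have hm0 : (0 : ℝ) < m := by exact_mod_cast hm
  have hK1 : (1 : ℝ) ≤ K := by exact_mod_cast hK
  have hK0 := Real.log_nonneg hK1
  have hD : 0 < 84 * (1 + C_V) * M ^ 2 * K * (18 / δ + Real.log K) / ε := by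
    have : 0 < M := by linarith
    positivity
  have h1 : 84 * (1 + C_V) * M ^ 2 * K * (18 / δ + Real.log K) / ε ≤ (m : ℝ) ^ (δ / 6) := by
    have := Real.rpow_le_rpow (by positivity) hle (show 0 ≤ δ / 6 by positivity)
    rwa [← Real.rpow_mul hD.le, show 6 / δ * (δ / 6) = 1 by field_simp, Real.rpow_one] at this
  refine (ssmwRate_le hK hδ hC hm).trans ?_
  rw [Real.rpow_neg hm0.le, ← div_eq_mul_inv, div_le_iff₀ (by positivity)]
  rw [div_le_iff₀ hε] at h1
  linarith

theorem exists_isLeast_threshold (hK : 0 < K) (hM : 1 ≤ M) (hδ : 0 < δ) (hC : 0 < C_V)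
    (hε : 0 < ε) :
    ∃ m₀ : ℕ, IsLeast {m : ℕ | 2 ≤ m ∧ ∀ m' : ℕ, m ≤ m' → ssmwRate K M δ C_V m' ≤ ε / 2} m₀ ∧
      m₀ ≤ max 2 ⌈(84 * (1 + C_V) * M ^ 2 * K * (18 / δ + Real.log K) / ε) ^ (6 / δ)⌉₊ := by
  set N := max 2 ⌈(84 * (1 + C_V) * M ^ 2 * K * (18 / δ + Real.log K) / ε) ^ (6 / δ)⌉₊ with hN
  have hmem : N ∈ {m : ℕ | 2 ≤ m ∧ ∀ m' : ℕ, m ≤ m' → ssmwRate K M δ C_V m' ≤ ε / 2} := by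
    refine ⟨le_max_left _ _, fun m' hm' => ?_⟩
    have h2 : 2 ≤ m' := (le_max_left _ _).trans hm'
    refine ssmwRate_le_half hK hM hδ hC hε (by omega) ((Nat.le_ceil _).trans ?_)
    exact_mod_cast (le_max_right _ _).trans hm'
  exact ⟨sInf _, ⟨Nat.sInf_mem ⟨N, hmem⟩, fun m hm => Nat.sInf_le hm⟩, Nat.sInf_le hmem⟩

/-- From Kε ≤ M one gets B ≥ 5/2, so numerical constants are absorbed by powers of X: 84·45 = 3780 ≤
(5/2)⁹. The base is then at most X¹¹ and its power 6/δ at most X^{66/δ}. One further factor X covers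
the rounding and the minimum 2, and X ≤ X^{1/δ}. -/
theorem threshold_le (hK : 2 ≤ K) (hM : 1 ≤ M) (hδ : 0 < δ) (hδ1 : δ ≤ 1) (hC : 0 < C_V)
    (hε : 0 < ε) (hεM : K * ε ≤ M) {m₀ : ℕ}
    (hm₀ : m₀ ≤ max 2 ⌈(84 * (1 + C_V) * M ^ 2 * K * (18 / δ + Real.log K) / ε) ^ (6 / δ)⌉₊) :
    (m₀ : ℝ) ≤ (max ((1 + C_V) * M ^ 2 * K * Real.log K / ε) (1 / δ)) ^ (67 / δ) := by
  have hK2 : (2 : ℝ) ≤ K := by exact_mod_cast hK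
  have hlog : 0.6931 ≤ Real.log K :=
    (by linarith [Real.log_two_gt_d9] : (0.6931 : ℝ) ≤ Real.log 2).trans
      (Real.log_le_log two_pos hK2)
  set B := (1 + C_V) * M ^ 2 * K * Real.log K / ε with hB
  set X := max B (1 / δ) with hX
  have hM0 : 0 < M := by linarith
  have hB1 : 5 / 2 ≤ B := by
    rw [hB, le_div_iff₀ hε]
    have h1 : 1 * M * 2 * (2 * 0.6931) ≤ (1 + C_V) * (M * M) * K * (K * Real.log K) := by
      gcongr
      · linarith
      · nlinarith
    have h2 : K * (5 / 2 * ε) ≤ K * ((1 + C_V) * M ^ 2 * K * Real.log K) := by nlinarith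
    exact le_of_mul_le_mul_left h2 (by linarith)
  have hX1 : 5 / 2 ≤ X := hB1.trans (le_max_left _ _)
  have hXδ : 1 / δ ≤ X := le_max_right _ _
  have hδ1' : 1 ≤ 1 / δ := by rw [le_div_iff₀ hδ]; linarith
  have hD : 84 * (1 + C_V) * M ^ 2 * K * (18 / δ + Real.log K) / ε ≤ X ^ 11 := by
    have h1 : 18 / δ + Real.log K ≤ 45 * Real.log K * (1 / δ) := by
      have h2 : 18 / δ = 18 * (1 / δ) := by ring
      nlinarith
    calc 84 * (1 + C_V) * M ^ 2 * K * (18 / δ + Real.log K) / ε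
        ≤ 84 * (1 + C_V) * M ^ 2 * K * (45 * Real.log K * (1 / δ)) / ε := by gcongr
      _ = 3780 * (B * (1 / δ)) := by rw [hB]; ring
      _ ≤ (5 / 2) ^ 9 * (X * X) := by
          gcongr
          · norm_num
          · exact le_max_left _ _
      _ ≤ X ^ 9 * (X * X) := by gcongr
      _ = X ^ 11 := by ring
  have hX0 : 0 < X := by linarith
  have hD0 : 0 ≤ 84 * (1 + C_V) * M ^ 2 * K * (18 / δ + Real.log K) / ε := by positivity
  have hpow : (84 * (1 + C_V) * M ^ 2 * K * (18 / δ + Real.log K) / ε) ^ (6 / δ) ≤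
      X ^ (66 / δ) := by
    refine (Real.rpow_le_rpow hD0 hD (by positivity)).trans (le_of_eq ?_)
    rw [← Real.rpow_natCast, ← Real.rpow_mul hX0.le]
    congr 1
    push_cast
    ring
  have h66 : 1 ≤ X ^ (66 / δ) := Real.one_le_rpow (by linarith) (by positivity)
  have h67 : X * X ^ (66 / δ) ≤ X ^ (67 / δ) := by
    rw [← Real.rpow_one_add' hX0.le (by positivity)]
    refine Real.rpow_le_rpow_of_exponent_le (by linarith) ?_
    have e : 67 / δ = 66 / δ + 1 / δ := by ring
    linarith
  refine le_trans ?_ h67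
  have hc := Nat.ceil_lt_add_one (Real.rpow_nonneg hD0 (6 / δ))
  calc (m₀ : ℝ) ≤ (max 2 ⌈(84 * (1 + C_V) * M ^ 2 * K * (18 / δ + Real.log K) / ε) ^
        (6 / δ)⌉₊ : ℕ) := by exact_mod_cast hm₀
    _ ≤ X * X ^ (66 / δ) := by
        push_cast
        refine max_le (by nlinarith) ?_
        nlinarith

end Rate

/-! ### Windows -/

section Windows

/-- Only the average of d over the window is negative, so x_r is compared with x_0. Since x moves by
at most M per step, the error is at most M(M+ε)r in step r. The sum n(n-1)/2 of the r is at most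
(n-1)² for every integer n ≥ 1; in particular a window of one slot costs nothing. -/
theorem window_bound {M ε : ℝ} (hM : 0 ≤ M) (hε : 0 ≤ ε) {n : ℕ} (hn : 1 ≤ n) {x d : ℕ → ℝ}
    (hx0 : 0 ≤ x 0) (hx : ∀ r, |x (r + 1) - x r| ≤ M) (hd : ∀ r < n, d r ≤ M)
    (hd' : ∀ r < n, -M ≤ d r) (hsum : ∑ r ∈ Finset.range n, d r ≤ -(ε * n)) :
    ∑ r ∈ Finset.range n, x r * d r ≤
      -(ε * ∑ r ∈ Finset.range n, x r) + (M ^ 2 + ε * M) * ((n : ℝ) - 1) ^ 2 := by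
  have hdiff : ∀ r, |x r - x 0| ≤ M * r := by
    intro r
    induction r with
    | zero => simp
    | succ r ih =>
      have := abs_sub_le (x (r + 1)) (x r) (x 0)
      have := hx r
      push_cast
      linarith
  have h1 : ∑ r ∈ Finset.range n, x r * (d r + ε) ≤
      ∑ r ∈ Finset.range n, (x 0 * (d r + ε) + M * (M + ε) * r) := by
    refine Finset.sum_le_sum fun r hr => ?_
    have hr := Finset.mem_range.1 hr
    have h2 : (x r - x 0) * (d r + ε) ≤ (M * r) * (M + ε) := by
      refine (le_abs_self _).trans ?_
      rw [abs_mul]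
      refine mul_le_mul (hdiff r) ?_ (abs_nonneg _) (by positivity)
      rw [abs_le]
      constructor <;> linarith [hd r hr, hd' r hr]
    linarith
  have hgauss : ∑ r ∈ Finset.range n, (r : ℝ) = n * (n - 1) / 2 := by
    have := Finset.sum_range_id_mul_two n
    have h2 : ((∑ k ∈ Finset.range n, k : ℕ) : ℝ) * 2 = n * ((n - 1 : ℕ) : ℝ) := by
      exact_mod_cast this
    rw [Nat.cast_sub hn] at h2
    push_cast at h2
    linarith
  have h3 : ∑ r ∈ Finset.range n, (d r + ε) ≤ 0 := by
    rw [Finset.sum_add_distrib]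
    simp only [Finset.sum_const, Finset.card_range, nsmul_eq_mul]
    linarith
  rw [Finset.sum_add_distrib, ← Finset.mul_sum, ← Finset.mul_sum, hgauss] at h1
  have h4 : (n : ℝ) * (n - 1) / 2 ≤ ((n : ℝ) - 1) ^ 2 := by
    rcases hn.eq_or_lt with rfl | h
    · norm_num
    · have : (2 : ℝ) ≤ n := by exact_mod_cast h
      nlinarith
  have h5 : M * (M + ε) * ((n : ℝ) * (n - 1) / 2) ≤ M * (M + ε) * ((n : ℝ) - 1) ^ 2 :=
    mul_le_mul_of_nonneg_left h4 (by positivity)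
  have h6 := mul_nonpos_of_nonneg_of_nonpos hx0 h3
  have h7 : ∑ r ∈ Finset.range n, x r * (d r + ε) =
      ∑ r ∈ Finset.range n, x r * d r + ε * ∑ r ∈ Finset.range n, x r := by
    rw [Finset.mul_sum, ← Finset.sum_add_distrib]
    exact Finset.sum_congr rfl fun r _ => by ring
  nlinarith

variable {K : ℕ} {lam sig θ : ℕ → Fin K → ℝ} {w : ℕ → ℕ} {C_W ε M : ℝ}

theorem PiecewiseStabilizable.lt_succ (h : PiecewiseStabilizable lam sig θ w C_W ε) (i : ℕ) :
    w i < w (i + 1) := h.strictMono (Nat.lt_succ_self i)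

theorem PiecewiseStabilizable.one_le (h : PiecewiseStabilizable lam sig θ w C_W ε) (i : ℕ) :
    i + 1 ≤ w i := by
  induction i with
  | zero => rw [h.start]
  | succ i ih => have := h.lt_succ i; omega

theorem PiecewiseStabilizable.sum_drift_le (h : PiecewiseStabilizable lam sig θ w C_W ε) (i : ℕ)
    (j : Fin K) :
    ∑ t ∈ Finset.Ico (w i) (w (i + 1)), (lam t j - θ t j * sig t j) ≤
      -(ε * (w (i + 1) - w i : ℕ)) := by
  have h1 := h.drift i j
  have h2 := h.lt_succ i
  have hn : (0 : ℝ) < (w (i + 1) - w i : ℕ) := by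
    exact_mod_cast (by omega : 0 < w (i + 1) - w i)
  rw [Finset.sum_sub_distrib]
  set n : ℝ := ((w (i + 1) - w i : ℕ) : ℝ)
  have h3 := mul_le_mul_of_nonneg_left h1 hn.le
  rw [mul_add, ← mul_assoc, ← mul_assoc, mul_one_div_cancel hn.ne', one_mul, one_mul] at h3
  linarith

/-- The reference policy offers at most M units of service per slot in total, and all K queues need
a surplus ε out of it. -/
theorem PiecewiseStabilizable.card_mul_eps_le (h : PiecewiseStabilizable lam sig θ w C_W ε)
    (hlam : ∀ t, 1 ≤ t → ∀ j, 0 ≤ lam t j) (hsig : ∀ t, 1 ≤ t → ∀ j, sig t j ≤ M) :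
    K * ε ≤ M := by
  have h2 : w 0 < w 1 := h.lt_succ 0
  have hn : (0 : ℝ) < (w 1 - w 0 : ℕ) := by exact_mod_cast (by omega : 0 < w 1 - w 0)
  have h1 := Finset.sum_le_sum fun j (_ : j ∈ Finset.univ) => h.sum_drift_le 0 j
  have h3 : ∑ j, ∑ t ∈ Finset.Ico (w 0) (w (0 + 1)), (-(M * θ t j)) ≤
      ∑ j, ∑ t ∈ Finset.Ico (w 0) (w (0 + 1)), (lam t j - θ t j * sig t j) := by
    refine Finset.sum_le_sum fun j _ => Finset.sum_le_sum fun t ht => ?_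
    have ht1 : 1 ≤ t := by have := (Finset.mem_Ico.1 ht).1; rw [h.start] at this; exact this
    have h4 := mul_le_mul_of_nonneg_left (hsig t ht1 j) ((h.mem_simplex t ht1).1 j)
    have := hlam t ht1 j
    linarith
  rw [Finset.sum_comm] at h3
  have h5 : ∑ t ∈ Finset.Ico (w 0) (w (0 + 1)), ∑ j, (-(M * θ t j)) =
      -(M * (w 1 - w 0 : ℕ)) := by
    calc _ = ∑ t ∈ Finset.Ico (w 0) (w (0 + 1)), (-M) := by
          refine Finset.sum_congr rfl fun t ht => ?_
          have ht1 : 1 ≤ t := by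
            have := (Finset.mem_Ico.1 ht).1; rw [h.start] at this; exact this
          rw [Finset.sum_neg_distrib, ← Finset.mul_sum, (h.mem_simplex t ht1).2, mul_one]
      _ = _ := by simp [mul_comm]
  rw [h5] at h3
  simp only [Finset.sum_const, Finset.card_univ, Fintype.card_fin, nsmul_eq_mul, zero_add] at h1
  have h6 : (K * ε) * (w 1 - w 0 : ℕ) ≤ M * (w 1 - w 0 : ℕ) := by linarith
  exact le_of_mul_le_mul_right h6 hn

/-- The drift of the reference policy over the first `J` windows. -/
theorem PiecewiseStabilizable.sum_windows_le (h : PiecewiseStabilizable lam sig θ w C_W ε)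
    (hM : 0 ≤ M) (hlam : ∀ t, 1 ≤ t → ∀ j, 0 ≤ lam t j ∧ lam t j ≤ M)
    (hsig : ∀ t, 1 ≤ t → ∀ j, 0 ≤ sig t j ∧ sig t j ≤ M) {e : ℕ → Fin K → ℝ}
    (he0 : ∀ t j, 0 ≤ e t j) (he : ∀ t j, |e (t + 1) j - e t j| ≤ M) (J : ℕ) :
    ∑ t ∈ Finset.range (w J - 1), ∑ j, e t j * (lam (t + 1) j - θ (t + 1) j * sig (t + 1) j) ≤
      -(ε * ∑ t ∈ Finset.range (w J - 1), ∑ j, e t j) +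
        (K * M ^ 2 + ε * K * M) *
          ∑ i ∈ Finset.range J, (((w (i + 1) - w i : ℕ) : ℝ) - 1) ^ 2 := by
  induction J with
  | zero => simp [h.start]
  | succ J ih =>
    have h1 := h.one_le J
    have h2 := h.lt_succ J
    -- Slot t+1 is weighted by the queue at time t, hence the shift by one between the window and
    -- the range of times.
    have hsplit : w (J + 1) - 1 = (w J - 1) + (w (J + 1) - w J) := by omega
    have hwin : ∀ j, ∑ r ∈ Finset.range (w (J + 1) - w J), e (w J - 1 + r) j *
          (lam (w J - 1 + r + 1) j - θ (w J - 1 + r + 1) j * sig (w J - 1 + r + 1) j) ≤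
        -(ε * ∑ r ∈ Finset.range (w (J + 1) - w J), e (w J - 1 + r) j) +
          (M ^ 2 + ε * M) * (((w (J + 1) - w J : ℕ) : ℝ) - 1) ^ 2 := by
      intro j
      have hb : ∀ t, 1 ≤ t → lam t j - θ t j * sig t j ≤ M ∧ -M ≤ lam t j - θ t j * sig t j := by
        intro t ht
        have hθ0 := (h.mem_simplex t ht).1 j
        have hθ1 := le_one_of_mem_stdSimplex (h.mem_simplex t ht) j
        have := hlam t ht j
        have := hsig t ht j
        constructor <;> nlinarith
      refine window_bound (x := fun r => e (w J - 1 + r) j)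
        (d := fun r => lam (w J - 1 + r + 1) j - θ (w J - 1 + r + 1) j * sig (w J - 1 + r + 1) j)
        hM h.eps_pos.le (by omega) (he0 _ _)
        (fun r => he _ _) (fun r _ => (hb _ (by omega)).1) (fun r _ => (hb _ (by omega)).2) ?_
      have h3 := h.sum_drift_le J j
      rw [Finset.sum_Ico_eq_sum_range] at h3
      refine le_trans (le_of_eq (Finset.sum_congr rfl fun r _ => ?_)) h3
      rw [show w J - 1 + r + 1 = w J + r by omega]
    have hs := Finset.sum_le_sum fun j (_ : j ∈ Finset.univ) => hwin j
    rw [Finset.sum_add_distrib, Finset.sum_neg_distrib, ← Finset.mul_sum, Finset.sum_comm,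
      Finset.sum_comm (s := Finset.univ) (t := Finset.range (w (J + 1) - w J))
        (f := fun j r => e (w J - 1 + r) j)] at hs
    simp only [Finset.sum_const, Finset.card_univ, Fintype.card_fin, nsmul_eq_mul] at hs
    rw [hsplit, Finset.sum_range_add, Finset.sum_range_add, Finset.sum_range_succ]
    linarith

/-- A horizon that is the end of a window. -/
theorem PiecewiseStabilizable.exists_horizon (h : PiecewiseStabilizable lam sig θ w C_W ε)
    (T : ℕ) : ∃ J, T + 1 ≤ w J - 1 ∧
      ∑ i ∈ Finset.range J, (((w (i + 1) - w i : ℕ) : ℝ) - 1) ^ 2 ≤ C_W * (T + 2) ∧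
      ((w J - 1 : ℕ) : ℝ) ≤ T + 1 + Real.sqrt (C_W * (T + 2)) := by
  have hex : ∃ J, T + 2 ≤ w J := ⟨T + 1, h.one_le (T + 1)⟩
  classical
  obtain ⟨J, hJ, hmin⟩ : ∃ J, T + 2 ≤ w J ∧ ∀ i < J, w i < T + 2 :=
    ⟨Nat.find hex, Nat.find_spec hex, fun i hi => not_le.1 (Nat.find_min hex hi)⟩
  -- With J minimal, the last window still starts before T+2, so it occurs in this sum; its length
  -- is therefore at most 1 + √(C_W(T+2)).
  have hw := h.windows (T + 2) (by omega)
  have hsub : Finset.range J ⊆ (Finset.range (T + 2)).filter fun i => w i < T + 2 := by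
    intro i hi
    have h1 := hmin i (Finset.mem_range.1 hi)
    have := h.one_le i
    simp only [Finset.mem_filter, Finset.mem_range]
    omega
  have hsum : ∑ i ∈ Finset.range J, (((w (i + 1) - w i : ℕ) : ℝ) - 1) ^ 2 ≤ C_W * (T + 2) := by
    refine (Finset.sum_le_sum_of_subset_of_nonneg hsub fun _ _ _ => sq_nonneg _).trans ?_
    exact_mod_cast hw
  refine ⟨J, by omega, hsum, ?_⟩
  rcases J with _ | J
  · rw [h.start] at hJ; omega
  have h1 := hmin J (by omega)
  have h2 := h.lt_succ J
  have h3 : (((w (J + 1) - w J : ℕ) : ℝ) - 1) ^ 2 ≤ C_W * (T + 2) :=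
    (Finset.single_le_sum (f := fun i => (((w (i + 1) - w i : ℕ) : ℝ) - 1) ^ 2)
      (fun _ _ => sq_nonneg _) (Finset.mem_range.2 (Nat.lt_succ_self J))).trans hsum
  have h4 := Real.le_sqrt_of_sq_le h3
  have h5 : w (J + 1) - 1 ≤ T + (w (J + 1) - w J) := by
    omega
  have h6 : ((w (J + 1) - 1 : ℕ) : ℝ) ≤ T + (w (J + 1) - w J : ℕ) := by exact_mod_cast h5
  linarith

end Windows

/-! ### Queue lengths over a finite horizon -/

namespace IsBoundedRun

variable {Ω : Type*} {K : ℕ} {M δ α C_W C_V ε : ℝ} {A S : ℕ → Ω → Fin K → ℝ} {a : ℕ → Ω → Fin K}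
  {ξ : ℕ → Ω → Fin K → ℝ} [MeasurableSpace Ω] {P : Measure Ω} {𝒜 𝒮 : ℕ → Measure (Fin K → ℝ)}
  {θ : ℕ → Fin K → ℝ} {w : ℕ → ℕ} {m₀ : ℕ}

theorem expTotalQueue_eq (t : ℕ) :
    expTotalQueue P A S a t = ∫ ω, ∑ i, queueProc A S a t ω i ∂P := by
  unfold expTotalQueue
  simp only [abs_of_nonneg (queueProc_nonneg _ _ _)]

theorem expTotalQueue_nonneg (t : ℕ) : 0 ≤ expTotalQueue P A S a t :=
  integral_nonneg fun _ => Finset.sum_nonneg fun _ _ => abs_nonneg _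

theorem abs_integral_queue_succ_sub_le (h : IsBoundedRun P M δ α 𝒜 𝒮 A S a ξ) (t : ℕ)
    (i : Fin K) :
    |(∫ ω, queueProc A S a (t + 1) ω i ∂P) - ∫ ω, queueProc A S a t ω i ∂P| ≤ M := by
  have := h.prob
  have h1 := h.setIntegral_queue_succ_le (t := t) MeasurableSet.univ i
  have h2 := h.le_setIntegral_queue_succ (t := t) MeasurableSet.univ i
  simp only [setIntegral_univ, probReal_univ, mul_one] at h1 h2
  rw [abs_le]
  constructor <;> linarith

/-- The horizon is the end of a window, so that the averaged drift condition can be used on complete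
windows. -/
theorem sum_expTotalQueue_le (h : IsBoundedRun P M δ α 𝒜 𝒮 A S a ξ) (hδ1 : δ ≤ 1)
    (hC : 0 < C_V)
    (hW : PiecewiseStabilizable (fun t => meanVec (𝒜 t)) (fun t => meanVec (𝒮 t)) θ w C_W ε)
    (hV : TimeHomogeneousVariation θ C_V δ) (hεM : ε ≤ M) (hm₀ : 2 ≤ m₀)
    (hrate : ∀ m, m₀ ≤ m → ssmwRate K M δ C_V m ≤ ε / 2) (J : ℕ) :
    ε / 2 * ∑ t ∈ Finset.range (w J - 1), expTotalQueue P A S a t ≤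
      ((K + 1) * M ^ 2 / 2 + 3 * M ^ 2 * m₀) * (w J - 1 : ℕ) +
        (K * M ^ 2 + ε * K * M) *
          ∑ i ∈ Finset.range J, (((w (i + 1) - w i : ℕ) : ℝ) - 1) ^ 2 := by
  have := h.prob
  have hwin := hW.sum_windows_le (e := fun t i => ∫ ω, queueProc A S a t ω i ∂P) h.nonneg
    (fun t ht j => ⟨(h.arrival t ht).meanVec_nonneg j,
      (h.arrival t ht).meanVec_le h.two_le h.one_le j⟩)
    (fun t ht j => ⟨(h.service t ht).meanVec_nonneg j,
      (h.service t ht).meanVec_le h.two_le h.one_le j⟩)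
    (fun t j => integral_nonneg fun ω => queueProc_nonneg _ _ _)
    h.abs_integral_queue_succ_sub_le J
  set T := w J - 1 with hT
  have hreg := h.sum_slotRegret_le hδ1 hC hW.mem_simplex hV hW.eps_pos hεM hm₀ hrate T
  have hdrift : ∀ N : ℕ, ∫ ω, 1 / 2 * ∑ i, queueProc A S a N ω i ^ 2 ∂P ≤
      ∑ t ∈ Finset.range N, ∑ i, (∫ ω, queueProc A S a t ω i ∂P) *
        (meanVec (𝒜 (t + 1)) i - θ (t + 1) i * meanVec (𝒮 (t + 1)) i) +
      ∑ t ∈ Finset.range N, (∫ ω, slotRegret M δ 𝒮 θ A S a ξ t ω ∂P) +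
        (K + 1) * M ^ 2 / 2 * N := by
    intro N
    induction N with
    | zero => simp [queueProc, queueLength]
    | succ N ih =>
      have := h.lyapunov_drift θ N
      rw [Finset.sum_range_succ, Finset.sum_range_succ]
      push_cast
      linarith
  have hd := hdrift T
  have e1 : ∀ t, expTotalQueue P A S a t = ∑ i, ∫ ω, queueProc A S a t ω i ∂P := fun t => by
    rw [expTotalQueue_eq, integral_finsetSum _ fun i _ => h.integrable_queue t i]
  have e2 : ∀ t, ∫ ω, ∑ i, queueProc A S a t ω i ∂P = expTotalQueue P A S a t := fun t =>
    (expTotalQueue_eq t).symm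
  simp only [e2] at hreg
  simp only [← e1] at hwin
  -- The term E V_T, on the left in `hd` and on the right in `hreg`, cancels; of the drift -ε from
  -- the windows the regret leaves -ε/2.
  linarith

end IsBoundedRun

theorem mainTheorem5 :
    ∃ c : ℝ, 0 < c ∧
      ∀ (K : ℕ) (M δ α C_W C_V ε : ℝ)
        (𝒜 𝒮 : ℕ → Measure (Fin K → ℝ)) (θ : ℕ → Fin K → ℝ) (w : ℕ → ℕ)
        (Ω : Type*) [MeasurableSpace Ω] (P : Measure Ω) [IsProbabilityMeasure P]
        (A S : ℕ → Ω → Fin K → ℝ) (a : ℕ → Ω → Fin K) (ξ : ℕ → Ω → Fin K → ℝ),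
        1 ≤ M → 0 < δ → δ ≤ 1 → 2 ≤ α → 0 < C_V →
        (∀ t, 1 ≤ t → HasBoundedMoments α M (𝒜 t)) →
        (∀ t, 1 ≤ t → HasBoundedMoments α M (𝒮 t)) →
        PiecewiseStabilizable (fun t => meanVec (𝒜 t)) (fun t => meanVec (𝒮 t)) θ w C_W ε →
        TimeHomogeneousVariation θ C_V δ →
        IsSSMWPlusRun P M δ 𝒜 𝒮 A S a ξ →
        ∃ m₀ : ℕ,
          IsLeast {m : ℕ | 2 ≤ m ∧ ∀ m' : ℕ, m ≤ m' → ssmwRate K M δ C_V m' ≤ ε / 2} m₀ ∧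
          (2 ≤ K → (m₀ : ℝ) ≤
            (max ((1 + C_V) * M ^ 2 * K * Real.log K / ε) (1 / δ)) ^ (c / δ)) ∧
          (∀ t, Integrable (fun ω => ∑ i, |queueProc A S a t ω i|) P) ∧
          (∀ T : ℕ, 0 < C_W → 4 / C_W + C_W ≤ T →
            (1 / (T : ℝ)) * ∑ t ∈ Finset.Icc 1 T, expTotalQueue P A S a t ≤
              (3 * K * M ^ 2 * m₀ + (K + 1) * M ^ 2 / 2 +
                (K * M ^ 2 + ε * K * M) * C_W + 4 * M ^ 2) * (10 / ε)) ∧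
          (∃ C : ℝ, ∀ T : ℕ, 1 ≤ T →
            (1 / (T : ℝ)) * ∑ t ∈ Finset.range T, expTotalQueue P A S a t ≤ C) := by
  refine ⟨67, by norm_num, ?_⟩
  intro K M δ α C_W C_V ε 𝒜 𝒮 θ w Ω _ P _ A S a ξ hM hδ hδ1 hα hC h𝒜 h𝒮 hW hV hrun
  have h : IsBoundedRun P M δ α 𝒜 𝒮 A S a ξ := ⟨hrun, inferInstance, hM, hδ, hα, h𝒜, h𝒮⟩
  have hK := h.card_pos
  have hK1 : (1 : ℝ) ≤ K := by exact_mod_cast hK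
  have hε := hW.eps_pos
  have hKε : K * ε ≤ M := hW.card_mul_eps_le (fun t ht j => (h𝒜 t ht).meanVec_nonneg j)
    fun t ht j => (h𝒮 t ht).meanVec_le hα hM j
  have hεM : ε ≤ M := (le_mul_of_one_le_left hε.le hK1).trans hKε
  obtain ⟨m₀, hleast, hm₀⟩ := exists_isLeast_threshold hK hM hδ hC hε
  have hsum := h.sum_expTotalQueue_le hδ1 hC hW hV hεM hleast.1.1 hleast.1.2
  have hM0 : 0 < M := by linarith
  set X := (K + 1) * M ^ 2 / 2 + 3 * M ^ 2 * m₀ with hX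
  set Y := K * M ^ 2 + ε * K * M with hY
  have hX0 : 0 ≤ X := by positivity
  have hY0 : 0 ≤ Y := by positivity
  -- Queue lengths are nonnegative, so T may be enlarged to the end of a window and the set of times
  -- is arbitrary; this serves the sums over 1,…,T and over 0,…,T-1 alike.
  have hhor : ∀ T : ℕ, ∀ s : Finset ℕ, s ⊆ Finset.range (T + 1) →
      ε / 2 * ∑ t ∈ s, expTotalQueue P A S a t ≤
        X * (T + 1 + Real.sqrt (C_W * (T + 2))) + Y * (C_W * (T + 2)) := by
    intro T s hs
    obtain ⟨J, hJ1, hJ2, hJ3⟩ := hW.exists_horizon T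
    have h1 : ∑ t ∈ s, expTotalQueue P A S a t ≤
        ∑ t ∈ Finset.range (w J - 1), expTotalQueue P A S a t :=
      Finset.sum_le_sum_of_subset_of_nonneg
        (hs.trans (Finset.range_subset_range.2 hJ1))
        fun _ _ _ => IsBoundedRun.expTotalQueue_nonneg _
    have h2 := mul_le_mul_of_nonneg_left h1 (half_pos hε).le
    have h3 := mul_le_mul_of_nonneg_left hJ2 hY0
    have h4 := mul_le_mul_of_nonneg_left hJ3 hX0
    have := hsum J
    linarith
  refine ⟨m₀, hleast, fun hK2 => threshold_le hK2 hM hδ hδ1 hC hε hKε hm₀, fun t => ?_, ?_, ?_⟩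
  · exact integrable_finsetSum _ fun i _ => (h.integrable_queue t i).abs
  · intro T hCW hT
    have hT4 : 4 ≤ (T : ℝ) := by
      have : 4 ≤ 4 / C_W + C_W := by
        rw [div_add' _ _ _ hCW.ne', le_div_iff₀ hCW]
        nlinarith [sq_nonneg (C_W - 2)]
      linarith
    have hCT : C_W ≤ T := by
      have : 0 < 4 / C_W := by positivity
      linarith
    have h1 := hhor T (Finset.Icc 1 T) fun t ht => by
      have := Finset.mem_Icc.1 ht
      exact Finset.mem_range.2 (by omega)
    -- Here C_W ≤ T enters. Then T + 1 + (T + 2) ≤ 5T as T ≥ 4, and dividing by ε/2 produces the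
    -- factor 10/ε.
    have hsqrt : Real.sqrt (C_W * (T + 2)) ≤ T + 2 := by
      rw [Real.sqrt_le_left (by linarith)]
      nlinarith
    set E := ∑ t ∈ Finset.Icc 1 T, expTotalQueue P A S a t
    have h2 : ε / 2 * E ≤ 5 * T * (X + Y * C_W) := by
      have h3 : X * (T + 1 + Real.sqrt (C_W * (T + 2))) ≤ X * (5 * T) := by
        gcongr; linarith
      have h4 : Y * (C_W * (T + 2)) ≤ Y * (C_W * (5 * T)) := by
        gcongr; linarith
      linarith
    have h5 : X + Y * C_W ≤ 3 * K * M ^ 2 * m₀ + (K + 1) * M ^ 2 / 2 + Y * C_W + 4 * M ^ 2 := by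
      have h6 : M ^ 2 * m₀ ≤ K * (M ^ 2 * m₀) := le_mul_of_one_le_left (by positivity) hK1
      have h7 : 0 ≤ M ^ 2 := by positivity
      rw [hX]
      linarith
    have hT0 : (0 : ℝ) < T := by linarith
    have h8 : 1 / (T : ℝ) * E ≤ (X + Y * C_W) * (10 / ε) := by
      rw [one_div_mul_eq_div, div_le_iff₀ hT0]
      have h9 : (X + Y * C_W) * (10 / ε) * T = (5 * T * (X + Y * C_W)) / (ε / 2) := by
        field_simp; ring
      rw [h9, le_div_iff₀ (by positivity)]
      linarith
    exact h8.trans (mul_le_mul_of_nonneg_right h5 (by positivity))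
  · refine ⟨(X * (C_W + 5) + Y * (C_W * 3)) / (ε / 2), fun T hT => ?_⟩
    have hT1 : (1 : ℝ) ≤ T := by exact_mod_cast hT
    have hCW := hW.C_nonneg
    have h1 := hhor T (Finset.range T) (Finset.range_subset_range.2 (by omega))
    -- A cruder bound that needs neither C_W > 0 nor a large T.
    have hsqrt : Real.sqrt (C_W * (T + 2)) ≤ C_W + (T + 2) := by
      rw [Real.sqrt_le_left (by positivity)]
      nlinarith
    set E := ∑ t ∈ Finset.range T, expTotalQueue P A S a t
    rw [one_div_mul_eq_div, div_le_iff₀ (by linarith), div_mul_eq_mul_div,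
      le_div_iff₀ (by positivity)]
    have h3 : X * (T + 1 + Real.sqrt (C_W * (T + 2))) ≤ X * ((C_W + 5) * T) := by
      gcongr
      nlinarith
    have h4 : Y * (C_W * (T + 2)) ≤ Y * (C_W * (3 * T)) := by
      gcongr; linarith
    linarith
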